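/- \textbf{Proposition.} All groups are finite and all fusion systems are saturated. A $2$-group $Q$ has rank $2$ if $|Q:\Phi(Q)|=4$. Write $[x,y]=xyx^{-1}y^{-1}$, $[x,x,y]=[x,[x,y]]$, $[y,x,y]=[y,[x,y]]$, ${}^ax=axa^{-1}$, $Q'=[Q,Q]$ and $K_3(Q)=[Q',Q]$. Let $\mathcal F$ be a fusion system on a finite $2$-group $P$. A subgroup $Q\le P$ is called $\mathcal F$-essential if it is fully $\mathcal F$-normalized and $\mathcal F$-centric, and $\operatorname{Out}_{\mathcal F}(Q)=\operatorname{Aut}_{\mathcal F}(Q)/\operatorname{Inn}(Q)$ contains a strongly $2$-embedded subgroup $H$, i.e. $2$ divides $|H|$, $|\operatorname{Out}_{\mathcal F}(Q):H|$ is odd and greater than $1$, and $|H\cap xHx^{-1}|$ is odd for all $x\in\operatorname{Out}_{\mathcal F}(Q)\setminus H$. If $Q\le P$ is an $\mathcal F$-essential subgroup of rank $2$, then one of the following holds: \begin{enumerate} \item[(i)] $Q\cong C_2^2$, and $P\cong D_{2^n}$ for some $n\ge 3$ or $P\cong SD_{2^n}$ for some $n\ge 4$. \item[(ii)] $Q\cong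 Q_8$, and $P\cong Q_{2^n}$ for some $n\ge 3$ or $P\cong SD_{2^n}$ for some $n\ge 4$. \item[(iii)] $Q\cong C_{2^r}^2$ and $P\cong C_{2^r}\wr C_2$ for some $r\ge 2$. \item[(iv)] For some $r\ge 2$, \[N_P(Q)/\Phi(Q')K_3(Q)\cong\langle x,y,a\mid x^{2^r}=[x,y]^2=[x,x,y]=[y,x,y]=1,\ a^2=[x,y]^k,\ {}^ax=y\rangle\] for some $k\in\{0,1\}$. The two groups so presented (for $k=0$ and $k=1$) are not isomorphic, and both have order $2^{2(r+1)}\ge 2^6$. Moreover, $N_P(Q)/Q'\cong C_{2^r}\wr C_2$, and $Q/\Phi(Q')K_3(Q)$ is minimal nonabelian of type $(r,r)$, that is, \[Q/\Phi(Q')K_3(Q)\cong\langle x,y\mid x^{2^r}=y^{2^r}=[x,y]^2=[x,x,y]=[y,x,y]=1\rangle.\] If $|\Phi(Q')K_3(Q)|=2$, then \[Q\cong\begin{cases}\langle x,y\mid x^8=[x,x,y]=[y,x,y]=1,\ x^4=y^4=[x,y]^2\rangle&\text{if }r=2,\\ \langle x,y\mid x^{2^r}=y^{2^r}=[x,y]^4=[x,x,y]=[y,x,y]=1\rangle&\text{if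 }r\ge 3.\end{cases}\] \end{enumerate} Here $C_m$ is the cyclic group of order $m$, and $D_{2^n}$, $SD_{2^n}$, $Q_{2^n}$ are the dihedral, semidihedral and quaternion groups of order $2^n$. -/

import Mathlib

open scoped commutatorElement

/-! ### Fusion systems -/

/-- A (not necessarily saturated) fusion system on a group `P`: a category whose objects are the
subgroups of `P` and whose morphisms `Hom Q R` are injective group homomorphisms, such that
conjugations by elements of `P` (in particular all inclusions) are morphisms, and every morphism is
the composition of an isomorphism of the category with an inclusion. -/
structure FusionSystem (P : Type*) [Group P] where
  /-- The set of morphisms from `Q` to `R`. -/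
  Hom : (Q R : Subgroup P) → Set (Q →* R)
  injective_of_mem : ∀ {Q R : Subgroup P} {φ : Q →* R}, φ ∈ Hom Q R → Function.Injective φ
  conj_mem : ∀ {Q R : Subgroup P} (φ : Q →* R) (g : P),
    (∀ u : Q, (φ u : P) = g * (u : P) * g⁻¹) → φ ∈ Hom Q R
  comp_mem : ∀ {Q R S : Subgroup P} {φ : Q →* R} {ψ : R →* S},
    φ ∈ Hom Q R → ψ ∈ Hom R S → ψ.comp φ ∈ Hom Q S
  /-- The isomorphism `e` from `Q` onto its image under `φ`, and its inverse, are morphisms. -/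
  iso_mem : ∀ {Q R : Subgroup P} {φ : Q →* R}, φ ∈ Hom Q R →
    ∀ (S : Subgroup P) (e : Q ≃* S), (∀ u : Q, (e u : P) = (φ u : P)) →
      e.toMonoidHom ∈ Hom Q S ∧ e.symm.toMonoidHom ∈ Hom S Q

/-- `Aut_P(Q)`: the automorphisms of `Q` induced by conjugation with elements of `N_P(Q)`. -/
def conjAut {P : Type*} [Group P] (Q : Subgroup P) : Subgroup (MulAut Q) :=
  Q.normalizerMonoidHom.range

/-- `Inn(Q)`. -/
def innerAut (Q : Type*) [Group Q] : Subgroup (MulAut Q) :=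
  (MulAut.conj : Q →* MulAut Q).range

instance innerAut_normal (Q : Type*) [Group Q] : (innerAut Q).Normal := by
  constructor
  rintro _ ⟨g, rfl⟩ α
  refine ⟨α g, ?_⟩
  ext x
  simp [MulAut.conj_apply]

/-- A subgroup `H` of `G` is strongly `p`-embedded if `p ∣ |H|`, `p ∤ |G : H| > 1`, and
`p ∤ |H ∩ xHx⁻¹|` for all `x ∈ G \ H`. -/
def IsStronglyEmbedded (p : ℕ) {G : Type*} [Group G] (H : Subgroup G) : Prop :=
  p ∣ Nat.card H ∧ ¬ p ∣ H.index ∧ 1 < H.index ∧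
    ∀ x : G, x ∉ H → ¬ p ∣ Nat.card (H ⊓ H.map (MulAut.conj x).toMonoidHom : Subgroup G)

/-- For an isomorphism `φ : Q → R` between subgroups of `P`, the group `N_φ` of all `y ∈ N_P(Q)`
such that `φ ∘ c_y ∘ φ⁻¹` is conjugation by some element of `N_P(R)`. -/
def extensionSubgroup {P : Type*} [Group P] {Q R : Subgroup P} (φ : Q ≃* R) : Subgroup P :=
  (((conjAut R).comap (MulAut.congr φ).toMonoidHom).comap Q.normalizerMonoidHom).map
    (Subgroup.normalizer (Q : Set P)).subtype

theorem mem_extensionSubgroup {P : Type*} [Group P] {Q R : Subgroup P} (φ : Q ≃* R) (y : P) :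
    y ∈ extensionSubgroup φ ↔ ∃ hy : y ∈ Subgroup.normalizer (Q : Set P),
      ∃ z ∈ Subgroup.normalizer (R : Set P), ∀ u : Q,
        (φ (Q.normalizerMonoidHom ⟨y, hy⟩ u) : P) = z * (φ u : P) * z⁻¹ := by
  constructor
  · rintro ⟨⟨y, hy⟩, ⟨z, hz⟩, rfl⟩
    refine ⟨hy, z, z.2, fun u => ?_⟩
    have := congrArg (fun f : MulAut R => (f (φ u) : P)) hz
    simpa using this.symm
  · rintro ⟨hy, z, hz, h⟩
    refine ⟨⟨y, hy⟩, ⟨⟨z, hz⟩, ?_⟩, rfl⟩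
    ext r
    have := h (φ.symm r)
    simpa using this.symm

theorem le_extensionSubgroup {P : Type*} [Group P] {Q R : Subgroup P} (φ : Q ≃* R) :
    Q ≤ extensionSubgroup φ := by
  intro y hy
  rw [mem_extensionSubgroup]
  refine ⟨Subgroup.le_normalizer hy, φ ⟨y, hy⟩, Subgroup.le_normalizer (φ ⟨y, hy⟩).2, fun u => ?_⟩
  have : Q.normalizerMonoidHom ⟨y, Subgroup.le_normalizer hy⟩ u = ⟨y, hy⟩ * u * ⟨y, hy⟩⁻¹ := by
    ext
    simp
  rw [this]
  simp

namespace FusionSystem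

variable {P : Type*} [Group P]

/-- `Q` and `R` are `F`-isomorphic. -/
def IsIsomorphic (F : FusionSystem P) (Q R : Subgroup P) : Prop :=
  ∃ e : Q ≃* R, e.toMonoidHom ∈ F.Hom Q R

/-- `Aut_F(Q)`. -/
def aut (F : FusionSystem P) (Q : Subgroup P) : Subgroup (MulAut Q) where
  carrier := {α | MulEquiv.toMonoidHom α ∈ F.Hom Q Q}
  one_mem' := F.conj_mem _ 1 (by intro u; simp)
  mul_mem' := by
    intro α β hα hβ
    exact F.comp_mem hβ hα
  inv_mem' := by
    intro α hα
    exact (F.iso_mem hα Q α (fun _ => rfl)).2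

/-- `Out_F(Q) = Aut_F(Q) / Inn(Q)`. -/
abbrev Out (F : FusionSystem P) (Q : Subgroup P) : Type _ :=
  F.aut Q ⧸ (innerAut Q).subgroupOf (F.aut Q)

def IsFullyNormalized (F : FusionSystem P) (Q : Subgroup P) : Prop :=
  ∀ R : Subgroup P, F.IsIsomorphic Q R →
    Nat.card (Subgroup.normalizer (R : Set P)) ≤ Nat.card (Subgroup.normalizer (Q : Set P))

def IsFullyCentralized (F : FusionSystem P) (Q : Subgroup P) : Prop :=
  ∀ R : Subgroup P, F.IsIsomorphic Q R →
    Nat.card (Subgroup.centralizer (R : Set P)) ≤ Nat.card (Subgroup.centralizer (Q : Set P))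

/-- `Q` is `F`-centric if `C_P(R) = Z(R)` for every `R` that is `F`-isomorphic to `Q`. -/
def IsCentric (F : FusionSystem P) (Q : Subgroup P) : Prop :=
  ∀ R : Subgroup P, F.IsIsomorphic Q R →
    Subgroup.centralizer (R : Set P) = (Subgroup.center R).map R.subtype

/-- The fusion system `F` is saturated (at the prime `p`): if `Q` is fully normalized, then it is
fully centralized and `Aut_P(Q)` is a Sylow `p`-subgroup of `Aut_F(Q)`; and every isomorphism
`φ : Q → R` in `F` with `R` fully centralized extends to a morphism `N_φ → P`. -/
structure IsSaturated (p : ℕ) (F : FusionSystem P) : Prop where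
  fullyCentralized : ∀ Q : Subgroup P, F.IsFullyNormalized Q → F.IsFullyCentralized Q
  sylow : ∀ Q : Subgroup P, F.IsFullyNormalized Q →
    ∃ S : Sylow p (F.aut Q), (S : Subgroup (F.aut Q)) = (conjAut Q).subgroupOf (F.aut Q)
  extension : ∀ (Q R : Subgroup P) (φ : Q ≃* R), φ.toMonoidHom ∈ F.Hom Q R →
    F.IsFullyCentralized R →
    ∃ ψ : extensionSubgroup φ →* (⊤ : Subgroup P), ψ ∈ F.Hom (extensionSubgroup φ) ⊤ ∧
      ∀ u : Q, (ψ ⟨u, le_extensionSubgroup φ u.2⟩ : P) = (φ u : P)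

/-- `Q` is `F`-essential: fully `F`-normalized, `F`-centric, and `Out_F(Q)` contains a strongly
`p`-embedded subgroup. -/
structure IsEssential (p : ℕ) (F : FusionSystem P) (Q : Subgroup P) : Prop where
  fullyNormalized : F.IsFullyNormalized Q
  centric : F.IsCentric Q
  stronglyEmbedded : ∃ H : Subgroup (F.Out Q), IsStronglyEmbedded p H

end FusionSystem

/-! ### Commutators and Frattini subgroups of a subgroup -/

/-- `Φ(Q')K₃(Q)` as a subgroup of the ambient group, where `Q' = [Q, Q]`, `K₃(Q) = [[Q, Q], Q]`. -/
def frattiniCommK3 {P : Type*} [Group P] (Q : Subgroup P) : Subgroup P :=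
  (frattini (⁅Q, Q⁆ : Subgroup P)).map (⁅Q, Q⁆ : Subgroup P).subtype ⊔ ⁅⁅Q, Q⁆, Q⁆

theorem normalizer_le_normalizer_commutator {P : Type*} [Group P] (H K : Subgroup P) :
    Subgroup.normalizer (H : Set P) ⊓ Subgroup.normalizer (K : Set P) ≤
      Subgroup.normalizer ((⁅H, K⁆ : Subgroup P) : Set P) := by
  rintro g ⟨hH, hK⟩
  have hH' := Subgroup.mem_normalizer_iff_map_conj_eq.mp hH
  have hK' := Subgroup.mem_normalizer_iff_map_conj_eq.mp hK
  rw [Subgroup.mem_normalizer_iff_map_conj_eq, Subgroup.map_commutator, hH', hK']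

theorem normalizer_le_normalizer_map {P : Type*} [Group P] (H : Subgroup P) (C : Subgroup H)
    [hC : C.Characteristic] :
    Subgroup.normalizer (H : Set P) ≤ Subgroup.normalizer ((C.map H.subtype : Subgroup P) : Set P) := by
  rw [Subgroup.le_normalizer_iff]
  rintro g hg _ ⟨c, hc, rfl⟩
  refine ⟨H.normalizerMonoidHom ⟨g, hg⟩ c, ?_, by simp⟩
  have := hC.fixed (H.normalizerMonoidHom ⟨g, hg⟩)
  have hc' : c ∈ C.comap (H.normalizerMonoidHom ⟨g, hg⟩).toMonoidHom := by rw [this]; exact hc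
  exact hc'

theorem normalizer_le_normalizer_derived {P : Type*} [Group P] (Q : Subgroup P) :
    Subgroup.normalizer (Q : Set P) ≤ Subgroup.normalizer ((⁅Q, Q⁆ : Subgroup P) : Set P) :=
  (le_inf le_rfl le_rfl).trans (normalizer_le_normalizer_commutator Q Q)

theorem normalizer_le_normalizer_frattiniCommK3 {P : Type*} [Group P] (Q : Subgroup P) :
    Subgroup.normalizer (Q : Set P) ≤ Subgroup.normalizer (frattiniCommK3 Q : Set P) := by
  have h1 := (normalizer_le_normalizer_derived Q).trans
    (normalizer_le_normalizer_map ⁅Q, Q⁆ (frattini (⁅Q, Q⁆ : Subgroup P)))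
  have h2 := (le_inf (normalizer_le_normalizer_derived Q) le_rfl).trans
    (normalizer_le_normalizer_commutator ⁅Q, Q⁆ Q)
  intro g hg
  have e1 := Subgroup.mem_normalizer_iff_map_conj_eq.mp (h1 hg)
  have e2 := Subgroup.mem_normalizer_iff_map_conj_eq.mp (h2 hg)
  rw [Subgroup.mem_normalizer_iff_map_conj_eq, frattiniCommK3, Subgroup.map_sup, e1, e2]

instance derived_subgroupOf_normalizer_normal {P : Type*} [Group P] (Q : Subgroup P) :
    ((⁅Q, Q⁆ : Subgroup P).subgroupOf (Subgroup.normalizer (Q : Set P))).Normal :=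
  Subgroup.normal_subgroupOf_of_le_normalizer (normalizer_le_normalizer_derived Q)

instance frattiniCommK3_subgroupOf_normalizer_normal {P : Type*} [Group P] (Q : Subgroup P) :
    ((frattiniCommK3 Q).subgroupOf (Subgroup.normalizer (Q : Set P))).Normal :=
  Subgroup.normal_subgroupOf_of_le_normalizer (normalizer_le_normalizer_frattiniCommK3 Q)

instance frattiniCommK3_subgroupOf_normal {P : Type*} [Group P] (Q : Subgroup P) :
    ((frattiniCommK3 Q).subgroupOf Q).Normal :=
  Subgroup.normal_subgroupOf_of_le_normalizer
    (Subgroup.le_normalizer.trans (normalizer_le_normalizer_frattiniCommK3 Q))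

/-! ### The groups that occur

Mathlib's `DihedralGroup m` has order `2 * m`, and `QuaternionGroup m` has order `4 * m`. -/

/-- The cyclic group `C_n`, written multiplicatively. -/
abbrev Cyc (n : ℕ) : Type := Multiplicative (ZMod n)

/-- The semidihedral group `SD_{2^n} = ⟨x, y ∣ x^(2^(n-1)) = y^2 = 1, yxy⁻¹ = x^(2^(n-2)-1)⟩`, for
`n ≥ 4`. -/
abbrev SemidihedralGroup (n : ℕ) : Type :=
  let x : FreeGroup (Fin 2) := .of 0
  let y : FreeGroup (Fin 2) := .of 1
  PresentedGroup {x ^ 2 ^ (n - 1), y ^ 2, y * x * y⁻¹ * (x ^ (2 ^ (n - 2) - 1))⁻¹}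

/-- The minimal nonabelian `p`-group of type `(r, s)`,
`⟨x, y ∣ x^(p^r) = y^(p^s) = [x, y]^p = [x, [x, y]] = [y, [x, y]] = 1⟩`. -/
abbrev MinimalNonabelianGroup (p r s : ℕ) : Type :=
  let x : FreeGroup (Fin 2) := .of 0
  let y : FreeGroup (Fin 2) := .of 1
  PresentedGroup {x ^ p ^ r, y ^ p ^ s, ⁅x, y⁆ ^ p, ⁅x, ⁅x, y⁆⁆, ⁅y, ⁅x, y⁆⁆}

/-- `⟨x, y, a ∣ x^(2^r) = [x, y]^2 = [x, [x, y]] = [y, [x, y]] = 1, a^2 = [x, y]^k, axa⁻¹ = y⟩`. The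
condition `a^2 ∈ ⟨[x, y]⟩` amounts to the two choices `k = 0` and `k = 1`. -/
abbrev NormalizerQuotientGroup (r k : ℕ) : Type :=
  let x : FreeGroup (Fin 3) := .of 0
  let y : FreeGroup (Fin 3) := .of 1
  let a : FreeGroup (Fin 3) := .of 2
  PresentedGroup {x ^ 2 ^ r, ⁅x, y⁆ ^ 2, ⁅x, ⁅x, y⁆⁆, ⁅y, ⁅x, y⁆⁆, a ^ 2 * (⁅x, y⁆ ^ k)⁻¹,
    a * x * a⁻¹ * y⁻¹}

/-- `⟨x, y ∣ x^8 = [x, [x, y]] = [y, [x, y]] = 1, x^4 = y^4 = [x, y]^2⟩`. -/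
abbrev EssentialGroupTwo : Type :=
  let x : FreeGroup (Fin 2) := .of 0
  let y : FreeGroup (Fin 2) := .of 1
  PresentedGroup {x ^ 8, ⁅x, ⁅x, y⁆⁆, ⁅y, ⁅x, y⁆⁆, x ^ 4 * (y ^ 4)⁻¹, y ^ 4 * (⁅x, y⁆ ^ 2)⁻¹}

/-- `⟨x, y ∣ x^(2^r) = y^(2^r) = [x, y]^4 = [x, [x, y]] = [y, [x, y]] = 1⟩`. -/
abbrev EssentialGroup (r : ℕ) : Type :=
  let x : FreeGroup (Fin 2) := .of 0
  let y : FreeGroup (Fin 2) := .of 1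
  PresentedGroup {x ^ 2 ^ r, y ^ 2 ^ r, ⁅x, y⁆ ^ 4, ⁅x, ⁅x, y⁆⁆, ⁅y, ⁅x, y⁆⁆}

/-!
Let `Q` be the essential subgroup, so that `Q/Φ(Q)` is a four-group. The automorphisms of `Q` that
act trivially on `Q/Φ(Q)` form a 2-group, so by strong embedding `Out_F(Q)` acts faithfully on
`Q/Φ(Q)` and has order six (`FusionSystem.IsEssential.card_out`). Hence `|N_P(Q) : Q| = 2` by
saturation, an element of `N_P(Q) ∖ Q` interchanges two of the three nontrivial cosets of `Φ(Q)`,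
and some automorphism `α` of `Q` permutes these cosets cyclically, which is recorded as
`FixesNoFrattiniCoset α`.

Two consequences of the existence of `α` carry the argument. First, any homomorphism `f` from `Q`
with `f ∘ α = f` is trivial (`FixesNoFrattiniCoset.eq_one_of_comp_eq`). Second, all elements
outside `Φ(Q)` have the same order `2 ^ r` modulo `Q'`, so that `Q/Q'` is a direct product of two
cyclic groups of order `2 ^ r` (`IsPGroup.nonempty_abelianization_equiv`).

If `r = 1`, then `|Q : Q'| = 4`. Either `Q` is a four-group, or it is nonabelian. By Taussky's
theorem (`IsPGroup.exists_zpowers_index_two`) a nonabelian 2-group with commutator subgroup of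
index four is dihedral, quaternion or semidihedral, and of these only `Q_8` admits `α`. As `Q` is
self-centralizing, `P` has commutator subgroup of index four too: if `Q` is a four-group, the
conjugacy class of a suitable element of `Q` is large, and if `Q` is `Q_8`, one passes to `P/Z(P)`.

If `r ≥ 2`, an element of `N_P(Q) ∖ Q` is adjusted by an element of `Q` so that its square lies in
`Q'` (`exists_swapsGenerators`). Thus `N_P(Q)/Q'` is a wreath product, and if `Q` is abelian, a
commutation argument shows that every element normalizing `N_P(Q)` normalizes `Q`, whence `N_P(Q) =
P`. If `Q` is nonabelian, `Q'` has order two modulo `M = Φ(Q')K₃(Q)`, and `u ↦ u ^ 2 ^ r` is an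
`α`-invariant homomorphism to `Q/M`, hence trivial. So `Q/M` and `N_P(Q)/M` satisfy the relations
of the presented groups; as the presented groups have at most the expected order, they are
isomorphic to these quotients. That the groups presented for `k = 0` and `k = 1` differ is read off
from an explicit model, `SwapModel`. Finally, if `|M| = 2`, the homomorphism `u ↦ [u, c]` with `Q'
= ⟨c⟩M` is `α`-invariant, so `Q'` is central and cyclic of order four; the power map `u ↦ u ^ 2 ^
r` into `M` is again a homomorphism if `r ≥ 3`, while for `r = 2` its failure to be one forces the
fourth powers of suitable generators to be equal to `c ^ 2`.
-/

/-! ### The Frattini subgroup of a finite 2-group -/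

theorem IsPGroup.index_eq_two_of_isCoatom {G : Type*} [Group G] [Finite G] (hG : IsPGroup 2 G)
    {K : Subgroup G} (hK : IsCoatom K) : K.index = 2 := by
  obtain ⟨m, hm⟩ := IsPGroup.iff_card.mp (hG.to_subgroup K)
  obtain ⟨k, hk⟩ := hG.index K
  have hcard := K.card_mul_index
  have hk0 : k ≠ 0 := by
    rintro rfl
    exact hK.1 (Subgroup.index_eq_one.mp (by simpa using hk))
  obtain ⟨L, hL, hKL⟩ := Sylow.exists_subgroup_card_pow_succ (p := 2) (n := m) (G := G)
    (by rw [← hcard, hm, hk, ← pow_add]; exact pow_dvd_pow _ (by omega)) hm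
  have hLtop : L = ⊤ := by
    refine hK.2 L (lt_of_le_of_ne hKL ?_)
    rintro rfl
    rw [hm] at hL
    exact absurd (Nat.pow_right_injective le_rfl hL) (by simp)
  rw [hLtop, Subgroup.card_top, ← hcard, hm, pow_succ] at hL
  exact Nat.eq_of_mul_eq_mul_left (by positivity) hL

theorem mem_frattini_iff {G : Type*} [Group G] {x : G} :
    x ∈ frattini G ↔ ∀ K : Subgroup G, IsCoatom K → x ∈ K := by
  simp [frattini, Order.radical, Subgroup.mem_iInf]

theorem IsPGroup.sq_mem_frattini {G : Type*} [Group G] [Finite G] (hG : IsPGroup 2 G) (x : G) :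
    x ^ 2 ∈ frattini G :=
  mem_frattini_iff.mpr fun K hK => K.sq_mem_of_index_two (hG.index_eq_two_of_isCoatom hK) x

theorem IsPGroup.commutatorElement_mem_frattini {G : Type*} [Group G] [Finite G]
    (hG : IsPGroup 2 G) (x y : G) : ⁅x, y⁆ ∈ frattini G := by
  refine mem_frattini_iff.mpr fun K hK => ?_
  have h := hG.index_eq_two_of_isCoatom hK
  simp only [commutatorElement_def, K.mul_mem_iff_of_index_two h, inv_mem_iff]
  tauto

theorem IsPGroup.commutator_le_frattini {G : Type*} [Group G] [Finite G] (hG : IsPGroup 2 G) :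
    commutator G ≤ frattini G :=
  Subgroup.commutator_le.mpr fun x _ y _ => hG.commutatorElement_mem_frattini x y

theorem mulAut_mem_iff_of_characteristic {G : Type*} [Group G] (K : Subgroup G)
    [hK : K.Characteristic] (α : MulAut G) (x : G) : α x ∈ K ↔ x ∈ K := by
  have := hK.fixed α
  exact (SetLike.ext_iff.mp this x)

/-- If `G/Φ(G)` has order four and `x`, `y` are distinct and nontrivial in it, its four elements are
the images of `1`, `x`, `y` and `xy`. -/
theorem IsPGroup.mem_frattini_cosets {G : Type*} [Group G] [Finite G] (hG : IsPGroup 2 G)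
    (hΦ : (frattini G).index = 2 ^ 2) {x y : G} (hx : x ∉ frattini G) (hy : y ∉ frattini G)
    (hxy : x⁻¹ * y ∉ frattini G) (w : G) :
    w ∈ frattini G ∨ x⁻¹ * w ∈ frattini G ∨ y⁻¹ * w ∈ frattini G ∨
      (x * y)⁻¹ * w ∈ frattini G := by
  classical
  have hcard : Nat.card (G ⧸ frattini G) = 4 := hΦ
  have := Fintype.ofFinite (G ⧸ frattini G)
  have hsq : ∀ v : G ⧸ frattini G, v * v = 1 := by
    intro v
    induction v using QuotientGroup.induction_on with
    | H g =>
      rw [← QuotientGroup.mk_mul, QuotientGroup.eq_one_iff, ← sq]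
      exact hG.sq_mem_frattini g
  simp only [← QuotientGroup.eq_one_iff, QuotientGroup.mk_mul, QuotientGroup.mk_inv] at *
  generalize (x : G ⧸ frattini G) = X at *
  generalize (y : G ⧸ frattini G) = Y at *
  generalize (w : G ⧸ frattini G) = W at *
  have hXY : X ≠ Y := fun h => hxy (by simp [h])
  have hXY' : X * Y ≠ 1 := fun h => hXY (by rw [← mul_left_inj Y, h, hsq])
  have hS : ({1, X, Y, X * Y} : Finset (G ⧸ frattini G)).card = 4 := by
    rw [Finset.card_insert_of_notMem, Finset.card_insert_of_notMem, Finset.card_insert_of_notMem,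
      Finset.card_singleton]
    · simpa using hx
    · simpa [hXY] using hy
    · simpa using ⟨Ne.symm hx, Ne.symm hy, Ne.symm hXY'⟩
  have huniv : ({1, X, Y, X * Y} : Finset (G ⧸ frattini G)) = Finset.univ := by
    rw [← Finset.card_eq_iff_eq_univ, hS, ← Nat.card_eq_fintype_card, hcard]
  have hW := Finset.mem_univ W
  rw [← huniv] at hW
  simp only [Finset.mem_insert, Finset.mem_singleton] at hW
  rcases hW with rfl | rfl | rfl | rfl <;> simp

/-- Burnside's basis theorem for two generators. -/
theorem IsPGroup.closure_pair_eq_top {G : Type*} [Group G] [Finite G] (hG : IsPGroup 2 G)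
    (hΦ : (frattini G).index = 2 ^ 2) {x y : G} (hx : x ∉ frattini G) (hy : y ∉ frattini G)
    (hxy : x⁻¹ * y ∉ frattini G) : Subgroup.closure {x, y} = ⊤ := by
  apply frattini_nongenerating
  rw [eq_top_iff]
  intro w _
  have hxC : x ∈ Subgroup.closure {x, y} := Subgroup.subset_closure (by simp)
  have hyC : y ∈ Subgroup.closure {x, y} := Subgroup.subset_closure (by simp)
  have key : ∀ u ∈ Subgroup.closure {x, y}, u⁻¹ * w ∈ frattini G →
      w ∈ Subgroup.closure {x, y} ⊔ frattini G := by
    intro u hu h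
    have := Subgroup.mul_mem_sup hu h
    rwa [mul_inv_cancel_left] at this
  rcases hG.mem_frattini_cosets hΦ hx hy hxy w with h | h | h | h
  · exact key 1 (one_mem _) (by simpa using h)
  · exact key _ hxC h
  · exact key _ hyC h
  · exact key _ (mul_mem hxC hyC) h

/-- The automorphism `α` acts without nontrivial fixed points on `G/Φ(G)`. If this quotient is a
four-group, this says that `α` permutes the three nontrivial cosets cyclically. -/
def FixesNoFrattiniCoset {G : Type*} [Group G] (α : MulAut G) : Prop :=
  ∀ x, x ∉ frattini G → x⁻¹ * α x ∉ frattini G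

theorem exists_notMem_frattini {G : Type*} [Group G] (hΦ : (frattini G).index = 2 ^ 2) :
    ∃ x, x ∉ frattini G := by
  by_contra! h
  rw [(Subgroup.eq_top_iff' _).mpr h, Subgroup.index_top] at hΦ
  simp at hΦ

theorem FixesNoFrattiniCoset.closure_eq_top {G : Type*} [Group G] [Finite G] {α : MulAut G}
    (hα : FixesNoFrattiniCoset α) (hG : IsPGroup 2 G) (hΦ : (frattini G).index = 2 ^ 2)
    {x : G} (hx : x ∉ frattini G) : Subgroup.closure {x, α x} = ⊤ :=
  hG.closure_pair_eq_top hΦ hx (mt (mulAut_mem_iff_of_characteristic _ α x).mp hx) (hα x hx)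

/-- The coinvariants of `α` are trivial: `u = x⁻¹ * α x` lies in the kernel of `f` and, together with
its image under `α`, generates `G`. -/
theorem FixesNoFrattiniCoset.eq_one_of_comp_eq {G H : Type*} [Group G] [Finite G] [Group H]
    {α : MulAut G} (hα : FixesNoFrattiniCoset α) (hG : IsPGroup 2 G)
    (hΦ : (frattini G).index = 2 ^ 2) (f : G →* H) (hf : ∀ x, f (α x) = f x) (u : G) :
    f u = 1 := by
  obtain ⟨x, hx⟩ := exists_notMem_frattini hΦ
  have hker : ∀ v, v⁻¹ * α v ∈ f.ker := fun v => by
    rw [MonoidHom.mem_ker, map_mul, hf, map_inv, inv_mul_cancel]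
  have htop : f.ker = ⊤ := by
    rw [eq_top_iff, ← hα.closure_eq_top hG hΦ (hα x hx), Subgroup.closure_le]
    rintro w (rfl | rfl)
    · exact hker x
    · simpa using hker (α x)
  exact MonoidHom.mem_ker.mp (htop ▸ Subgroup.mem_top u)

/-- Modulo the commutator subgroup, `w` and `α w` generate the group and have the same order, so
the order of an element outside the Frattini subgroup is the exponent of the abelianization. -/
theorem FixesNoFrattiniCoset.pow_mem_commutator {G : Type*} [Group G] [Finite G]
    {α : MulAut G} (hα : FixesNoFrattiniCoset α) (hG : IsPGroup 2 G)
    (hΦ : (frattini G).index = 2 ^ 2) {w : G} (hw : w ∉ frattini G) {n : ℕ}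
    (hn : w ^ n ∈ commutator G) (u : G) : u ^ n ∈ commutator G := by
  have hu : u ∈ Subgroup.closure {w, α w} := hα.closure_eq_top hG hΦ hw ▸ Subgroup.mem_top u
  rw [← Abelianization.ker_of, MonoidHom.mem_ker] at hn ⊢
  rw [map_pow] at hn ⊢
  have h2 : Abelianization.of (α w) ^ n = 1 := by
    rw [← map_pow, ← map_pow, ← MonoidHom.mem_ker, Abelianization.ker_of,
      mulAut_mem_iff_of_characteristic, ← Abelianization.ker_of, MonoidHom.mem_ker, map_pow, hn]
  induction hu using Subgroup.closure_induction with
  | mem x hx =>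
    rcases hx with rfl | rfl
    · exact hn
    · exact h2
  | one => simp
  | mul x y _ _ hx hy => rw [map_mul, mul_pow, hx, hy, one_mul]
  | inv x _ hx => rw [map_inv, inv_pow, hx, inv_one]

/-! ### The outer automorphism group of an essential subgroup of rank two -/

/-- The automorphisms of `G` that act trivially on `G/Φ(G)`. -/
def frattiniKernel (G : Type*) [Group G] : Subgroup (MulAut G) where
  carrier := {β | ∀ x, x⁻¹ * β x ∈ frattini G}
  one_mem' := by simp
  mul_mem' := by
    intro β γ hβ hγ x
    have := mul_mem (hγ x) (hβ (γ x))
    simpa [mul_assoc] using this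
  inv_mem' := by
    intro β hβ x
    have := inv_mem (hβ (β⁻¹ x))
    simpa using this

theorem mem_frattiniKernel {G : Type*} [Group G] {β : MulAut G} :
    β ∈ frattiniKernel G ↔ ∀ x, x⁻¹ * β x ∈ frattini G := Iff.rfl

/-- The action of `Aut(G)` on `G/Φ(G)`. -/
def frattiniAction (G : Type*) [Group G] : MulAut G →* MulAut (G ⧸ frattini G) where
  toFun β := QuotientGroup.congr _ _ β
    (Subgroup.characteristic_iff_map_eq.mp inferInstance β)
  map_one' := by
    ext v
    induction v using QuotientGroup.induction_on with
    | H g => rfl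
  map_mul' β γ := by
    ext v
    induction v using QuotientGroup.induction_on with
    | H g => rfl

theorem frattiniAction_mk {G : Type*} [Group G] (β : MulAut G) (x : G) :
    frattiniAction G β (x : G ⧸ frattini G) = ((β x : G) : G ⧸ frattini G) := rfl

theorem ker_frattiniAction (G : Type*) [Group G] :
    (frattiniAction G).ker = frattiniKernel G := by
  ext β
  rw [MonoidHom.mem_ker, mem_frattiniKernel]
  constructor
  · intro h x
    rw [← QuotientGroup.eq, ← frattiniAction_mk, h]
    rfl
  · intro h
    ext v
    induction v using QuotientGroup.induction_on with
    | H g =>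
      rw [frattiniAction_mk]
      exact (QuotientGroup.eq.mpr (h g)).symm

instance frattiniKernel_normal (G : Type*) [Group G] : (frattiniKernel G).Normal := by
  rw [← ker_frattiniAction]
  infer_instance

theorem IsPGroup.innerAut_le_frattiniKernel {G : Type*} [Group G] [Finite G] (hG : IsPGroup 2 G) :
    innerAut G ≤ frattiniKernel G := by
  rintro _ ⟨g, rfl⟩ x
  have := hG.commutatorElement_mem_frattini x⁻¹ g
  simpa [commutatorElement_def, mul_assoc] using this

/-- Each coset of `Φ(G)` has order a power of two, so an automorphism of odd prime order that
preserves it has a fixed point in it. The fixed points therefore generate `G` modulo `Φ(G)`. -/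
theorem IsPGroup.eq_one_of_mem_frattiniKernel {G : Type*} [Group G] [Finite G]
    (hG : IsPGroup 2 G) {β : MulAut G} (hβ : β ∈ frattiniKernel G) {p : ℕ} (hp : p.Prime)
    (hp2 : p ≠ 2) (hβp : β ^ p = 1) : β = 1 := by
  classical
  have := Fintype.ofFinite G
  have : Fact p.Prime := ⟨hp⟩
  have hfix : ∀ x : G, ∃ u, x⁻¹ * u ∈ frattini G ∧ β u = u := by
    intro x
    let f : Function.End {u : G // x⁻¹ * u ∈ frattini G} := fun u =>
      ⟨β u, by simpa [mul_assoc] using mul_mem u.2 (hβ u)⟩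
    have hiter : ∀ (n : ℕ) (u : {u : G // x⁻¹ * u ∈ frattini G}),
        ((f ^ n) u : G) = (β ^ n) u := by
      intro n
      induction n with
      | zero => intro u; rfl
      | succ n ih =>
        intro u
        rw [pow_succ, pow_succ]
        exact ih (f u)
    have hfp : f ^ p ^ 1 = 1 := by
      funext u
      apply Subtype.ext
      rw [hiter, pow_one, hβp]
      rfl
    have hmod := Equiv.Perm.card_fixedPoints_modEq hfp
    have hcard : Fintype.card {u : G // x⁻¹ * u ∈ frattini G} = Nat.card (frattini G) := by
      rw [← Nat.card_eq_fintype_card]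
      exact Nat.card_congr
        ⟨fun u => ⟨x⁻¹ * u, u.2⟩, fun v => ⟨x * v, by simp⟩, fun u => by simp, fun v => by simp⟩
    obtain ⟨m, hm⟩ := IsPGroup.iff_card.mp (hG.to_subgroup (frattini G))
    rw [hcard, hm] at hmod
    by_contra! hno
    have hempty : Fintype.card f.fixedPoints = 0 := by
      rw [Fintype.card_eq_zero_iff]
      exact ⟨fun u => hno u.1 u.1.2 (congrArg Subtype.val u.2)⟩
    rw [hempty] at hmod
    have hdvd := hp.dvd_of_dvd_pow ((Nat.modEq_zero_iff_dvd).mp hmod)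
    exact hp2 ((Nat.prime_dvd_prime_iff_eq hp Nat.prime_two).mp hdvd)
  let C : Subgroup G := MonoidHom.eqLocus β.toMonoidHom (MonoidHom.id G)
  have hC : C = ⊤ := by
    apply frattini_nongenerating
    rw [eq_top_iff]
    intro x _
    obtain ⟨u, hu, hβu⟩ := hfix x
    have h := Subgroup.mul_mem_sup (show u ∈ C from hβu) (inv_mem hu)
    simpa using h
  ext x
  exact (hC ▸ Subgroup.mem_top x : x ∈ C)

/-- An automorphism of odd prime order that acts trivially on `G/Φ(G)` is trivial, so the group of
these automorphisms is a 2-group. -/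
theorem IsPGroup.frattiniKernel {G : Type*} [Group G] [Finite G] (hG : IsPGroup 2 G) :
    IsPGroup 2 (frattiniKernel G) := by
  have : Finite (MulAut G) := Finite.of_injective (fun β : MulAut G => (β : G → G))
    DFunLike.coe_injective
  rw [isPGroup_iff_primeFactors_card_subset two_ne_zero]
  intro p hp
  have hpp := Nat.prime_of_mem_primeFactors hp
  have : Fact p.Prime := ⟨hpp⟩
  obtain ⟨β, hβ⟩ := exists_prime_orderOf_dvd_card' p (Nat.dvd_of_mem_primeFactors hp)
  by_contra h2
  have h1 : (β : MulAut G) = 1 := by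
    refine hG.eq_one_of_mem_frattiniKernel β.2 hpp (fun h => h2 ?_) ?_
    · simp [h, Nat.prime_two]
    · rw [← SubgroupClass.coe_pow, ← hβ, pow_orderOf_eq_one, OneMemClass.coe_one]
  have h3 : β = 1 := Subtype.ext h1
  rw [h3, orderOf_one] at hβ
  exact hpp.one_lt.ne hβ

/-- A normal `p`-subgroup fixes a coset of a strongly `p`-embedded subgroup, hence it lies in the
intersection of all conjugates of that subgroup. -/
theorem IsStronglyEmbedded.eq_bot_of_isPGroup {p : ℕ} [Fact p.Prime] {G : Type*} [Group G]
    [Finite G] {H : Subgroup G} (hH : IsStronglyEmbedded p H) {K : Subgroup G} [hKn : K.Normal]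
    (hK : IsPGroup p K) : K = ⊥ := by
  obtain ⟨-, hodd, hone, hinter⟩ := hH
  have hle : K ≤ H := by
    obtain ⟨v, hv⟩ := hK.nonempty_fixed_point_of_prime_not_dvd_card (G ⧸ H) hodd
    induction v using QuotientGroup.induction_on with
    | H g =>
      intro k hk
      have h := hv ⟨g * k * g⁻¹, hKn.conj_mem k hk g⟩
      have h' : ((g * k * g⁻¹ * g : G) : G ⧸ H) = (g : G ⧸ H) := h
      have := QuotientGroup.eq.mp h'.symm
      simpa [mul_assoc] using this
  obtain ⟨x, hx⟩ : ∃ x, x ∉ H := by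
    by_contra! h
    rw [(Subgroup.eq_top_iff' H).mpr h, Subgroup.index_top] at hone
    exact lt_irrefl _ hone
  have hle' : K ≤ H ⊓ H.map (MulAut.conj x).toMonoidHom := by
    refine le_inf hle fun k hk => ⟨x⁻¹ * k * x, hle ?_, by simp [mul_assoc]⟩
    simpa using hKn.conj_mem k hk x⁻¹
  rcases hK.card_eq_or_dvd with h | h
  · exact Subgroup.card_eq_one.mp h
  · exact absurd (h.trans (Subgroup.card_dvd_of_le hle')) (hinter x hx)

/-- An automorphism permutes the three nontrivial elements and is determined by this permutation. -/
theorem card_mulAut_le_of_card_eq_four {V : Type*} [Group V] (hV : Nat.card V = 4) :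
    Nat.card (MulAut V) ≤ 6 := by
  classical
  have : Finite V := Nat.finite_of_card_ne_zero (by omega)
  have := Fintype.ofFinite V
  let f : MulAut V → Equiv.Perm {v : V // v ≠ 1} := fun e =>
    e.toEquiv.subtypeEquiv fun v => by simp
  have hf : Function.Injective f := by
    intro e₁ e₂ h
    ext v
    by_cases hv : v = 1
    · simp [hv]
    · exact congrArg Subtype.val (Equiv.ext_iff.mp h ⟨v, hv⟩)
  have hcard : Nat.card {v : V // v ≠ 1} = 3 := by
    rw [Nat.card_eq_fintype_card, Fintype.card_subtype_compl, Fintype.card_subtype_eq,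
      ← Nat.card_eq_fintype_card, hV]
  have := Nat.card_le_card_of_injective f hf
  rwa [Nat.card_perm, hcard] at this

/-- The number of fixed points of an automorphism of order three of a group of order four is
congruent to one modulo three. -/
theorem eq_one_of_pow_three_eq_one {V : Type*} [Group V] (hV : Nat.card V = 4) {e : MulAut V}
    (he : e ^ 3 = 1) {v : V} (hv : v ≠ 1) (hev : e v = v) : e = 1 := by
  classical
  have : Finite V := Nat.finite_of_card_ne_zero (by omega)
  have := Fintype.ofFinite V
  let f : Function.End V := fun v => e v
  have hiter : ∀ (n : ℕ) (u : V), (f ^ n) u = (e ^ n) u := by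
    intro n
    induction n with
    | zero => intro u; rfl
    | succ n ih =>
      intro u
      rw [pow_succ, pow_succ]
      exact ih (f u)
  have hf : f ^ 3 ^ 1 = 1 := by
    funext u
    rw [hiter, pow_one, he]
    rfl
  have hmod := Equiv.Perm.card_fixedPoints_modEq hf
  have hle : Fintype.card f.fixedPoints ≤ Fintype.card V :=
    Fintype.card_le_of_injective _ Subtype.val_injective
  have hge : 1 < Fintype.card f.fixedPoints := by
    rw [Fintype.one_lt_card_iff]
    exact ⟨⟨v, hev⟩, ⟨1, map_one e⟩, fun h => hv (congrArg Subtype.val h)⟩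
  rw [Nat.card_eq_fintype_card] at hV
  rw [hV] at hmod hle
  have h4 : Fintype.card f.fixedPoints = Fintype.card V := by
    unfold Nat.ModEq at hmod
    omega
  have hbij := (Fintype.bijective_iff_injective_and_card
    (Subtype.val : f.fixedPoints → V)).mpr ⟨Subtype.val_injective, h4⟩
  ext u
  obtain ⟨w, rfl⟩ := hbij.2 u
  exact w.2

theorem FusionSystem.conjAut_le_aut {P : Type*} [Group P] (F : FusionSystem P) (Q : Subgroup P) :
    conjAut Q ≤ F.aut Q := by
  rintro _ ⟨g, rfl⟩
  exact F.conj_mem _ g (by intro u; simp)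

theorem innerAut_le_conjAut {P : Type*} [Group P] (Q : Subgroup P) : innerAut Q ≤ conjAut Q := by
  rintro _ ⟨g, rfl⟩
  refine ⟨⟨g, Subgroup.le_normalizer g.2⟩, ?_⟩
  ext u
  simp

theorem FusionSystem.IsCentric.centralizer_le {P : Type*} [Group P] {F : FusionSystem P}
    {Q : Subgroup P} (hQ : F.IsCentric Q) : Subgroup.centralizer (Q : Set P) ≤ Q := by
  rw [hQ Q ⟨MulEquiv.refl Q, F.conj_mem _ 1 (by intro u; simp)⟩]
  exact Subgroup.map_subtype_le _

/-- If `C_P(Q) ≤ Q`, the elements of `N_P(Q)` inducing inner automorphisms of `Q` are those of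
`Q`. -/
theorem comap_normalizerMonoidHom_innerAut {P : Type*} [Group P] {Q : Subgroup P}
    (hQ : Subgroup.centralizer (Q : Set P) ≤ Q) :
    (innerAut Q).comap Q.normalizerMonoidHom =
      Q.subgroupOf (Subgroup.normalizer (Q : Set P)) := by
  ext g
  rw [Subgroup.mem_comap, Subgroup.mem_subgroupOf]
  constructor
  · rintro ⟨q, hq⟩
    have hmem : (q : P)⁻¹ * g ∈ Subgroup.centralizer (Q : Set P) := by
      rw [Subgroup.mem_centralizer_iff]
      intro u hu
      have := congrArg (fun f : MulAut Q => (f ⟨u, hu⟩ : P)) hq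
      simp only [MulAut.conj_apply, Subgroup.coe_mul, InvMemClass.coe_inv,
        Subgroup.normalizerMonoidHom_apply_apply_coe] at this
      calc u * ((q : P)⁻¹ * g) = (q : P)⁻¹ * (q * u * (q : P)⁻¹) * g := by group
        _ = (q : P)⁻¹ * g * u := by rw [this]; group
    have := Q.mul_mem q.2 (hQ hmem)
    simpa using this
  · intro hg
    refine ⟨⟨g, hg⟩, ?_⟩
    ext u
    simp

namespace FusionSystem

variable {P : Type*} [Group P]

section
variable [Finite P] {F : FusionSystem P} {Q : Subgroup P}

/-- The automorphisms in `Aut_F(Q)` that act trivially on `Q/Φ(Q)` form a normal 2-subgroup, so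
their image in `Out_F(Q)` is trivial by strong embedding. -/
theorem IsEssential.mem_innerAut (hP : IsPGroup 2 P) (hQ : F.IsEssential 2 Q)
    {β : MulAut Q} (hβ : β ∈ F.aut Q) (hβ' : β ∈ frattiniKernel Q) : β ∈ innerAut Q := by
  have : Finite (MulAut Q) := Finite.of_injective (fun β : MulAut Q => (β : Q → Q))
    DFunLike.coe_injective
  obtain ⟨H, hH⟩ := hQ.stronglyEmbedded
  let K : Subgroup (F.Out Q) := ((frattiniKernel Q).subgroupOf (F.aut Q)).map
    (QuotientGroup.mk' ((innerAut Q).subgroupOf (F.aut Q)))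
  have hKn : K.Normal := Subgroup.Normal.map inferInstance _ (QuotientGroup.mk'_surjective _)
  have hK : IsPGroup 2 K :=
    ((hP.to_subgroup Q).frattiniKernel.comap_subtype).map _
  have hbot := hH.eq_bot_of_isPGroup hK
  have hmem : QuotientGroup.mk' ((innerAut Q).subgroupOf (F.aut Q)) ⟨β, hβ⟩ ∈ K :=
    Subgroup.mem_map_of_mem _ hβ'
  rw [hbot, Subgroup.mem_bot] at hmem
  rw [QuotientGroup.mk'_apply, QuotientGroup.eq_one_iff] at hmem
  exact hmem

theorem IsEssential.ker_frattiniAction_comp (hP : IsPGroup 2 P) (hQ : F.IsEssential 2 Q) :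
    ((frattiniAction Q).comp (F.aut Q).subtype).ker = (innerAut Q).subgroupOf (F.aut Q) := by
  ext β
  rw [← MonoidHom.comap_ker, ker_frattiniAction, Subgroup.mem_comap, Subgroup.mem_subgroupOf]
  exact ⟨fun h => hQ.mem_innerAut hP β.2 h,
    fun h => (hP.to_subgroup Q).innerAut_le_frattiniKernel h⟩

/-- `Out_F(Q)` embeds in `Aut(Q/Φ(Q))`, of order at most six, and a group with a strongly
2-embedded subgroup has order at least `2 * 3`. -/
theorem IsEssential.card_out (hP : IsPGroup 2 P) (hQ : F.IsEssential 2 Q)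
    (hrank : (frattini Q).index = 2 ^ 2) : Nat.card (F.Out Q) = 6 := by
  have : Finite (MulAut Q) := Finite.of_injective (fun β : MulAut Q => (β : Q → Q))
    DFunLike.coe_injective
  have hfin : Finite (MulAut (Q ⧸ frattini Q)) :=
    Finite.of_injective (fun β : MulAut (Q ⧸ frattini Q) => (β : _ → _)) DFunLike.coe_injective
  have hle : Nat.card (F.Out Q) ≤ 6 := by
    have h1 : Nat.card (F.Out Q) = ((innerAut Q).subgroupOf (F.aut Q)).index := rfl
    rw [h1, ← hQ.ker_frattiniAction_comp hP, Subgroup.index_ker]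
    exact (Nat.card_le_card_of_injective _ Subtype.val_injective).trans
      (card_mulAut_le_of_card_eq_four hrank)
  obtain ⟨H, h2, hodd, hone, -⟩ := hQ.stronglyEmbedded
  have hcard := H.card_mul_index
  have hpos : 0 < Nat.card H := Nat.card_pos
  obtain ⟨k, hk⟩ := h2
  have h3 : 3 ≤ H.index := by
    rcases Nat.lt_or_ge H.index 3 with h | h
    · interval_cases H.index
      omega
    · exact h
  have hk1 : k = 1 := by
    rcases Nat.lt_or_ge k 2 with h | h
    · omega
    · have : 2 * 2 * 3 ≤ Nat.card H * H.index := by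
        rw [hk]
        exact Nat.mul_le_mul (by omega) h3
      omega
  subst hk1
  rw [hk] at hcard
  omega

/-- An element of order three of `Out_F(Q)` acts without fixed points on `Q/Φ(Q)`. -/
theorem IsEssential.exists_fixesNoFrattiniCoset (hP : IsPGroup 2 P) (hQ : F.IsEssential 2 Q)
    (hrank : (frattini Q).index = 2 ^ 2) : ∃ α : MulAut Q, FixesNoFrattiniCoset α := by
  have : Finite (MulAut Q) := Finite.of_injective (fun β : MulAut Q => (β : Q → Q))
    DFunLike.coe_injective
  have : Fact (Nat.Prime 3) := ⟨Nat.prime_three⟩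
  obtain ⟨a, ha⟩ := exists_prime_orderOf_dvd_card' (G := F.Out Q) 3
    (by rw [hQ.card_out hP hrank]; norm_num)
  obtain ⟨α, rfl⟩ := QuotientGroup.mk_surjective a
  have hker := hQ.ker_frattiniAction_comp hP
  have h3 : frattiniAction Q α ^ 3 = 1 := by
    have h : ((α ^ 3 : F.aut Q) : F.Out Q) = 1 := by
      rw [QuotientGroup.mk_pow, ← ha, pow_orderOf_eq_one]
    rw [QuotientGroup.eq_one_iff, ← hker, MonoidHom.mem_ker, map_pow] at h
    exact h
  have h1 : frattiniAction Q α ≠ 1 := by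
    intro h
    have hα : α ∈ ((frattiniAction Q).comp (F.aut Q).subtype).ker := h
    rw [hker, ← QuotientGroup.eq_one_iff] at hα
    rw [hα, orderOf_one] at ha
    omega
  refine ⟨α, fun x hx hαx => h1 ?_⟩
  refine eq_one_of_pow_three_eq_one hrank h3 (v := (x : Q ⧸ frattini Q)) ?_ ?_
  · rwa [Ne, QuotientGroup.eq_one_iff]
  · rw [frattiniAction_mk]
    exact (QuotientGroup.eq.mpr hαx).symm

/-- By saturation `Aut_P(Q)/Inn(Q)`, which is `N_P(Q)/Q`, is a Sylow 2-subgroup of the group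
`Out_F(Q)` of order six. -/
theorem IsEssential.relIndex_normalizer (hP : IsPGroup 2 P) (hF : F.IsSaturated 2)
    (hQ : F.IsEssential 2 Q) (hrank : (frattini Q).index = 2 ^ 2) :
    Q.relIndex (Subgroup.normalizer (Q : Set P)) = 2 := by
  have : Finite (MulAut Q) := Finite.of_injective (fun β : MulAut Q => (β : Q → Q))
    DFunLike.coe_injective
  have hle := innerAut_le_conjAut Q
  have hle' := F.conjAut_le_aut Q
  rw [Subgroup.relIndex, ← comap_normalizerMonoidHom_innerAut hQ.centric.centralizer_le,
    Subgroup.index_comap]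
  change (innerAut Q).relIndex (conjAut Q) = 2
  have h6 : (innerAut Q).relIndex (F.aut Q) = 6 := hQ.card_out hP hrank
  obtain ⟨S, hS⟩ := hF.sylow Q hQ.fullyNormalized
  have hodd := S.not_dvd_index
  rw [hS] at hodd
  change ¬ 2 ∣ (conjAut Q).relIndex (F.aut Q) at hodd
  have hmul := Subgroup.relIndex_mul_relIndex _ _ _ hle hle'
  rw [h6] at hmul
  have hconj : IsPGroup 2 (conjAut Q) := (hP.to_subgroup _).of_surjective
    Q.normalizerMonoidHom.rangeRestrict (MonoidHom.rangeRestrict_surjective _)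
  obtain ⟨m, hm⟩ := hconj.index ((innerAut Q).subgroupOf (conjAut Q))
  change (innerAut Q).relIndex (conjAut Q) = 2 ^ m at hm
  rw [hm] at hmul ⊢
  match m with
  | 0 => omega
  | 1 => rfl
  | m + 2 =>
    have h4 : (4 : ℕ) ∣ 6 := hmul ▸ Dvd.dvd.mul_right ⟨2 ^ m, by ring⟩ _
    omega

theorem IsEssential.exists_notMem_frattini (hP : IsPGroup 2 P) (hQ : F.IsEssential 2 Q)
    {g : P} (hg : g ∈ Subgroup.normalizer (Q : Set P)) (hgQ : g ∉ Q) :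
    ∃ x : Q, x⁻¹ * Q.normalizerMonoidHom ⟨g, hg⟩ x ∉ frattini Q := by
  by_contra! h
  refine hgQ ?_
  have hinn : Q.normalizerMonoidHom ⟨g, hg⟩ ∈ innerAut Q :=
    hQ.mem_innerAut hP (F.conjAut_le_aut Q ⟨_, rfl⟩) h
  rw [← Subgroup.mem_comap, comap_normalizerMonoidHom_innerAut hQ.centric.centralizer_le] at hinn
  exact hinn

end

end FusionSystem

/-! ### Generators and commutators -/

theorem commutator_le_of_closure_eq_top {G : Type*} [Group G] {S : Set G}
    (hS : Subgroup.closure S = ⊤) (N : Subgroup G) [N.Normal]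
    (h : ∀ s ∈ S, ∀ t ∈ S, ⁅s, t⁆ ∈ N) : commutator G ≤ N := by
  have key : ∀ g k : G, Commute (g : G ⧸ N) (k : G ⧸ N) := by
    intro g k
    have hg : g ∈ Subgroup.closure S := hS ▸ Subgroup.mem_top g
    have hk : k ∈ Subgroup.closure S := hS ▸ Subgroup.mem_top k
    induction hg, hk using Subgroup.closure_induction₂ with
    | mem x y hx hy =>
      rw [← commutatorElement_eq_one_iff_commute]
      exact (QuotientGroup.eq_one_iff _).mpr (h x hx y hy)
    | one_left x _ => exact Commute.one_left _
    | one_right x _ => exact Commute.one_right _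
    | mul_left x y z _ _ _ h1 h2 => exact h1.mul_left h2
    | mul_right x y z _ _ _ h1 h2 => exact h1.mul_right h2
    | inv_left x y _ _ h => exact h.inv_left
    | inv_right x y _ _ h => exact h.inv_right
  refine Subgroup.commutator_le.mpr fun g _ k _ => ?_
  exact (QuotientGroup.eq_one_iff _).mp (commutatorElement_eq_one_iff_commute.mpr (key g k))

theorem commutator_le_of_closure_pair_eq_top {G : Type*} [Group G] {x y : G}
    (hS : Subgroup.closure {x, y} = ⊤) (N : Subgroup G) [N.Normal] (h : ⁅x, y⁆ ∈ N) :
    commutator G ≤ N := by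
  refine commutator_le_of_closure_eq_top hS N ?_
  have h' : ⁅y, x⁆ ∈ N := by rw [← commutatorElement_inv]; exact inv_mem h
  rintro s (rfl | rfl) t (rfl | rfl)
  · simp
  · exact h
  · exact h'
  · simp

/-- A set containing `1` and stable under left multiplication by a generating set and its inverses
is everything. -/
theorem mem_of_closure_eq_top {G : Type*} [Group G] {S T : Set G}
    (hS : Subgroup.closure S = ⊤) (h1 : 1 ∈ T)
    (hmul : ∀ s ∈ S, ∀ t ∈ T, s * t ∈ T ∧ s⁻¹ * t ∈ T) (g : G) : g ∈ T := by
  have hg : g ∈ Subgroup.closure S := hS ▸ Subgroup.mem_top g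
  induction hg using Subgroup.closure_induction_left with
  | one => exact h1
  | mul_left s hs t _ ht => exact (hmul s hs t ht).1
  | inv_mul_cancel s hs t _ ht => exact (hmul s hs t ht).2

theorem zpowers_normal_of_closure_eq_top {G : Type*} [Group G] [Finite G] {S : Set G}
    (hS : Subgroup.closure S = ⊤) {d : G}
    (h : ∀ s ∈ S, s * d * s⁻¹ ∈ Subgroup.zpowers d) : (Subgroup.zpowers d).Normal := by
  rw [← Subgroup.normalizer_eq_top_iff, eq_top_iff, ← hS, Subgroup.closure_le]
  intro s hs
  have hle : (Subgroup.zpowers d).map (MulAut.conj s).toMonoidHom ≤ Subgroup.zpowers d := by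
    rw [MonoidHom.map_zpowers, Subgroup.zpowers_le]
    exact h s hs
  rw [SetLike.mem_coe, Subgroup.mem_normalizer_iff_map_conj_eq]
  refine Subgroup.eq_of_le_of_card_ge hle ?_
  rw [Subgroup.card_map_of_injective (MulAut.conj s).injective]

theorem IsPGroup.eq_two_pow {G : Type*} [Group G] [Finite G] (hG : IsPGroup 2 G) (g : G) :
    ∃ m, orderOf g = 2 ^ m := IsPGroup.iff_orderOf.mp hG g

/-! ### Finite 2-groups with commutator subgroup of index four -/

/-- The conjugacy class of `t` has at least `|G|/4` elements and injects into the commutator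
subgroup via `gtg⁻¹ ↦ [g, t]`. -/
theorem index_commutator_le_of_card_centralizer_le {G : Type*} [Group G] [Finite G] {t : G}
    (ht : Nat.card (Subgroup.centralizer {t}) ≤ 4) : (commutator G).index ≤ 4 := by
  have hinj : Function.Injective (fun v : G ⧸ Subgroup.centralizer {t} =>
      (⟨⁅v.out, t⁆, Subgroup.commutator_mem_commutator (Subgroup.mem_top _)
        (Subgroup.mem_top _)⟩ : commutator G)) := by
    intro v w h
    have h' : ⁅v.out, t⁆ = ⁅w.out, t⁆ := congrArg Subtype.val h
    rw [← QuotientGroup.out_eq' v, ← QuotientGroup.out_eq' w, QuotientGroup.eq,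
      Subgroup.mem_centralizer_singleton_iff]
    simp only [commutatorElement_def, mul_left_inj] at h'
    calc v.out⁻¹ * w.out * t = v.out⁻¹ * (w.out * t * w.out⁻¹) * w.out := by group
      _ = t * (v.out⁻¹ * w.out) := by rw [← h']; group
  have hle := Nat.card_le_card_of_injective _ hinj
  change (Subgroup.centralizer {t}).index ≤ _ at hle
  have h1 := (Subgroup.centralizer {t}).card_mul_index
  have h2 := (commutator G).card_mul_index
  have hpos : 0 < Nat.card (commutator G) := Nat.card_pos
  by_contra! h5
  have h3 : Nat.card (commutator G) * 5 ≤ Nat.card G := by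
    rw [← h2]
    exact Nat.mul_le_mul_left _ h5
  have h4 : Nat.card G ≤ 4 * Nat.card (commutator G) := by
    rw [← h1]
    exact Nat.mul_le_mul ht hle
  omega

theorem IsPGroup.index_commutator_le_of_centralizer_le {G : Type*} [Group G] [Finite G]
    (hG : IsPGroup 2 G) {Q : Subgroup G} (hcard : Nat.card Q = 4)
    (hQ : Subgroup.centralizer (Q : Set G) ≤ Q) : (commutator G).index ≤ 4 := by
  have hZQ : Subgroup.center G ≤ Q := (Subgroup.center_le_centralizer _).trans hQ
  by_cases hQZ : Q ≤ Subgroup.center G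
  · have hG4 : Nat.card G ≤ 4 := by
      have htop : Q = ⊤ := by
        rw [eq_top_iff]
        exact le_trans (fun g _ => Subgroup.mem_centralizer_iff.mpr fun q hq =>
          ((Subgroup.mem_center_iff.mp (hQZ hq)) g).symm) hQ
      rw [← hcard, htop, Subgroup.card_top]
    exact (Nat.le_of_dvd Nat.card_pos (commutator G).index_dvd_card).trans hG4
  · obtain ⟨t, htQ, htZ⟩ := SetLike.not_le_iff_exists.mp hQZ
    have hnt : Nontrivial G := ⟨t, 1, fun h => htZ (h ▸ one_mem _)⟩
    have hZ1 : Subgroup.center G ≠ ⊥ := (hG.bot_lt_center).ne'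
    refine index_commutator_le_of_card_centralizer_le (t := t) ?_
    rw [← hcard]
    refine Nat.card_le_card_of_injective _ (Subgroup.inclusion_injective (le_trans ?_ hQ))
    -- `Q` is generated by `t` and the center, which has order two
    have hgen : Subgroup.center G ⊔ Subgroup.zpowers t = Q := by
      have hle : Subgroup.center G ⊔ Subgroup.zpowers t ≤ Q :=
        sup_le hZQ (by rwa [Subgroup.zpowers_le])
      refine Subgroup.eq_of_le_of_card_ge hle ?_
      have hlt : Subgroup.center G < Subgroup.center G ⊔ Subgroup.zpowers t :=
        lt_of_le_of_ne le_sup_left fun h => htZ (h ▸ (le_sup_right : _ ≤ Subgroup.center G ⊔ _)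
          (Subgroup.mem_zpowers t))
      have h1 := Subgroup.card_dvd_of_le hle
      have h2 := Subgroup.card_dvd_of_le hlt.le
      have h3 : Nat.card (Subgroup.center G) ≠ 1 := fun h => hZ1 (Subgroup.card_eq_one.mp h)
      have h4 : Nat.card (Subgroup.center G) ≠
          Nat.card (Subgroup.center G ⊔ Subgroup.zpowers t : Subgroup G) := fun h =>
        hlt.ne (Subgroup.eq_of_le_of_card_ge hlt.le h.ge)
      rw [hcard] at h1 ⊢
      have hle4 := Nat.le_of_dvd (by norm_num) h1
      interval_cases hc : Nat.card (Subgroup.center G ⊔ Subgroup.zpowers t : Subgroup G)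
      · omega
      · rw [Nat.dvd_one] at h2
        omega
      · have := (Nat.dvd_prime Nat.prime_two).mp h2
        omega
      · omega
      · exact le_rfl
    intro g hg
    rw [Subgroup.mem_centralizer_singleton_iff] at hg
    have hQg : Q ≤ Subgroup.centralizer {g} := by
      rw [← hgen, sup_le_iff, Subgroup.zpowers_le]
      exact ⟨Subgroup.center_le_centralizer _,
        Subgroup.mem_centralizer_singleton_iff.mpr hg.symm⟩
    rw [Subgroup.mem_centralizer_iff]
    intro q hq
    exact Subgroup.mem_centralizer_singleton_iff.mp (hQg hq)

/-- A nontrivial normal subgroup of a finite 2-group meets the center, by counting fixed points of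
the conjugation action. -/
theorem IsPGroup.exists_central_of_commutator_ne_bot {G : Type*} [Group G] [Finite G]
    (hG : IsPGroup 2 G) (h : commutator G ≠ ⊥) :
    ∃ z ∈ commutator G, z ∈ Subgroup.center G ∧ orderOf z = 2 := by
  obtain ⟨n, hn, hcard⟩ := ((hG.to_subgroup (commutator G)).nontrivial_iff_card).mp
    ((Subgroup.nontrivial_iff_ne_bot _).mpr h)
  obtain ⟨b, hb, hb1⟩ := (hG.of_equiv ConjAct.toConjAct).exists_fixed_point_of_prime_dvd_card_of_fixed_point
    (commutator G) (hcard ▸ dvd_pow_self 2 hn.ne') (a := 1) (fun g => smul_one g)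
  have hbc : (b : G) ∈ Subgroup.center G := by
    rw [Subgroup.mem_center_iff]
    intro g
    have h := congrArg Subtype.val (hb (ConjAct.toConjAct g))
    rw [ConjAct.Subgroup.val_conj_smul, ConjAct.smul_def, ConjAct.ofConjAct_toConjAct] at h
    exact mul_inv_eq_iff_eq_mul.mp h
  obtain ⟨m, hm⟩ := hG.eq_two_pow (b : G)
  have hm0 : m ≠ 0 := by
    rintro rfl
    rw [pow_zero, orderOf_eq_one_iff] at hm
    exact hb1 (Subtype.ext hm.symm)
  refine ⟨(b : G) ^ 2 ^ (m - 1), pow_mem b.2 _, pow_mem hbc _, ?_⟩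
  rw [orderOf_pow_of_dvd (by positivity) (hm ▸ pow_dvd_pow 2 (by omega)), hm,
    Nat.pow_div (by omega) (by norm_num)]
  simp [show m - (m - 1) = 1 by omega]

theorem mul_comm_of_sq_eq_one {G : Type*} [Group G] (h : ∀ g : G, g ^ 2 = 1) (x y : G) :
    x * y = y * x := by
  have hinv : ∀ g : G, g⁻¹ = g := fun g => inv_eq_of_mul_eq_one_left (by rw [← sq, h])
  rw [← hinv (x * y), mul_inv_rev, hinv, hinv]

theorem commutator_eq_bot_of_mul_comm {G : Type*} [Group G] (h : ∀ x y : G, x * y = y * x) :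
    commutator G = ⊥ := by
  rw [eq_bot_iff]
  refine Subgroup.commutator_le.mpr fun x _ y _ => ?_
  rw [Subgroup.mem_bot, commutatorElement_eq_one_iff_mul_comm, h]

theorem eq_one_or_eq_of_mem_zpowers {G : Type*} [Group G] {z u : G} (hz : orderOf z = 2)
    (hu : u ∈ Subgroup.zpowers z) : u = 1 ∨ u = z := by
  obtain ⟨i, rfl⟩ := hu
  have hz2 : z ^ (2 : ℤ) = 1 := by
    have h := pow_orderOf_eq_one z
    rw [hz] at h
    exact_mod_cast h
  rcases Int.even_or_odd' i with ⟨k, rfl | rfl⟩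
  · left
    simp [zpow_mul, hz2]
  · right
    simp [zpow_add, zpow_mul, hz2]

/-- For even `i` the conjugate of `a` would have smaller order than `a`. -/
theorem zpow_odd_of_conj {G : Type*} [Group G] {a b w : G} {i : ℤ} {m : ℕ}
    (hm : orderOf a = 2 ^ (m + 1)) (hw : Commute a w) (hw2 : w ^ 2 ^ m = 1)
    (h : b * a * b⁻¹ = a ^ i * w) : Odd i := by
  by_contra heven
  rw [Int.not_odd_iff_even] at heven
  obtain ⟨k, rfl⟩ := heven
  have h1 : b * a ^ 2 ^ m * b⁻¹ = 1 := by
    rw [← conj_pow, h, (hw.zpow_left _).mul_pow, hw2, mul_one, ← zpow_natCast, ← zpow_mul,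
      show (k + k) * ((2 ^ m : ℕ) : ℤ) = (2 ^ (m + 1) : ℕ) * k by push_cast; ring, zpow_mul,
      zpow_natCast, ← hm, pow_orderOf_eq_one, one_zpow]
  have h2 : a ^ 2 ^ m = 1 := by
    rwa [mul_inv_eq_one, mul_eq_left] at h1
  have := orderOf_dvd_of_pow_eq_one h2
  rw [hm] at this
  exact absurd (Nat.le_of_dvd (by positivity) this) (by rw [pow_succ]; have := Nat.two_pow_pos m; omega)

/-- Taussky's theorem, by induction along a central subgroup of order two: the preimage of a cyclic
subgroup of index two is abelian, and it is cyclic because otherwise the commutator subgroup would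
be too small. -/
theorem IsPGroup.exists_zpowers_index_two {G : Type*} [Group G] [Finite G] (hG : IsPGroup 2 G)
    (hcomm : (commutator G).index = 4) : ∃ a : G, (Subgroup.zpowers a).index = 2 := by
  induction hN : Nat.card G using Nat.strong_induction_on generalizing G with
  | h N ih =>
    subst hN
    by_cases hbot : commutator G = ⊥
    · rw [hbot, Subgroup.index_bot] at hcomm
      obtain ⟨a, ha⟩ := exists_prime_orderOf_dvd_card' (G := G) 2 (by rw [hcomm]; norm_num)
      refine ⟨a, ?_⟩
      have h := (Subgroup.zpowers a).card_mul_index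
      rw [Nat.card_zpowers, ha, hcomm] at h
      omega
    · obtain ⟨z, hzG, hzZ, hz2⟩ := hG.exists_central_of_commutator_ne_bot hbot
      have hzn : (Subgroup.zpowers z).Normal := by
        constructor
        intro u hu g
        have hle : Subgroup.zpowers z ≤ Subgroup.center G := by rwa [Subgroup.zpowers_le]
        rw [Subgroup.mem_center_iff.mp (hle hu) g, mul_inv_cancel_right]
        exact hu
      have hsurj := QuotientGroup.mk'_surjective (Subgroup.zpowers z)
      have hcardq : Nat.card G = Nat.card (G ⧸ Subgroup.zpowers z) * 2 := by
        rw [← hz2, ← Nat.card_zpowers, Subgroup.card_eq_card_quotient_mul_card_subgroup]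
      have hcommq : (commutator (G ⧸ Subgroup.zpowers z)).index = 4 := by
        have hmap : (commutator G).map (QuotientGroup.mk' (Subgroup.zpowers z)) =
            commutator (G ⧸ Subgroup.zpowers z) := by
          rw [commutator_def, Subgroup.map_commutator, Subgroup.map_top_of_surjective _ hsurj,
            commutator_def]
        rw [← hmap, Subgroup.index_map_eq _ hsurj, hcomm]
        rwa [QuotientGroup.ker_mk', Subgroup.zpowers_le]
      have hpos : 0 < Nat.card (G ⧸ Subgroup.zpowers z) := Nat.card_pos
      obtain ⟨v, hv⟩ := ih _ (by omega) (hG.to_quotient _) hcommq rfl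
      obtain ⟨a, rfl⟩ := QuotientGroup.mk_surjective v
      have hA : ((Subgroup.zpowers (a : G ⧸ Subgroup.zpowers z)).comap
          (QuotientGroup.mk' (Subgroup.zpowers z))).index = 2 := by
        rw [Subgroup.index_comap_of_surjective _ hsurj, hv]
      set A := (Subgroup.zpowers (a : G ⧸ Subgroup.zpowers z)).comap
          (QuotientGroup.mk' (Subgroup.zpowers z)) with hAdef
      have hAmem : ∀ g, g ∈ A ↔ ∃ i : ℤ, ∃ ε : ℤ, g = a ^ i * z ^ ε := by
        intro g
        rw [hAdef, Subgroup.mem_comap, Subgroup.mem_zpowers_iff]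
        refine exists_congr fun i => ?_
        rw [QuotientGroup.mk'_apply, ← QuotientGroup.mk_zpow, QuotientGroup.eq,
          Subgroup.mem_zpowers_iff]
        exact exists_congr fun ε => ⟨fun h => by rw [h, mul_inv_cancel_left], fun h => by
          rw [h, inv_mul_cancel_left]⟩
      have haA : a ∈ A := (hAmem a).mpr ⟨1, 0, by simp⟩
      by_cases hza : z ∈ Subgroup.zpowers a
      · refine ⟨a, ?_⟩
        rw [← hA]
        congr 1
        ext g
        rw [hAmem]
        constructor
        · rintro ⟨i, rfl⟩
          exact ⟨i, 0, by simp⟩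
        · rintro ⟨i, ε, rfl⟩
          exact mul_mem (zpow_mem (Subgroup.mem_zpowers a) _) (zpow_mem hza _)
      · obtain ⟨m, hm⟩ := hG.eq_two_pow a
        have hsq : ∀ u ∈ Subgroup.zpowers z, u ≠ 1 → u = z :=
          fun u hu hu1 => (eq_one_or_eq_of_mem_zpowers hz2 hu).resolve_left hu1
        have hcardG : Nat.card (commutator G) = orderOf (a : G ⧸ Subgroup.zpowers z) := by
          have h1 := (commutator G).card_mul_index
          have h2 := (Subgroup.zpowers (a : G ⧸ Subgroup.zpowers z)).card_mul_index
          rw [hcomm] at h1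
          rw [hv, Nat.card_zpowers] at h2
          omega
        have hle : 2 ^ m ≤ Nat.card (commutator G) := by
          rw [hcardG, ← hm]
          refine Nat.le_of_dvd (orderOf_pos _) (orderOf_dvd_of_pow_eq_one ?_)
          by_contra hne
          have hmem : a ^ orderOf (a : G ⧸ Subgroup.zpowers z) ∈ Subgroup.zpowers z := by
            rw [← QuotientGroup.eq_one_iff, QuotientGroup.mk_pow, pow_orderOf_eq_one]
          exact hza (hsq _ hmem hne ▸ pow_mem (Subgroup.mem_zpowers a) _)
        have hle' : Nat.card (commutator G) ≤ 2 ^ m := by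
          rw [hcardG, ← hm]
          exact Nat.le_of_dvd (orderOf_pos _)
            (orderOf_map_dvd (QuotientGroup.mk' (Subgroup.zpowers z)) a)
        have hcard8 : Nat.card G = 4 * 2 ^ m := by
          rw [← (commutator G).card_mul_index, hcomm, le_antisymm hle' hle, mul_comm]
        match m with
        | 0 => exact absurd (Subgroup.card_eq_one.mp (le_antisymm hle' hle)) hbot
        | 1 =>
          -- a nonabelian group of order eight has an element of order four
          obtain ⟨x, hx⟩ : ∃ x : G, x ^ 2 ≠ 1 := by
            by_contra! h
            exact hbot (commutator_eq_bot_of_mul_comm (mul_comm_of_sq_eq_one h))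
          obtain ⟨k, hk⟩ := hG.eq_two_pow x
          have hdvd := orderOf_dvd_natCard x
          have hindex := (Subgroup.zpowers x).card_mul_index
          rw [Nat.card_zpowers] at hindex
          rw [hk, hcard8, show 4 * 2 ^ 1 = 2 ^ 3 by norm_num, Nat.pow_dvd_pow_iff_le_right'] at hdvd
          interval_cases k
          · rw [pow_zero, orderOf_eq_one_iff] at hk
            exact absurd (by rw [hk, one_pow]) hx
          · rw [pow_one] at hk
            exact absurd (hk ▸ pow_orderOf_eq_one x) hx
          · refine ⟨x, ?_⟩
            rw [hk, hcard8] at hindex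
            omega
          · refine absurd (commutator_eq_bot_of_mul_comm fun u v => ?_) hbot
            have htop : Subgroup.zpowers x = ⊤ := by
              apply Subgroup.eq_top_of_card_eq
              rw [Nat.card_zpowers, hk, hcard8]
              norm_num
            obtain ⟨i, rfl⟩ := (htop ▸ Subgroup.mem_top u : u ∈ Subgroup.zpowers x)
            obtain ⟨j, rfl⟩ := (htop ▸ Subgroup.mem_top v : v ∈ Subgroup.zpowers x)
            exact (Commute.refl x).zpow_zpow i j
        | m + 2 =>
          exfalso
          obtain ⟨b, hb⟩ : ∃ b, b ∉ A := by
            by_contra! h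
            rw [(Subgroup.eq_top_iff' A).mpr h, Subgroup.index_top] at hA
            omega
          have hAn : A.Normal := Subgroup.normal_of_index_eq_two hA
          obtain ⟨i, ε, hi⟩ := (hAmem _).mp (hAn.conj_mem a haA b)
          have hzc : ∀ g : G, Commute g z := fun g => Subgroup.mem_center_iff.mp hzZ g
          have hzε : (z ^ ε) ^ 2 = 1 := by
            rw [← zpow_natCast, ← zpow_mul, mul_comm, zpow_mul, zpow_natCast, ← hz2,
              pow_orderOf_eq_one, one_zpow]
          have hodd : Odd i := zpow_odd_of_conj hm ((hzc a).zpow_right ε)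
            (by rw [pow_succ', pow_mul, hzε, one_pow]) hi
          obtain ⟨k, rfl⟩ := hodd
          -- the commutator subgroup is generated by `d = [b, a]`
          set d := a ^ (2 * k) * z ^ ε with hd
          have hcommd : ∀ g : G, Commute g (z ^ ε) := fun g => (hzc g).zpow_right ε
          have hba : ⁅b, a⁆ = d := by
            rw [commutatorElement_def, hi, mul_assoc, ← (hcommd a⁻¹).eq, ← mul_assoc, hd]
            congr 1
            rw [zpow_add_one, mul_inv_cancel_right]
          have hbd : b * d * b⁻¹ = d ^ (2 * k + 1) := by
            have h1 : b * d * b⁻¹ = (b * a * b⁻¹) ^ (2 * k) * z ^ ε := by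
              rw [conj_zpow, hd, ← mul_assoc, mul_assoc _ (z ^ ε) b⁻¹, ← (hcommd b⁻¹).eq,
                ← mul_assoc]
            rw [h1, hi, (hcommd _).mul_zpow, (hcommd _).mul_zpow, ← zpow_mul a, ← zpow_mul a,
              mul_comm (2 * k + 1), mul_assoc, zpow_add_one (z ^ ε)]
          have hgen : Subgroup.closure {a, b, z} = ⊤ := by
            have hAle : A ≤ Subgroup.closure {a, b, z} := by
              intro g hg
              obtain ⟨i, ε, rfl⟩ := (hAmem g).mp hg
              exact mul_mem (zpow_mem (Subgroup.subset_closure (by simp)) _)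
                (zpow_mem (Subgroup.subset_closure (by simp)) _)
            rw [eq_top_iff]
            intro g _
            by_cases hg : g ∈ A
            · exact hAle hg
            · have hbg : b * g ∈ A := by rw [A.mul_mem_iff_of_index_two hA]; tauto
              have := mul_mem (inv_mem (Subgroup.subset_closure (by simp : b ∈ ({a, b, z} : Set G))))
                (hAle hbg)
              rwa [inv_mul_cancel_left] at this
          have hdn : (Subgroup.zpowers d).Normal := by
            refine zpowers_normal_of_closure_eq_top hgen ?_
            rintro s (rfl | rfl | rfl)
            · have : Commute s d :=
                ((Commute.refl s).zpow_right _).mul_right (hcommd s)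
              rw [this.eq, mul_inv_cancel_right]
              exact Subgroup.mem_zpowers d
            · rw [hbd]
              exact zpow_mem (Subgroup.mem_zpowers d) _
            · rw [← (hzc d).eq, mul_inv_cancel_right]
              exact Subgroup.mem_zpowers d
          have hled : commutator G ≤ Subgroup.zpowers d := by
            refine commutator_le_of_closure_eq_top hgen _ ?_
            have hzl : ∀ g : G, ⁅z, g⁆ = 1 := fun g =>
              commutatorElement_eq_one_iff_commute.mpr (hzc g).symm
            have hzr : ∀ g : G, ⁅g, z⁆ = 1 := fun g =>
              commutatorElement_eq_one_iff_commute.mpr (hzc g)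
            have hdm := Subgroup.mem_zpowers d
            rintro s (rfl | rfl | rfl) t (rfl | rfl | rfl)
            · simp
            · rw [← commutatorElement_inv, hba]; exact inv_mem hdm
            · rw [hzr]; exact one_mem _
            · rw [hba]; exact hdm
            · simp
            · rw [hzr]; exact one_mem _
            · rw [hzl]; exact one_mem _
            · rw [hzl]; exact one_mem _
            · simp
          have hdpow : d ^ 2 ^ (m + 1) = 1 := by
            rw [hd, (hcommd _).mul_pow, pow_succ' 2 m, pow_mul (z ^ ε), hzε, one_pow, mul_one,
              ← zpow_natCast, ← zpow_mul,
              show 2 * k * ((2 * 2 ^ m : ℕ) : ℤ) = (2 ^ (m + 2) : ℕ) * k by push_cast; ring,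
              zpow_mul, zpow_natCast, ← hm, pow_orderOf_eq_one, one_zpow]
          have h1 := Nat.card_le_card_of_injective _ (Subgroup.inclusion_injective hled)
          rw [Nat.card_zpowers] at h1
          have h2 := Nat.le_of_dvd (by positivity) (orderOf_dvd_of_pow_eq_one hdpow)
          have h3 : 2 ^ (m + 2) = 2 * 2 ^ (m + 1) := pow_succ' _ _
          have h4 := Nat.two_pow_pos (m + 1)
          omega

/-- A finite nonabelian 2-group with commutator subgroup of index four is dihedral, quaternion or
semidihedral, in terms of generators `a`, `b` and relations. -/
theorem IsPGroup.exists_maximal_class_generators {G : Type*} [Group G] [Finite G]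
    (hG : IsPGroup 2 G) (hcomm : (commutator G).index = 4) (hne : commutator G ≠ ⊥) :
    ∃ n, 3 ≤ n ∧ ∃ a b : G, Nat.card G = 2 ^ n ∧ orderOf a = 2 ^ (n - 1) ∧
      b ∉ Subgroup.zpowers a ∧ (Subgroup.zpowers a).index = 2 ∧
      ((b * a * b⁻¹ = a⁻¹ ∧ b ^ 2 = 1) ∨
        (b * a * b⁻¹ = a⁻¹ ∧ b ^ 2 = a ^ 2 ^ (n - 2)) ∨
        (4 ≤ n ∧ b * a * b⁻¹ = a ^ (2 ^ (n - 2) - 1) ∧ b ^ 2 = 1)) := by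
  obtain ⟨a, ha⟩ := hG.exists_zpowers_index_two hcomm
  obtain ⟨k, hk⟩ := IsPGroup.iff_card.mp hG
  obtain ⟨m, hm⟩ := hG.eq_two_pow a
  obtain ⟨c, hc⟩ := IsPGroup.iff_card.mp (hG.to_subgroup (commutator G))
  have h1 := (Subgroup.zpowers a).card_mul_index
  have h2 := (commutator G).card_mul_index
  rw [ha, Nat.card_zpowers, hm, hk, ← pow_succ] at h1
  rw [hcomm, hc, hk, show 4 = 2 ^ 2 from rfl, ← pow_add] at h2
  have hk1 := Nat.pow_right_injective le_rfl h1
  have hk2 := Nat.pow_right_injective le_rfl h2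
  have hc0 : c ≠ 0 := by
    rintro rfl
    exact hne (Subgroup.card_eq_one.mp hc)
  obtain ⟨l, rfl⟩ : ∃ l, m = l + 2 := ⟨m - 2, by omega⟩
  have hcl : c = l + 1 := by omega
  have hkl : k = l + 3 := by omega
  clear hk1 hk2 h1 h2 hc0
  subst hcl hkl
  have hn : (Subgroup.zpowers a).Normal := Subgroup.normal_of_index_eq_two ha
  obtain ⟨b, hb⟩ : ∃ b, b ∉ Subgroup.zpowers a := by
    by_contra! h
    rw [(Subgroup.eq_top_iff' _).mpr h, Subgroup.index_top] at ha
    omega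
  obtain ⟨s, hs⟩ := hn.conj_mem a (Subgroup.mem_zpowers a) b
  obtain ⟨j, hj⟩ := (Subgroup.zpowers a).sq_mem_of_index_two ha b
  replace hs : b * a * b⁻¹ = a ^ s := hs.symm
  replace hj : b ^ 2 = a ^ j := hj.symm
  have hsz : ∀ i : ℤ, b * a ^ i * b⁻¹ = a ^ (s * i) := fun i => by
    rw [← conj_zpow, hs, zpow_mul]
  obtain ⟨t, rfl⟩ : Odd s := zpow_odd_of_conj (w := 1) hm (Commute.one_right a) (one_pow _)
    (by rw [hs, mul_one])
  have hgen : Subgroup.closure {b, a} = ⊤ := by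
    rw [eq_top_iff]
    intro g _
    have hle : Subgroup.zpowers a ≤ Subgroup.closure {b, a} := by
      rw [Subgroup.zpowers_le]
      exact Subgroup.subset_closure (by simp)
    by_cases hg : g ∈ Subgroup.zpowers a
    · exact hle hg
    · have hbg : b * g ∈ Subgroup.zpowers a := by rw [Subgroup.mul_mem_iff_of_index_two ha]; tauto
      have := mul_mem (inv_mem (Subgroup.subset_closure (by simp : b ∈ ({b, a} : Set G)))) (hle hbg)
      rwa [inv_mul_cancel_left] at this
  have hba : ⁅b, a⁆ = a ^ (2 * t) := by
    rw [commutatorElement_def, hs, zpow_add_one, mul_inv_cancel_right]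
  have hdvd : ∀ i : ℤ, a ^ i = 1 ↔ (2 ^ (l + 2) : ℤ) ∣ i := fun i => by
    rw [← orderOf_dvd_iff_zpow_eq_one, hm]
    push_cast
    rfl
  have hnd : (Subgroup.zpowers (a ^ (2 * t))).Normal := by
    refine zpowers_normal_of_closure_eq_top hgen ?_
    rintro g (rfl | rfl)
    · rw [hsz, mul_comm (2 * t + 1), zpow_mul a (2 * t)]
      exact zpow_mem (Subgroup.mem_zpowers (a ^ (2 * t))) _
    · rw [((Commute.refl g).zpow_right _).eq, mul_inv_cancel_right]
      exact Subgroup.mem_zpowers _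
  have hled : commutator G ≤ Subgroup.zpowers (a ^ (2 * t)) :=
    commutator_le_of_closure_pair_eq_top hgen _ (hba ▸ Subgroup.mem_zpowers (a ^ (2 * t)))
  -- `[b, a]` generates the commutator subgroup, which has order `2 ^ (l + 1)`
  have ht : Odd t := by
    by_contra heven
    rw [Int.not_odd_iff_even] at heven
    obtain ⟨u, rfl⟩ := heven
    have hpow : (a ^ (2 * (u + u))) ^ 2 ^ l = 1 := by
      rw [← zpow_natCast, ← zpow_mul, hdvd]
      exact ⟨u, by push_cast; ring⟩
    have h1 := Nat.card_le_card_of_injective _ (Subgroup.inclusion_injective hled)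
    rw [Nat.card_zpowers, hc, pow_succ] at h1
    have h2 := Nat.le_of_dvd (by positivity) (orderOf_dvd_of_pow_eq_one hpow)
    have h3 := Nat.two_pow_pos l
    omega
  have hcop : IsCoprime (2 ^ (l + 1) : ℤ) t := by
    obtain ⟨u, rfl⟩ := ht
    exact IsCoprime.pow_left ⟨-u, 1, by ring⟩
  have hw : ∀ i : ℤ, (2 ^ (l + 1) : ℤ) ∣ i → a ^ i = 1 ∨ a ^ i = a ^ 2 ^ (l + 1) := by
    rintro _ ⟨i, rfl⟩
    rcases Int.even_or_odd' i with ⟨u, rfl | rfl⟩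
    · left
      rw [hdvd]
      exact ⟨u, by ring⟩
    · right
      rw [mul_add, zpow_add, (hdvd _).mpr ⟨u, by ring⟩, one_mul, mul_one]
      exact_mod_cast rfl
  have hww : a ^ 2 ^ (l + 1) * a ^ 2 ^ (l + 1) = 1 := by
    rw [← pow_add, ← two_mul, ← pow_succ', ← hm, pow_orderOf_eq_one]
  have hs1 : (2 ^ (l + 1) : ℤ) ∣ 2 * t + 1 + 1 := by
    have h : a ^ ((2 * t + 1) * (2 * t + 1) - 1) = 1 := by
      rw [zpow_sub_one, mul_inv_eq_one, ← hsz, ← hs]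
      calc b * (b * a * b⁻¹) * b⁻¹ = b ^ 2 * a * (b ^ 2)⁻¹ := by rw [sq]; group
        _ = a := by rw [hj, ((Commute.refl a).zpow_left j).eq, mul_inv_cancel_right]
    rw [hdvd] at h
    obtain ⟨v, hv⟩ := h
    refine hcop.dvd_of_dvd_mul_left (z := 2 * t + 1 + 1) ⟨v, ?_⟩
    have h2 : (2 : ℤ) ≠ 0 := two_ne_zero
    apply mul_left_cancel₀ h2
    rw [show (2 : ℤ) ^ (l + 2) = 2 * 2 ^ (l + 1) by ring] at hv
    linarith
  have hj1 : (2 ^ (l + 1) : ℤ) ∣ j := by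
    have h : a ^ ((2 * t + 1) * j - j) = 1 := by
      rw [zpow_sub, mul_inv_eq_one, ← hsz, ← hj]
      group
    rw [hdvd] at h
    obtain ⟨v, hv⟩ := h
    refine hcop.dvd_of_dvd_mul_left ⟨v, ?_⟩
    have h2 : (2 : ℤ) ≠ 0 := two_ne_zero
    apply mul_left_cancel₀ h2
    rw [show (2 : ℤ) ^ (l + 2) = 2 * 2 ^ (l + 1) by ring] at hv
    linarith
  have hcase := hw _ hj1
  rw [← hj] at hcase
  have hcase' := hw _ hs1
  rw [zpow_add_one, ← hs] at hcase'
  refine ⟨l + 3, by omega, ?_⟩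
  simp only [show l + 3 - 1 = l + 2 by omega, show l + 3 - 2 = l + 1 by omega]
  rcases hcase' with h | h
  · have hinv := eq_inv_of_mul_eq_one_left h
    rcases hcase with h' | h'
    · exact ⟨a, b, hk, hm, hb, ha, Or.inl ⟨hinv, h'⟩⟩
    · exact ⟨a, b, hk, hm, hb, ha, Or.inr (Or.inl ⟨hinv, h'⟩)⟩
  · have hpos := Nat.two_pow_pos (l + 1)
    have hrel : b * a * b⁻¹ = a ^ (2 ^ (l + 1) - 1) := by
      rw [pow_sub _ hpos, pow_one, ← h, mul_inv_cancel_right]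
    have hl : 4 ≤ l + 3 := by
      by_contra hl
      obtain rfl : l = 0 := by omega
      obtain ⟨u, rfl⟩ := ht
      have h1 : a ^ (2 * (2 * u + 1) + 1 + 1) = 1 := (hdvd _).mpr ⟨u + 1, by ring⟩
      rw [zpow_add_one, ← hs, h] at h1
      have := orderOf_dvd_of_pow_eq_one h1
      rw [hm] at this
      norm_num at this
    rcases hcase with h' | h'
    · exact ⟨a, b, hk, hm, hb, ha, Or.inr (Or.inr ⟨hl, hrel, h'⟩)⟩
    · -- the square of `ab` is `a * (bab⁻¹) * b²`
      refine ⟨a, a * b, hk, hm, fun hab => hb ?_, ha, Or.inr (Or.inr ⟨hl, ?_, ?_⟩)⟩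
      · rwa [Subgroup.mul_mem_cancel_left _ (Subgroup.mem_zpowers a)] at hab
      · calc a * b * a * (a * b)⁻¹ = a * (b * a * b⁻¹) * a⁻¹ := by group
          _ = _ := by rw [hrel, ← pow_succ', pow_succ, mul_inv_cancel_right]
      · calc (a * b) ^ 2 = a * (b * a * b⁻¹) * a * a⁻¹ * b ^ 2 := by rw [sq, sq]; group
          _ = 1 := by
            rw [mul_assoc a, h, h', ← pow_succ', pow_succ, mul_inv_cancel_right, hww]

/-- The homomorphism from `C_n` that sends the generator to an element `a` with `a ^ n = 1`. -/
def cycHom {G : Type*} [Group G] (n : ℕ) (a : G) (ha : a ^ n = 1) : Cyc n →* G :=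
  AddMonoidHom.toMultiplicativeLeft
    (ZMod.lift n ⟨AddMonoidHom.toMultiplicativeLeft.symm (zpowersHom G a), by
      change Additive.ofMul (a ^ (n : ℤ)) = 0
      rw [zpow_natCast, ha, ofMul_one]⟩)

theorem cycHom_intCast {G : Type*} [Group G] (n : ℕ) (a : G) (ha : a ^ n = 1) (i : ℤ) :
    cycHom n a ha (Multiplicative.ofAdd (i : ZMod n)) = a ^ i := by
  change Additive.toMul (ZMod.lift n _ (i : ZMod n)) = _
  rw [ZMod.lift_coe]
  rfl

theorem exists_zpow_of_index_two {G : Type*} [Group G] {a b : G}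
    (ha : (Subgroup.zpowers a).index = 2) (hb : b ∉ Subgroup.zpowers a) {g : G}
    (hg : g ∉ Subgroup.zpowers a) : ∃ i : ℤ, g = b * a ^ i := by
  have h : b⁻¹ * g ∈ Subgroup.zpowers a := by
    rw [Subgroup.mul_mem_iff_of_index_two ha, inv_mem_iff]
    tauto
  obtain ⟨i, hi⟩ := h
  exact ⟨i, by rw [← mul_inv_cancel_left b g, ← hi]⟩

/-- In the dihedral and quaternion groups all elements outside the cyclic subgroup `⟨a⟩` have the
same square. -/
theorem sq_of_conj_eq_inv {G : Type*} [Group G] {a b : G} (h : b * a * b⁻¹ = a⁻¹) (i : ℤ) :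
    (b * a ^ i) ^ 2 = b ^ 2 := by
  have h' : b * a ^ i * b⁻¹ = a ^ (-i) := by rw [← conj_zpow, h, inv_zpow, zpow_neg]
  calc (b * a ^ i) ^ 2 = (b * a ^ i * b⁻¹) * b ^ 2 * a ^ i := by rw [sq, sq]; group
    _ = b ^ 2 * ((b⁻¹) ^ 2 * a ^ (-i) * b ^ 2) * a ^ i := by rw [h']; group
    _ = b ^ 2 := by
      have h2 : b ^ 2 * a ^ (-i) = a ^ (-i) * b ^ 2 := by
        have h3 : b * a ^ (-i) * b⁻¹ = a ^ i := by
          rw [← conj_zpow, h, inv_zpow, zpow_neg, inv_inv]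
        calc b ^ 2 * a ^ (-i) = b * (b * a ^ (-i) * b⁻¹) * b⁻¹ * b ^ 2 := by rw [sq]; group
          _ = a ^ (-i) * b ^ 2 := by rw [h3, h']
      rw [mul_assoc _ _ (b ^ 2), ← h2]
      group

theorem dihedralGroup_equiv {G : Type*} [Group G] [Finite G] {a b : G}
    (ha : (Subgroup.zpowers a).index = 2) (hb : b ∉ Subgroup.zpowers a)
    (h : b * a * b⁻¹ = a⁻¹) (hb2 : b ^ 2 = 1) : Nonempty (G ≃* DihedralGroup (orderOf a)) := by
  have hab : ∀ i : ℤ, a ^ i * b = b * a ^ (-i) := fun i => by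
    have h' : b * a ^ (-i) * b⁻¹ = a ^ i := by rw [← conj_zpow, h, inv_zpow, zpow_neg, inv_inv]
    rw [← h', inv_mul_cancel_right]
  let E := cycHom (orderOf a) a (pow_orderOf_eq_one a)
  let f : DihedralGroup (orderOf a) → G
    | .r i => E (Multiplicative.ofAdd i)
    | .sr i => b * E (Multiplicative.ofAdd i)
  have hf : ∀ u v, f (u * v) = f u * f v := by
    rintro (i | i) (j | j) <;> obtain ⟨i, rfl⟩ := ZMod.intCast_surjective i <;>
      obtain ⟨j, rfl⟩ := ZMod.intCast_surjective j
    · simp only [DihedralGroup.r_mul_r, f, ← Int.cast_add, E, cycHom_intCast, zpow_add]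
    · simp only [DihedralGroup.r_mul_sr, f, ← Int.cast_sub, E, cycHom_intCast]
      rw [← mul_assoc, hab, mul_assoc, ← zpow_add, neg_add_eq_sub]
    · simp only [DihedralGroup.sr_mul_r, f, ← Int.cast_add, E, cycHom_intCast, zpow_add, mul_assoc]
    · simp only [DihedralGroup.sr_mul_sr, f, ← Int.cast_sub, E, cycHom_intCast]
      rw [mul_assoc, ← mul_assoc (a ^ i), hab, mul_assoc, ← mul_assoc, ← sq, hb2, one_mul,
        ← zpow_add, neg_add_eq_sub]
  let F : DihedralGroup (orderOf a) →* G := MonoidHom.mk' f hf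
  have hsurj : Function.Surjective F := by
    intro g
    by_cases hg : g ∈ Subgroup.zpowers a
    · obtain ⟨i, rfl⟩ := hg
      exact ⟨.r i, cycHom_intCast _ _ (pow_orderOf_eq_one a) _⟩
    · obtain ⟨i, rfl⟩ := exists_zpow_of_index_two ha hb hg
      exact ⟨.sr i, congrArg (b * ·) (cycHom_intCast _ _ (pow_orderOf_eq_one a) _)⟩
  have hcard : Nat.card (DihedralGroup (orderOf a)) = Nat.card G := by
    rw [DihedralGroup.nat_card, ← (Subgroup.zpowers a).card_mul_index, ha, Nat.card_zpowers,
      mul_comm]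
  have : NeZero (orderOf a) := ⟨(orderOf_pos a).ne'⟩
  exact ⟨(MulEquiv.ofBijective F
    ((Nat.bijective_iff_surjective_and_card _).mpr ⟨hsurj, hcard⟩)).symm⟩

theorem quaternionGroup_equiv {G : Type*} [Group G] [Finite G] {a b : G} {m : ℕ}
    (hm : orderOf a = 2 * m) (ha : (Subgroup.zpowers a).index = 2) (hb : b ∉ Subgroup.zpowers a)
    (h : b * a * b⁻¹ = a⁻¹) (hb2 : b ^ 2 = a ^ m) : Nonempty (G ≃* QuaternionGroup m) := by
  have hab : ∀ i : ℤ, a ^ i * b = b * a ^ (-i) := fun i => by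
    have h' : b * a ^ (-i) * b⁻¹ = a ^ i := by rw [← conj_zpow, h, inv_zpow, zpow_neg, inv_inv]
    rw [← h', inv_mul_cancel_right]
  let E := cycHom (2 * m) a (hm ▸ pow_orderOf_eq_one a)
  let f : QuaternionGroup m → G
    | .a i => E (Multiplicative.ofAdd i)
    | .xa i => b * E (Multiplicative.ofAdd i)
  have hf : ∀ u v, f (u * v) = f u * f v := by
    rintro (i | i) (j | j) <;> obtain ⟨i, rfl⟩ := ZMod.intCast_surjective i <;>
      obtain ⟨j, rfl⟩ := ZMod.intCast_surjective j
    · simp only [QuaternionGroup.a_mul_a, f, ← Int.cast_add, E, cycHom_intCast, zpow_add]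
    · simp only [QuaternionGroup.a_mul_xa, f, ← Int.cast_sub, E, cycHom_intCast]
      rw [← mul_assoc, hab, mul_assoc, ← zpow_add, neg_add_eq_sub]
    · simp only [QuaternionGroup.xa_mul_a, f, ← Int.cast_add, E, cycHom_intCast, zpow_add,
        mul_assoc]
    · simp only [QuaternionGroup.xa_mul_xa, f, ← Int.cast_sub, ← Int.cast_add,
        ← Int.cast_natCast (R := ZMod (2 * m)), E, cycHom_intCast]
      rw [mul_assoc, ← mul_assoc (a ^ i), hab, mul_assoc, ← mul_assoc, ← sq, hb2, ← zpow_natCast,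
        ← zpow_add, ← zpow_add]
      congr 1
      ring
  let F : QuaternionGroup m →* G := MonoidHom.mk' f hf
  have hsurj : Function.Surjective F := by
    intro g
    by_cases hg : g ∈ Subgroup.zpowers a
    · obtain ⟨i, rfl⟩ := hg
      exact ⟨.a i, cycHom_intCast _ _ (hm ▸ pow_orderOf_eq_one a) _⟩
    · obtain ⟨i, rfl⟩ := exists_zpow_of_index_two ha hb hg
      exact ⟨.xa i, congrArg (b * ·) (cycHom_intCast _ _ (hm ▸ pow_orderOf_eq_one a) _)⟩
  have : NeZero m := ⟨by rintro rfl; exact (orderOf_pos a).ne' hm⟩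
  have hcard : Nat.card (QuaternionGroup m) = Nat.card G := by
    rw [Nat.card_eq_fintype_card, QuaternionGroup.card, ← (Subgroup.zpowers a).card_mul_index, ha,
      Nat.card_zpowers, hm]
    ring
  exact ⟨(MulEquiv.ofBijective F
    ((Nat.bijective_iff_surjective_and_card _).mpr ⟨hsurj, hcard⟩)).symm⟩

theorem nonempty_mulEquiv_of_surjective {G H : Type*} [Group G] [Group H] {m : ℕ} (f : G →* H)
    (hf : Function.Surjective f) (hG : Finite G ∧ Nat.card G ≤ m) (hH : Nat.card H = m) :
    Nonempty (H ≃* G) := by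
  have := hG.1
  have hle := Nat.card_le_card_of_surjective f hf
  exact ⟨(MulEquiv.ofBijective f ((Nat.bijective_iff_surjective_and_card _).mpr
    ⟨hf, by omega⟩)).symm⟩

/-- A group generated by `x` and `y` with `⟨x⟩` normalized by `y` consists of the elements
`x ^ i * y ^ j`. -/
theorem card_le_of_conj_mem_zpowers {G : Type*} [Group G] {x y : G} {m : ℕ} (hm : m ≠ 0)
    (hgen : Subgroup.closure {x, y} = ⊤) (hx : x ^ m = 1) (hy : y ^ 2 = 1)
    (h : y * x * y⁻¹ ∈ Subgroup.zpowers x) : Finite G ∧ Nat.card G ≤ m * 2 := by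
  obtain ⟨s, hs⟩ := h
  have hyi : ∀ i : ℤ, y * x ^ i = x ^ (s * i) * y := fun i => by
    rw [← mul_inv_eq_iff_eq_mul, ← conj_zpow, ← hs, zpow_mul]
  have hyinv : y⁻¹ = y := inv_eq_of_mul_eq_one_left (by rw [← sq, hy])
  have hall : ∀ g : G, ∃ i j : ℤ, g = x ^ i * y ^ j := by
    refine mem_of_closure_eq_top (T := {g | ∃ i j : ℤ, g = x ^ i * y ^ j}) hgen
      ⟨0, 0, by simp⟩ ?_
    have hyT : ∀ i j : ℤ, y * (x ^ i * y ^ j) = x ^ (s * i) * y ^ (1 + j) := fun i j => by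
      rw [← mul_assoc, hyi, zpow_one_add, mul_assoc]
    rintro g (rfl | rfl) _ ⟨i, j, rfl⟩
    · exact ⟨⟨1 + i, j, by rw [zpow_one_add, mul_assoc]⟩,
        ⟨-1 + i, j, by rw [zpow_add, zpow_neg_one, mul_assoc]⟩⟩
    · rw [hyinv]
      exact ⟨⟨_, _, hyT i j⟩, ⟨_, _, hyT i j⟩⟩
  let f : Cyc m × Cyc 2 → G := fun p => cycHom m x hx p.1 * cycHom 2 y hy p.2
  have hf : Function.Surjective f := by
    intro g
    obtain ⟨i, j, rfl⟩ := hall g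
    exact ⟨(Multiplicative.ofAdd (i : ZMod m), Multiplicative.ofAdd (j : ZMod 2)), by
      simp only [f, cycHom_intCast]⟩
  have : NeZero m := ⟨hm⟩
  refine ⟨Finite.of_surjective f hf, ?_⟩
  have := Nat.card_le_card_of_surjective f hf
  rwa [Nat.card_prod, Nat.card_congr Multiplicative.toAdd, Nat.card_congr Multiplicative.toAdd,
    Nat.card_zmod, Nat.card_zmod] at this

theorem PresentedGroup.closure_pair {rels : Set (FreeGroup (Fin 2))} :
    Subgroup.closure {(PresentedGroup.of 0 : PresentedGroup rels), PresentedGroup.of 1} = ⊤ := by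
  rw [← PresentedGroup.closure_range_of rels]
  congr 1
  ext g
  simp [Fin.exists_fin_two, eq_comm]

theorem MonoidHom.surjective_of_closure {G H : Type*} [Group G] [Group H] (f : G →* H) {S : Set H}
    (hS : Subgroup.closure S = ⊤) (h : ∀ s ∈ S, s ∈ f.range) : Function.Surjective f := by
  rw [← MonoidHom.range_eq_top, eq_top_iff, ← hS, Subgroup.closure_le]
  exact h

theorem semidihedralGroup_equiv {G : Type*} [Group G] [Finite G] {n : ℕ} (hn : 1 ≤ n) {a b : G}
    (hcard : Nat.card G = 2 ^ n) (ha2 : (Subgroup.zpowers a).index = 2)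
    (hb : b ∉ Subgroup.zpowers a)
    (h : b * a * b⁻¹ = a ^ (2 ^ (n - 2) - 1)) (hb2 : b ^ 2 = 1) :
    Nonempty (G ≃* SemidihedralGroup n) := by
  have h2n : 2 ^ n = 2 ^ (n - 1) * 2 := by rw [← pow_succ]; congr 1; omega
  have ha : a ^ 2 ^ (n - 1) = 1 := by
    have := (Subgroup.zpowers a).card_mul_index
    rw [ha2, hcard, Nat.card_zpowers, h2n] at this
    rw [← Nat.eq_of_mul_eq_mul_right two_pos this, pow_orderOf_eq_one]
  have hgen : Subgroup.closure {a, b} = ⊤ := by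
    rw [eq_top_iff]
    intro g _
    have hle : Subgroup.zpowers a ≤ Subgroup.closure {a, b} := by
      rw [Subgroup.zpowers_le]
      exact Subgroup.subset_closure (by simp)
    by_cases hg : g ∈ Subgroup.zpowers a
    · exact hle hg
    · obtain ⟨i, rfl⟩ := exists_zpow_of_index_two ha2 hb hg
      exact mul_mem (Subgroup.subset_closure (by simp)) (hle ⟨i, rfl⟩)
  have hrel : ∀ r ∈ ({.of 0 ^ 2 ^ (n - 1), .of 1 ^ 2,
      .of 1 * .of 0 * (.of 1)⁻¹ * (.of 0 ^ (2 ^ (n - 2) - 1))⁻¹} : Set (FreeGroup (Fin 2))),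
      FreeGroup.lift ![a, b] r = 1 := by
    rintro r (rfl | rfl | rfl)
    · simpa using ha
    · simpa using hb2
    · simp [h]
  let F : SemidihedralGroup n →* G := PresentedGroup.toGroup hrel
  refine nonempty_mulEquiv_of_surjective F (MonoidHom.surjective_of_closure F hgen ?_)
    (m := 2 ^ n) ?_ hcard
  · rintro s (rfl | rfl)
    · exact ⟨.of 0, PresentedGroup.toGroup.of hrel⟩
    · exact ⟨.of 1, PresentedGroup.toGroup.of hrel⟩
  · rw [h2n]
    refine card_le_of_conj_mem_zpowers (by positivity) PresentedGroup.closure_pair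
      (PresentedGroup.one_of_mem (by simp)) (PresentedGroup.one_of_mem (by simp)) ?_
    rw [show (PresentedGroup.of 1 : SemidihedralGroup n) * .of 0 * (.of 1)⁻¹ =
      .of 0 ^ (2 ^ (n - 2) - 1) from PresentedGroup.mk_eq_mk_of_mul_inv_mem (by simp)]
    exact pow_mem (Subgroup.mem_zpowers _) _

/-- If `G/G'` had order at most two, it would be cyclic, and so would be `G`, since `G' ≤ Φ(G)`. -/
theorem IsPGroup.four_le_index_commutator {G : Type*} [Group G] [Finite G] (hG : IsPGroup 2 G)
    (hne : commutator G ≠ ⊥) : 4 ≤ (commutator G).index := by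
  by_contra! hlt
  have hcyc : ∃ g : G, Subgroup.zpowers g ⊔ commutator G = ⊤ := by
    obtain ⟨k, hk⟩ := hG.index (commutator G)
    have hk2 : k < 2 := by
      by_contra! h
      have := Nat.pow_le_pow_right two_pos h
      omega
    interval_cases k
    · exact ⟨1, by rw [Subgroup.index_eq_one.mp hk, sup_top_eq]⟩
    · obtain ⟨g, hg⟩ : ∃ g, g ∉ commutator G := by
        by_contra! h
        rw [(Subgroup.eq_top_iff' _).mpr h, Subgroup.index_top] at hk
        omega
      refine ⟨g, ?_⟩
      rw [eq_top_iff]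
      intro u _
      by_cases hu : u ∈ commutator G
      · exact (le_sup_right : _ ≤ Subgroup.zpowers g ⊔ _) hu
      · have h : g⁻¹ * u ∈ commutator G := by
          rw [Subgroup.mul_mem_iff_of_index_two hk, inv_mem_iff]
          tauto
        have := Subgroup.mul_mem_sup (Subgroup.mem_zpowers g) h
        rwa [mul_inv_cancel_left] at this
  obtain ⟨g, hg⟩ := hcyc
  have htop : Subgroup.zpowers g = ⊤ := frattini_nongenerating
    (top_le_iff.mp (hg ▸ sup_le_sup_left hG.commutator_le_frattini _))
  refine hne (commutator_eq_bot_of_mul_comm fun u v => ?_)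
  obtain ⟨i, rfl⟩ := (htop ▸ Subgroup.mem_top u : u ∈ Subgroup.zpowers g)
  obtain ⟨j, rfl⟩ := (htop ▸ Subgroup.mem_top v : v ∈ Subgroup.zpowers g)
  exact (Commute.refl g).zpow_zpow i j

/-- Every element of `⟨a⟩` lies in `Φ(G)` or in `aΦ(G)`, while `α` moves the coset `aΦ(G)`. -/
theorem FixesNoFrattiniCoset.apply_notMem_zpowers {G : Type*} [Group G] [Finite G]
    {α : MulAut G} (hα : FixesNoFrattiniCoset α) (hG : IsPGroup 2 G)
    {a : G} (ha : a ∉ frattini G) : α a ∉ Subgroup.zpowers a := by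
  rintro ⟨i, hi⟩
  replace hi : a ^ i = α a := hi
  have hsq : ∀ k : ℤ, a ^ (2 * k) ∈ frattini G := fun k => by
    rw [zpow_mul]
    exact zpow_mem (by exact_mod_cast hG.sq_mem_frattini a) _
  rcases Int.even_or_odd' i with ⟨k, rfl | rfl⟩
  · exact (mt (mulAut_mem_iff_of_characteristic _ α a).mp ha) (hi ▸ hsq k)
  · refine hα a ha ?_
    rw [← hi, ← zpow_neg_one, ← zpow_add, neg_add_cancel_comm_assoc]
    exact hsq k

/-- Among the dihedral, quaternion and semidihedral groups only `Q_8` admits an automorphism that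
fixes no nontrivial coset of the Frattini subgroup: `α a` lies outside `⟨a⟩` and has the order of
`a`, while the elements outside `⟨a⟩` have order at most four. -/
theorem FixesNoFrattiniCoset.quaternionGroup_equiv {G : Type*} [Group G] [Finite G]
    {α : MulAut G} (hα : FixesNoFrattiniCoset α) (hG : IsPGroup 2 G)
    (hΦ : (frattini G).index = 2 ^ 2)
    (hcomm : (commutator G).index = 4) (hne : commutator G ≠ ⊥) :
    Nonempty (G ≃* QuaternionGroup 2) := by
  obtain ⟨n, hn, a, b, hcard, ha, hb, hindex, hrel⟩ := hG.exists_maximal_class_generators hcomm hne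
  obtain ⟨l, rfl⟩ : ∃ l, n = l + 3 := ⟨n - 3, by omega⟩
  simp only [show l + 3 - 1 = l + 2 by omega, show l + 3 - 2 = l + 1 by omega] at ha hrel
  have haΦ : a ∉ frattini G := by
    intro h
    have h1 := Subgroup.card_dvd_of_le ((Subgroup.zpowers_le).mpr h)
    rw [Nat.card_zpowers, ha] at h1
    have h2 := (frattini G).card_mul_index
    rw [hΦ, hcard, show 2 ^ (l + 3) = 2 ^ (l + 1) * 2 ^ 2 by ring] at h2
    rw [Nat.eq_of_mul_eq_mul_right (by norm_num) h2] at h1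
    have := (Nat.pow_dvd_pow_iff_le_right' (b := 0)).mp h1
    omega
  obtain ⟨i, hi⟩ := exists_zpow_of_index_two hindex hb (hα.apply_notMem_zpowers hG haΦ)
  -- a power of `a` that is trivial, transported back from `α a`
  have key : ∀ k, (b * a ^ i) ^ k = 1 → 2 ^ (l + 2) ∣ k := fun k hk => by
    rw [← ha, orderOf_dvd_iff_pow_eq_one]
    rwa [← hi, ← map_pow, map_eq_one_iff α α.injective] at hk
  rcases hrel with ⟨h, h2⟩ | ⟨h, h2⟩ | ⟨hl, h, h2⟩
  · have := Nat.le_of_dvd two_pos (key 2 (by rw [sq_of_conj_eq_inv h, h2]))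
    have h4 : 4 ≤ 2 ^ (l + 2) := Nat.pow_le_pow_right two_pos (by omega : 2 ≤ l + 2)
    omega
  · have h1 : (b * a ^ i) ^ 4 = 1 := by
      rw [show 4 = 2 * 2 from rfl, pow_mul, sq_of_conj_eq_inv h, h2, ← pow_mul, ← pow_succ, ← ha,
        pow_orderOf_eq_one]
    have h4 := Nat.le_of_dvd (by norm_num) (key 4 h1)
    obtain rfl : l = 0 := by
      by_contra hl
      have : 8 ≤ 2 ^ (l + 2) := Nat.pow_le_pow_right two_pos (by omega : 3 ≤ l + 2)
      omega
    exact _root_.quaternionGroup_equiv (by rw [ha]; norm_num) hindex hb h h2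
  · -- the square of `b * a ^ i` is a power of `a ^ 2 ^ (l + 1)`
    have hba : b * a ^ i * b⁻¹ = a ^ ((2 ^ (l + 1) - 1 : ℤ) * i) := by
      rw [← conj_zpow, h, zpow_mul, ← zpow_natCast, Nat.cast_sub (Nat.one_le_two_pow)]
      push_cast
      rfl
    have hsq : (b * a ^ i) ^ 2 = a ^ (2 ^ (l + 1) * i) := by
      have hbinv : b⁻¹ = b := inv_eq_of_mul_eq_one_left (by rw [← sq, h2])
      calc (b * a ^ i) ^ 2 = (b * a ^ i * b) * a ^ i := by rw [sq]; group
        _ = _ := by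
          nth_rw 2 [← hbinv]
          rw [hba, ← zpow_add]
          congr 1
          ring
    have h1 : (b * a ^ i) ^ 4 = 1 := by
      rw [show 4 = 2 * 2 from rfl, pow_mul, hsq, ← zpow_natCast, ← zpow_mul,
        show (2 ^ (l + 1) * i * ((2 : ℕ) : ℤ)) = ((2 ^ (l + 2) : ℕ) : ℤ) * i by push_cast; ring,
        zpow_mul, zpow_natCast, ← ha, pow_orderOf_eq_one, one_zpow]
    have h4 := Nat.le_of_dvd (by norm_num) (key 4 h1)
    have : 8 ≤ 2 ^ (l + 2) := Nat.pow_le_pow_right two_pos (by omega : 3 ≤ l + 2)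
    omega

/-! ### 2-groups with a self-centralizing four-group or quaternion subgroup -/

/-- A generalized quaternion group, given by generators and relations, has only one involution. -/
theorem eq_of_sq_eq_one_of_sq_eq {G : Type*} [Group G] {a b : G} {m : ℕ}
    (ha : orderOf a = 2 ^ (m + 1)) (hindex : (Subgroup.zpowers a).index = 2)
    (hb : b ∉ Subgroup.zpowers a) (h : b * a * b⁻¹ = a⁻¹) (hb2 : b ^ 2 = a ^ 2 ^ m) {g : G}
    (hg : g ^ 2 = 1) (hg1 : g ≠ 1) : g = a ^ 2 ^ m := by
  have hne : a ^ 2 ^ m ≠ 1 := by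
    intro h
    have h1 := Nat.le_of_dvd (by positivity) (orderOf_dvd_of_pow_eq_one h)
    rw [ha, pow_succ] at h1
    have := Nat.two_pow_pos m
    omega
  by_cases hga : g ∈ Subgroup.zpowers a
  · obtain ⟨i, rfl⟩ := hga
    have hdvd : ∀ i : ℤ, a ^ i = 1 ↔ (2 ^ (m + 1) : ℤ) ∣ i := fun i => by
      rw [← orderOf_dvd_iff_zpow_eq_one, ha]
      push_cast
      rfl
    simp only at hg hg1 ⊢
    rw [← zpow_natCast, ← zpow_mul, hdvd, pow_succ] at hg
    obtain ⟨u, rfl⟩ : (2 ^ m : ℤ) ∣ i :=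
      Int.dvd_of_mul_dvd_mul_right two_ne_zero (by exact_mod_cast hg)
    rcases Int.even_or_odd' u with ⟨v, rfl | rfl⟩
    · exact absurd ((hdvd _).mpr ⟨v, by ring⟩) hg1
    · rw [mul_add, zpow_add, (hdvd _).mpr ⟨v, by ring⟩, one_mul, mul_one]
      exact_mod_cast rfl
  · obtain ⟨i, rfl⟩ := exists_zpow_of_index_two hindex hb hga
    rw [sq_of_conj_eq_inv h, hb2] at hg
    exact absurd hg hne

/-- A 2-group with a self-centralizing four-subgroup has maximal class; the quaternion groups are
excluded because they have only one involution. -/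
theorem IsPGroup.dihedral_or_semidihedral_of_four_subgroup {G : Type*} [Group G] [Finite G]
    (hG : IsPGroup 2 G) {Q : Subgroup G} (e : Q ≃* Cyc 2 × Cyc 2)
    (hQ : Subgroup.centralizer (Q : Set G) ≤ Q) (hQtop : Q ≠ ⊤) :
    (∃ n, 3 ≤ n ∧ Nonempty (G ≃* DihedralGroup (2 ^ (n - 1)))) ∨
      ∃ n, 4 ≤ n ∧ Nonempty (G ≃* SemidihedralGroup n) := by
  have hcardQ : Nat.card Q = 4 := by
    rw [Nat.card_congr e.toEquiv, Nat.card_prod, Nat.card_congr Multiplicative.toAdd, Nat.card_zmod]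
  have hne : commutator G ≠ ⊥ := by
    intro h
    refine hQtop (top_le_iff.mp (le_trans (fun g _ => ?_) hQ))
    rw [Subgroup.mem_centralizer_iff]
    intro q _
    rw [← commutatorElement_eq_one_iff_mul_comm, ← Subgroup.mem_bot, ← h]
    exact Subgroup.commutator_mem_commutator (Subgroup.mem_top _) (Subgroup.mem_top _)
  have hcomm := le_antisymm (hG.index_commutator_le_of_centralizer_le hcardQ hQ)
    (hG.four_le_index_commutator hne)
  obtain ⟨n, hn, a, b, hcard, ha, hb, hindex, ⟨h, h2⟩ | ⟨h, h2⟩ | ⟨hn4, h, h2⟩⟩ :=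
    hG.exists_maximal_class_generators hcomm hne
  · exact Or.inl ⟨n, hn, ha ▸ dihedralGroup_equiv hindex hb h h2⟩
  · exfalso
    have ha' : orderOf a = 2 ^ (n - 2 + 1) := by rw [ha]; congr 1; omega
    have hinv : ∀ v : Cyc 2 × Cyc 2, v ≠ 1 → (e.symm v : G) = a ^ 2 ^ (n - 2) := fun v hv => by
      refine eq_of_sq_eq_one_of_sq_eq ha' hindex hb h h2 ?_ ?_
      · have hv2 : v ^ 2 = 1 := by revert v; decide
        rw [← SubgroupClass.coe_pow, ← map_pow, hv2, map_one, OneMemClass.coe_one]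
      · rwa [Ne, OneMemClass.coe_eq_one, map_eq_one_iff _ e.symm.injective]
    have h1 := hinv (Multiplicative.ofAdd 1, 1) (by decide)
    have h3 := hinv (1, Multiplicative.ofAdd 1) (by decide)
    have := e.symm.injective (Subtype.ext (h1.trans h3.symm))
    revert this
    decide
  · exact Or.inr ⟨n, hn4, semidihedralGroup_equiv (by omega) hcard hindex hb h h2⟩

theorem quaternionGroup_two_center : ∀ q : QuaternionGroup 2, (∀ u, u * q = q * u) →
    q = 1 ∨ q = .a 2 := by decide

theorem quaternionGroup_two_generators : ∀ q : QuaternionGroup 2,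
    ∃ i < 4, ∃ j < 2, q = .a 1 ^ i * .xa 0 ^ j := by decide

/-- The automorphisms of `Q_8` that act trivially modulo the center are inner. -/
theorem quaternionGroup_two_exists_conj : ∀ s t : QuaternionGroup 2, (s = 1 ∨ s = .a 2) →
    (t = 1 ∨ t = .a 2) →
    ∃ q : QuaternionGroup 2, ⁅q, .a 1⁆ = s ∧ ⁅q, .xa 0⁆ = t := by
  simp only [commutatorElement_def]
  decide

/-- The quotient by the center inherits a self-centralizing four-subgroup, so the commutator
subgroup, which contains the center, has index four. -/
theorem IsPGroup.index_commutator_le_of_quaternion_subgroup {G : Type*} [Group G] [Finite G]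
    (hG : IsPGroup 2 G) {Q : Subgroup G} (e : Q ≃* QuaternionGroup 2)
    (hQ : Subgroup.centralizer (Q : Set G) ≤ Q) : (commutator G).index ≤ 4 := by
  set x := e.symm (.a 1) with hx
  set y := e.symm (.xa 0) with hy
  set z := e.symm (.a 2) with hz
  have hz1 : (z : G) ≠ 1 := by
    rw [Ne, OneMemClass.coe_eq_one, hz, map_eq_one_iff _ e.symm.injective]
    decide
  have hZQ : Subgroup.center G ≤ Q := (Subgroup.center_le_centralizer _).trans hQ
  have hZ : ∀ c ∈ Subgroup.center G, c = 1 ∨ c = z := by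
    intro c hc
    have h := quaternionGroup_two_center (e ⟨c, hZQ hc⟩) (fun u => by
      obtain ⟨u, rfl⟩ := e.surjective u
      rw [← map_mul, ← map_mul]
      congr 1
      exact Subtype.ext (Subgroup.mem_center_iff.mp hc u))
    rcases h with h | h
    · left
      rw [map_eq_one_iff _ e.injective] at h
      exact congrArg Subtype.val h
    · right
      rw [← e.eq_symm_apply] at h
      exact congrArg Subtype.val h
  have hnt : Nontrivial G := ⟨z, 1, hz1⟩
  have hzZ : (z : G) ∈ Subgroup.center G := by
    have := hG.center_nontrivial
    obtain ⟨c, hc⟩ := exists_ne (1 : Subgroup.center G)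
    rw [← (hZ c c.2).resolve_left (fun h => hc (Subtype.ext h))]
    exact c.2
  have hcardZ : Nat.card (Subgroup.center G) = 2 := by
    have : Subgroup.center G = Subgroup.zpowers (z : G) := by
      apply le_antisymm
      · intro c hc
        rcases hZ c hc with rfl | rfl
        · exact one_mem _
        · exact Subgroup.mem_zpowers _
      · rwa [Subgroup.zpowers_le]
    rw [this, Nat.card_zpowers, Subgroup.orderOf_coe, hz, e.symm.orderOf_eq]
    exact orderOf_eq_prime (by decide) (by decide)
  have hcardQ : Nat.card Q = 8 := by
    rw [Nat.card_congr e.toEquiv, Nat.card_eq_fintype_card, QuaternionGroup.card]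
  have hxy : ⁅(x : G), (y : G)⁆ = z := by
    have : ⁅x, y⁆ = z := by
      rw [hx, hy, hz, ← map_commutatorElement]
      congr 1
    rw [← this]
    rfl
  set π := QuotientGroup.mk' (Subgroup.center G)
  have hπ : Function.Surjective π := QuotientGroup.mk'_surjective _
  have hcardQ' : Nat.card (Q.map π) = 4 := by
    have h := ((Subgroup.center G).subgroupOf Q).card_mul_index
    rw [Nat.card_congr (Subgroup.subgroupOfEquivOfLe hZQ).toEquiv, hcardZ, hcardQ] at h
    rw [← Subgroup.relIndex_ker, QuotientGroup.ker_mk', Subgroup.relIndex]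
    omega
  have hcent : Subgroup.centralizer (Q.map π : Set (G ⧸ Subgroup.center G)) ≤ Q.map π := by
    intro v hv
    obtain ⟨g, rfl⟩ := hπ v
    rw [Subgroup.mem_centralizer_iff] at hv
    have hgZ : ∀ u ∈ Q, ⁅g, u⁆ ∈ Subgroup.center G := fun u hu => by
      rw [← QuotientGroup.ker_mk' (Subgroup.center G), MonoidHom.mem_ker, map_commutatorElement,
        commutatorElement_eq_one_iff_mul_comm]
      exact (hv _ (Subgroup.mem_map_of_mem _ hu)).symm
    have hgz : ∀ u : Q, ∃ s : QuaternionGroup 2, (s = 1 ∨ s = .a 2) ∧ ⁅g, (u : G)⁆ = e.symm s :=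
      fun u => by
        rcases hZ _ (hgZ u u.2) with h | h
        · exact ⟨1, Or.inl rfl, by rw [h, map_one, OneMemClass.coe_one]⟩
        · exact ⟨.a 2, Or.inr rfl, h⟩
    obtain ⟨s, hs, hsx⟩ := hgz x
    obtain ⟨t, ht, hty⟩ := hgz y
    obtain ⟨q, hqs, hqt⟩ := quaternionGroup_two_exists_conj s t hs ht
    -- `q` and `g` induce the same automorphism of `Q`
    have hcomm : ∀ u : Q, ⁅g, (u : G)⁆ = ⁅(e.symm q : G), (u : G)⁆ →
        Commute ((e.symm q : G)⁻¹ * g) u := fun u hu => by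
      simp only [commutatorElement_def, mul_left_inj] at hu
      calc (e.symm q : G)⁻¹ * g * u = (e.symm q : G)⁻¹ * (g * u * g⁻¹) * g := by group
        _ = u * ((e.symm q : G)⁻¹ * g) := by rw [hu]; group
    have hqx : Commute ((e.symm q : G)⁻¹ * g) x := hcomm x (by
      rw [hsx, ← hqs, map_commutatorElement]; rfl)
    have hqy : Commute ((e.symm q : G)⁻¹ * g) y := hcomm y (by
      rw [hty, ← hqt, map_commutatorElement]; rfl)
    have hmem : (e.symm q : G)⁻¹ * g ∈ Q := by
      refine hQ (Subgroup.mem_centralizer_iff.mpr fun u hu => ?_)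
      obtain ⟨i, -, j, -, hij⟩ := quaternionGroup_two_generators (e ⟨u, hu⟩)
      have : u = (x : G) ^ i * (y : G) ^ j := by
        rw [← e.eq_symm_apply, map_mul, map_pow, map_pow] at hij
        exact congrArg Subtype.val hij
      rw [this]
      exact ((hqx.pow_right i).mul_right (hqy.pow_right j)).symm
    have := mul_mem (e.symm q).2 hmem
    rw [mul_inv_cancel_left] at this
    exact Subgroup.mem_map_of_mem _ this
  have hmap : (commutator G).map π = commutator (G ⧸ Subgroup.center G) := by
    rw [commutator_def, Subgroup.map_commutator, Subgroup.map_top_of_surjective _ hπ,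
      commutator_def]
  rw [← Subgroup.index_map_eq _ hπ, hmap]
  · exact (hG.to_quotient _).index_commutator_le_of_centralizer_le hcardQ' hcent
  · rw [QuotientGroup.ker_mk']
    intro c hc
    rcases hZ c hc with rfl | rfl
    · exact one_mem _
    · rw [← hxy]
      exact Subgroup.commutator_mem_commutator (Subgroup.mem_top _) (Subgroup.mem_top _)

/-- A 2-group with a self-centralizing subgroup `Q_8` has maximal class; the dihedral groups are
excluded because their elements of order four commute with each other. -/
theorem IsPGroup.quaternion_or_semidihedral_of_quaternion_subgroup {G : Type*} [Group G] [Finite G]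
    (hG : IsPGroup 2 G) {Q : Subgroup G} (e : Q ≃* QuaternionGroup 2)
    (hQ : Subgroup.centralizer (Q : Set G) ≤ Q) :
    (∃ n, 3 ≤ n ∧ Nonempty (G ≃* QuaternionGroup (2 ^ (n - 2)))) ∨
      ∃ n, 4 ≤ n ∧ Nonempty (G ≃* SemidihedralGroup n) := by
  have hxy : ⁅(e.symm (.a 1) : G), (e.symm (.xa 0) : G)⁆ ≠ 1 := by
    intro h
    have h1 : ⁅e.symm (.a 1), e.symm (.xa 0)⁆ = 1 := Subtype.ext h
    rw [← map_commutatorElement, map_eq_one_iff _ e.symm.injective] at h1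
    revert h1
    decide
  have hne : commutator G ≠ ⊥ := by
    intro h
    refine hxy ?_
    rw [← Subgroup.mem_bot, ← h]
    exact Subgroup.commutator_mem_commutator (Subgroup.mem_top _) (Subgroup.mem_top _)
  have hcomm := le_antisymm (hG.index_commutator_le_of_quaternion_subgroup e hQ)
    (hG.four_le_index_commutator hne)
  obtain ⟨n, hn, a, b, hcard, ha, hb, hindex, ⟨h, h2⟩ | ⟨h, h2⟩ | ⟨hn4, h, h2⟩⟩ :=
    hG.exists_maximal_class_generators hcomm hne
  · exfalso
    have hmem : ∀ v : QuaternionGroup 2, v ^ 2 ≠ 1 → (e.symm v : G) ∈ Subgroup.zpowers a := by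
      intro v hv
      by_contra hva
      obtain ⟨i, hi⟩ := exists_zpow_of_index_two hindex hb hva
      refine hv ?_
      rw [← map_eq_one_iff _ e.symm.injective, ← OneMemClass.coe_eq_one, map_pow,
        SubgroupClass.coe_pow, hi, sq_of_conj_eq_inv h, h2]
    obtain ⟨i, hi⟩ := hmem (.a 1) (by decide)
    obtain ⟨j, hj⟩ := hmem (.xa 0) (by decide)
    refine hxy ?_
    rw [← hi, ← hj, commutatorElement_eq_one_iff_commute]
    exact (Commute.refl a).zpow_zpow i j
  · refine Or.inl ⟨n, hn, quaternionGroup_equiv ?_ hindex hb h h2⟩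
    rw [ha, ← pow_succ']
    congr 1
    omega
  · exact Or.inr ⟨n, hn4, semidihedralGroup_equiv (by omega) hcard hindex hb h h2⟩

/-! ### Orders of the presented groups -/

/-- Normal form in a two-generator group in which `c = [x, y]` is central. -/
theorem exists_normal_form {G : Type*} [Group G] {x y : G} {m n : ℕ} (hm : m ≠ 0)
    (hn : n ≠ 0) (hxc : Commute x ⁅x, y⁆) (hyc : Commute y ⁅x, y⁆)
    (hx : x ^ m ∈ Subgroup.zpowers ⁅x, y⁆) (hy : y ^ m ∈ Subgroup.zpowers ⁅x, y⁆)
    (hc : ⁅x, y⁆ ^ n = 1) {g : G} (hg : g ∈ Subgroup.closure {x, y}) :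
    ∃ (i : Fin m) (j : Fin m) (k : Fin n), g = x ^ (i : ℕ) * y ^ (j : ℕ) * ⁅x, y⁆ ^ (k : ℕ) := by
  set c := ⁅x, y⁆ with hcdef
  have hyx : y * x * y⁻¹ = c⁻¹ * x := by
    rw [hcdef, commutatorElement_def]
    group
  have hyxi : ∀ i : ℤ, y * x ^ i = c ^ (-i) * x ^ i * y := fun i => by
    rw [← mul_inv_eq_iff_eq_mul, ← conj_zpow, hyx, (hxc.symm.inv_left).mul_zpow, inv_zpow,
      zpow_neg]
  have hyxi' : ∀ i : ℤ, y⁻¹ * x ^ i = c ^ i * x ^ i * y⁻¹ := fun i => by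
    rw [inv_mul_eq_iff_eq_mul, ← mul_assoc, ← mul_assoc, (hyc.zpow_right i).eq, mul_assoc (c ^ i),
      hyxi, ← mul_assoc, ← mul_assoc, ← zpow_add, add_neg_cancel, zpow_zero, one_mul,
      mul_inv_cancel_right]
  have hall : ∃ i j k : ℤ, g = x ^ i * y ^ j * c ^ k := by
    induction hg using Subgroup.closure_induction_left with
    | one => exact ⟨0, 0, 0, by simp⟩
    | mul_left s hs t _ ht =>
      obtain ⟨i, j, k, rfl⟩ := ht
      rcases hs with rfl | rfl
      · exact ⟨1 + i, j, k, by simp only [zpow_one_add, mul_assoc]⟩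
      · refine ⟨i, 1 + j, k - i, ?_⟩
        rw [← mul_assoc, ← mul_assoc, hyxi, (hxc.symm.zpow_zpow _ _).eq, mul_assoc (x ^ i),
          (hyc.symm.zpow_left _).eq, ← mul_assoc (x ^ i), mul_assoc (x ^ i * s),
          ((hyc.symm.zpow_zpow _ _)).eq, ← mul_assoc, mul_assoc (x ^ i), ← zpow_one_add,
          mul_assoc (x ^ i * _), ← zpow_add, neg_add_eq_sub]
    | inv_mul_cancel s hs t _ ht =>
      obtain ⟨i, j, k, rfl⟩ := ht
      rcases hs with rfl | rfl
      · exact ⟨-1 + i, j, k, by simp only [zpow_add, zpow_neg_one, mul_assoc]⟩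
      · refine ⟨i, -1 + j, i + k, ?_⟩
        rw [← mul_assoc, ← mul_assoc, hyxi', (hxc.symm.zpow_zpow _ _).eq, mul_assoc (x ^ i),
          (hyc.inv_left.symm.zpow_left _).eq, ← mul_assoc (x ^ i), mul_assoc (x ^ i * s⁻¹),
          ((hyc.symm.zpow_zpow _ _)).eq, ← mul_assoc, mul_assoc (x ^ i), ← zpow_neg_one,
          ← zpow_add, mul_assoc (x ^ i * _), ← zpow_add]
  have hred : ∀ (u : G), u ^ m ∈ Subgroup.zpowers c → ∀ i : ℤ, ∃ (i' : Fin m) (k : ℤ),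
      u ^ i = u ^ (i' : ℕ) * c ^ k := by
    rintro u ⟨l, hl⟩ i
    have hm' : (0 : ℤ) < m := by exact_mod_cast Nat.pos_of_ne_zero hm
    have h0 := Int.emod_nonneg i hm'.ne'
    have h1 := Int.emod_lt_of_pos i hm'
    refine ⟨⟨(i % m).toNat, by omega⟩, l * (i / m), ?_⟩
    rw [zpow_mul, show c ^ l = u ^ m from hl, ← zpow_natCast u m, ← zpow_mul, ← zpow_natCast,
      ← zpow_add]
    congr 1
    rw [Int.toNat_of_nonneg h0]
    exact (Int.emod_add_mul_ediv i m).symm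
  obtain ⟨i, j, k, rfl⟩ := hall
  obtain ⟨i', k₁, hi⟩ := hred x hx i
  obtain ⟨j', k₂, hj⟩ := hred y hy j
  have hn' : (0 : ℤ) < n := by exact_mod_cast Nat.pos_of_ne_zero hn
  have h0 := Int.emod_nonneg (k₁ + k₂ + k) hn'.ne'
  have h1 := Int.emod_lt_of_pos (k₁ + k₂ + k) hn'
  refine ⟨i', j', ⟨((k₁ + k₂ + k) % n).toNat, by omega⟩, ?_⟩
  have hk : c ^ ((k₁ + k₂ + k) % n).toNat = c ^ (k₁ + k₂ + k) := by
    conv_rhs => rw [← Int.emod_add_mul_ediv (k₁ + k₂ + k) n]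
    rw [zpow_add, zpow_mul, zpow_natCast, hc, one_zpow, mul_one, ← zpow_natCast,
      Int.toNat_of_nonneg h0]
  rw [hi, hj]
  simp only
  rw [hk, zpow_add, zpow_add]
  have h2 : Commute (c ^ k₁) (y ^ (j' : ℕ)) := (hyc.symm.zpow_left _).pow_right _
  simp only [mul_assoc]
  rw [← mul_assoc (c ^ k₁), h2.eq]
  simp only [mul_assoc]

theorem card_le_of_central_commutator {G : Type*} [Group G] {x y : G} {m n : ℕ} (hm : m ≠ 0)
    (hn : n ≠ 0) (hgen : Subgroup.closure {x, y} = ⊤) (hxc : ⁅x, ⁅x, y⁆⁆ = 1)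
    (hyc : ⁅y, ⁅x, y⁆⁆ = 1)
    (hx : x ^ m ∈ Subgroup.zpowers ⁅x, y⁆) (hy : y ^ m ∈ Subgroup.zpowers ⁅x, y⁆)
    (hc : ⁅x, y⁆ ^ n = 1) : Finite G ∧ Nat.card G ≤ m * m * n := by
  let f : Fin m × Fin m × Fin n → G := fun p =>
    x ^ (p.1 : ℕ) * y ^ (p.2.1 : ℕ) * ⁅x, y⁆ ^ (p.2.2 : ℕ)
  have hf : Function.Surjective f := fun g => by
    obtain ⟨i, j, k, h⟩ := exists_normal_form hm hn
      (commutatorElement_eq_one_iff_commute.mp hxc) (commutatorElement_eq_one_iff_commute.mp hyc)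
      hx hy hc (hgen ▸ Subgroup.mem_top g)
    exact ⟨(i, j, k), h.symm⟩
  refine ⟨Finite.of_surjective f hf, ?_⟩
  have := Nat.card_le_card_of_surjective f hf
  rwa [Nat.card_prod, Nat.card_prod, Nat.card_fin, Nat.card_fin, ← mul_assoc] at this

/-- The subgroup `⟨x, y⟩` is normalized by `a` and contains `a ^ 2`, so it has index at most two;
its order is bounded by means of the normal form. -/
theorem card_le_of_swapped_generators {G : Type*} [Group G] {x y a : G} {m n k : ℕ} (hm : m ≠ 0)
    (hn : n ≠ 0) (hgen : Subgroup.closure {x, y, a} = ⊤) (hxc : ⁅x, ⁅x, y⁆⁆ = 1)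
    (hyc : ⁅y, ⁅x, y⁆⁆ = 1) (hx : x ^ m = 1) (hc : ⁅x, y⁆ ^ n = 1)
    (ha : a ^ 2 = ⁅x, y⁆ ^ k) (hax : a * x * a⁻¹ = y) :
    Finite G ∧ Nat.card G ≤ 2 * (m * m * n) := by
  rw [commutatorElement_eq_one_iff_commute] at hxc hyc
  have hxC : x ∈ Subgroup.closure {x, y} := Subgroup.subset_closure (by simp)
  have hyC : y ∈ Subgroup.closure {x, y} := Subgroup.subset_closure (by simp)
  have ha2C : a ^ 2 ∈ Subgroup.closure {x, y} := by
    rw [ha, commutatorElement_def]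
    exact pow_mem (mul_mem (mul_mem (mul_mem hxC hyC) (inv_mem hxC)) (inv_mem hyC)) _
  have hay : a * y * a⁻¹ = x := by
    calc a * y * a⁻¹ = a ^ 2 * x * (a ^ 2)⁻¹ := by rw [← hax, sq]; group
      _ = x := by rw [ha, (hxc.pow_right k).symm.eq, mul_inv_cancel_right]
  have hconj : ∀ g ∈ Subgroup.closure {x, y}, a * g * a⁻¹ ∈ Subgroup.closure {x, y} := by
    intro g hg
    have hle : (Subgroup.closure {x, y}).map (MulAut.conj a).toMonoidHom ≤
        Subgroup.closure {x, y} := by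
      rw [MonoidHom.map_closure, Subgroup.closure_le]
      rintro _ ⟨s, rfl | rfl, rfl⟩
      · simpa [hax] using hyC
      · simpa [hay] using hxC
    exact hle (Subgroup.mem_map_of_mem _ hg)
  have hconj' : ∀ g ∈ Subgroup.closure {x, y}, a⁻¹ * g * a ∈ Subgroup.closure {x, y} := by
    intro g hg
    have h := mul_mem (mul_mem (inv_mem ha2C) (hconj g hg)) ha2C
    rwa [show (a ^ 2)⁻¹ * (a * g * a⁻¹) * a ^ 2 = a⁻¹ * g * a by rw [sq]; group] at h
  have hall : ∀ g : G, ∃ e : Fin 2, ∃ h ∈ Subgroup.closure {x, y}, g = a ^ (e : ℕ) * h := by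
    refine mem_of_closure_eq_top
      (T := {g | ∃ e : Fin 2, ∃ h ∈ Subgroup.closure {x, y}, g = a ^ (e : ℕ) * h}) hgen
      ⟨0, 1, one_mem _, by simp⟩ ?_
    have hCT : ∀ s ∈ Subgroup.closure {x, y}, ∀ (e : Fin 2), ∀ h ∈ Subgroup.closure {x, y},
        ∃ e' : Fin 2, ∃ h' ∈ Subgroup.closure {x, y},
          s * (a ^ (e : ℕ) * h) = a ^ (e' : ℕ) * h' := by
      intro s hs e h hh
      match e with
      | 0 => exact ⟨0, s * h, mul_mem hs hh, by simp⟩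
      | 1 => exact ⟨1, a⁻¹ * s * a * h, mul_mem (hconj' s hs) hh, by simp; group⟩
    rintro s (rfl | rfl | rfl) _ ⟨e, h, hh, rfl⟩
    · exact ⟨hCT _ hxC e h hh, hCT _ (inv_mem hxC) e h hh⟩
    · exact ⟨hCT _ hyC e h hh, hCT _ (inv_mem hyC) e h hh⟩
    · match e with
      | 0 =>
        exact ⟨⟨1, h, hh, by simp⟩, ⟨1, (s ^ 2)⁻¹ * h, mul_mem (inv_mem ha2C) hh, by simp [sq, mul_assoc]⟩⟩
      | 1 =>
        exact ⟨⟨0, s ^ 2 * h, mul_mem ha2C hh, by simp [sq, mul_assoc]⟩, ⟨0, h, hh, by simp⟩⟩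
  let f : Fin 2 × Fin m × Fin m × Fin n → G := fun p =>
    a ^ (p.1 : ℕ) * (x ^ (p.2.1 : ℕ) * y ^ (p.2.2.1 : ℕ) * ⁅x, y⁆ ^ (p.2.2.2 : ℕ))
  have hf : Function.Surjective f := fun g => by
    obtain ⟨e, h, hh, rfl⟩ := hall g
    have hy : y ^ m = 1 := by rw [← hax, conj_pow, hx, mul_one, mul_inv_cancel]
    obtain ⟨i, j, k, rfl⟩ := exists_normal_form hm hn hxc hyc (hx ▸ one_mem _) (hy ▸ one_mem _)
      hc hh
    exact ⟨(e, i, j, k), rfl⟩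
  refine ⟨Finite.of_surjective f hf, ?_⟩
  have := Nat.card_le_card_of_surjective f hf
  rwa [Nat.card_prod, Nat.card_prod, Nat.card_prod, Nat.card_fin, Nat.card_fin, Nat.card_fin,
    ← mul_assoc m] at this

theorem minimalNonabelianGroup_card_le (r : ℕ) : Finite (MinimalNonabelianGroup 2 r r) ∧
    Nat.card (MinimalNonabelianGroup 2 r r) ≤ 2 ^ r * 2 ^ r * 2 := by
  let x : FreeGroup (Fin 2) := .of 0
  let y : FreeGroup (Fin 2) := .of 1
  have h1 : (PresentedGroup.of 0 : MinimalNonabelianGroup 2 r r) ^ 2 ^ r = 1 :=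
    PresentedGroup.one_of_mem (x := x ^ 2 ^ r) (by simp [x])
  have h2 : (PresentedGroup.of 1 : MinimalNonabelianGroup 2 r r) ^ 2 ^ r = 1 :=
    PresentedGroup.one_of_mem (x := y ^ 2 ^ r) (by simp [y])
  exact card_le_of_central_commutator (by positivity) two_ne_zero PresentedGroup.closure_pair
    (PresentedGroup.one_of_mem (x := ⁅x, ⁅x, y⁆⁆) (by simp [x, y]))
    (PresentedGroup.one_of_mem (x := ⁅y, ⁅x, y⁆⁆) (by simp [x, y]))
    (h1 ▸ one_mem _) (h2 ▸ one_mem _)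
    (PresentedGroup.one_of_mem (x := ⁅x, y⁆ ^ 2) (by simp [x, y]))

theorem essentialGroup_card_le (r : ℕ) : Finite (EssentialGroup r) ∧
    Nat.card (EssentialGroup r) ≤ 2 ^ r * 2 ^ r * 4 := by
  let x : FreeGroup (Fin 2) := .of 0
  let y : FreeGroup (Fin 2) := .of 1
  have h1 : (PresentedGroup.of 0 : EssentialGroup r) ^ 2 ^ r = 1 :=
    PresentedGroup.one_of_mem (x := x ^ 2 ^ r) (by simp [x])
  have h2 : (PresentedGroup.of 1 : EssentialGroup r) ^ 2 ^ r = 1 :=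
    PresentedGroup.one_of_mem (x := y ^ 2 ^ r) (by simp [y])
  exact card_le_of_central_commutator (by positivity) four_ne_zero PresentedGroup.closure_pair
    (PresentedGroup.one_of_mem (x := ⁅x, ⁅x, y⁆⁆) (by simp [x, y]))
    (PresentedGroup.one_of_mem (x := ⁅y, ⁅x, y⁆⁆) (by simp [x, y]))
    (h1 ▸ one_mem _) (h2 ▸ one_mem _)
    (PresentedGroup.one_of_mem (x := ⁅x, y⁆ ^ 4) (by simp [x, y]))

theorem essentialGroupTwo_card_le : Finite EssentialGroupTwo ∧
    Nat.card EssentialGroupTwo ≤ 4 * 4 * 4 := by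
  let x : FreeGroup (Fin 2) := .of 0
  let y : FreeGroup (Fin 2) := .of 1
  have h1 : (PresentedGroup.of 0 : EssentialGroupTwo) ^ 4 = PresentedGroup.of 1 ^ 4 :=
    PresentedGroup.mk_eq_mk_of_mul_inv_mem (x := x ^ 4) (y := y ^ 4) (by simp [x, y])
  have h2 : (PresentedGroup.of 1 : EssentialGroupTwo) ^ 4 =
      ⁅(PresentedGroup.of 0 : EssentialGroupTwo), (PresentedGroup.of 1 : EssentialGroupTwo)⁆ ^ 2 :=
    PresentedGroup.mk_eq_mk_of_mul_inv_mem (x := y ^ 4) (y := ⁅x, y⁆ ^ 2) (by simp [x, y])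
  have h3 : (PresentedGroup.of 0 : EssentialGroupTwo) ^ 8 = 1 :=
    PresentedGroup.one_of_mem (x := x ^ 8) (by simp [x])
  refine card_le_of_central_commutator four_ne_zero four_ne_zero PresentedGroup.closure_pair
    (PresentedGroup.one_of_mem (x := ⁅x, ⁅x, y⁆⁆) (by simp [x, y]))
    (PresentedGroup.one_of_mem (x := ⁅y, ⁅x, y⁆⁆) (by simp [x, y])) ?_ ?_ ?_
  · rw [h1, h2]
    exact pow_mem (Subgroup.mem_zpowers _) _
  · rw [h2]
    exact pow_mem (Subgroup.mem_zpowers _) _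
  · have h4 := congrArg (· ^ 2) (h1.trans h2)
    simp only [← pow_mul] at h4
    exact h4.symm.trans h3

theorem normalizerQuotientGroup_card_le (r k : ℕ) : Finite (NormalizerQuotientGroup r k) ∧
    Nat.card (NormalizerQuotientGroup r k) ≤ 2 ^ (2 * (r + 1)) := by
  let x : FreeGroup (Fin 3) := .of 0
  let y : FreeGroup (Fin 3) := .of 1
  let a : FreeGroup (Fin 3) := .of 2
  rw [show 2 ^ (2 * (r + 1)) = 2 * (2 ^ r * 2 ^ r * 2) by ring]
  refine card_le_of_swapped_generators (x := PresentedGroup.of 0) (y := PresentedGroup.of 1)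
    (a := PresentedGroup.of 2) (k := k) (by positivity) two_ne_zero ?_
    (PresentedGroup.one_of_mem (x := ⁅x, ⁅x, y⁆⁆) (by simp [x, y]))
    (PresentedGroup.one_of_mem (x := ⁅y, ⁅x, y⁆⁆) (by simp [x, y]))
    (PresentedGroup.one_of_mem (x := x ^ 2 ^ r) (by simp [x]))
    (PresentedGroup.one_of_mem (x := ⁅x, y⁆ ^ 2) (by simp [x, y]))
    (PresentedGroup.mk_eq_mk_of_mul_inv_mem (x := a ^ 2) (y := ⁅x, y⁆ ^ k) (by simp [x, y, a]))
    (PresentedGroup.mk_eq_mk_of_mul_inv_mem (x := a * x * (a)⁻¹) (y := y) (by simp [x, y, a]))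
  rw [← PresentedGroup.closure_range_of]
  congr 1
  ext g
  simp [Fin.exists_fin_succ, eq_comm]

/-! ### A model of the quotient of the normalizer -/

/-- The extension of the group of triples `(i, j, l)`, standing for `x ^ i * y ^ j * z ^ l` with
`x ^ 2 ^ (r + 1) = y ^ 2 ^ (r + 1) = 1` and `z = [x, y]` central of order two, by an element `a` with
`a ^ 2 = z ^ k` that swaps `x` and `y`. The Boolean records whether a factor `a` follows. -/
structure SwapModel (r k : ℕ) where
  /-- The exponent of `x`. -/
  i : ZMod (2 ^ (r + 1))
  /-- The exponent of `y`. -/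
  j : ZMod (2 ^ (r + 1))
  /-- The exponent of `z`. -/
  l : ZMod 2
  /-- Whether the factor `a` occurs. -/
  e : Bool

namespace SwapModel

variable {r k : ℕ}

/-- Reduction of exponents modulo two. -/
def red (r : ℕ) : ZMod (2 ^ (r + 1)) →+* ZMod 2 :=
  ZMod.castHom (dvd_pow_self 2 r.succ_ne_zero) (ZMod 2)

/-- The product is determined by `y * x = z * (x * y)`, since `z` is its own inverse, and by
`a * (x ^ i * y ^ j) = y ^ i * x ^ j * a`. -/
instance : Mul (SwapModel r k) where
  mul
    | ⟨i, j, l, false⟩, ⟨i', j', l', e'⟩ => ⟨i + i', j + j', l + l' + red r j * red r i', e'⟩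
    | ⟨i, j, l, true⟩, ⟨i', j', l', false⟩ =>
      ⟨i + j', j + i', l + l' + red r i' * red r j' + red r j * red r j', true⟩
    | ⟨i, j, l, true⟩, ⟨i', j', l', true⟩ =>
      ⟨i + j', j + i', l + l' + red r i' * red r j' + red r j * red r j' + k, false⟩

theorem mul_false (i j i' j' : ZMod (2 ^ (r + 1))) (l l' : ZMod 2) (e' : Bool) :
    (⟨i, j, l, false⟩ * ⟨i', j', l', e'⟩ : SwapModel r k) =
      ⟨i + i', j + j', l + l' + red r j * red r i', e'⟩ := rfl

theorem true_mul_false (i j i' j' : ZMod (2 ^ (r + 1))) (l l' : ZMod 2) :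
    (⟨i, j, l, true⟩ * ⟨i', j', l', false⟩ : SwapModel r k) =
      ⟨i + j', j + i', l + l' + red r i' * red r j' + red r j * red r j', true⟩ := rfl

theorem true_mul_true (i j i' j' : ZMod (2 ^ (r + 1))) (l l' : ZMod 2) :
    (⟨i, j, l, true⟩ * ⟨i', j', l', true⟩ : SwapModel r k) =
      ⟨i + j', j + i', l + l' + red r i' * red r j' + red r j * red r j' + k, false⟩ := rfl

instance : One (SwapModel r k) where
  one := ⟨0, 0, 0, false⟩

theorem one_def : (1 : SwapModel r k) = ⟨0, 0, 0, false⟩ := rfl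

instance : Inv (SwapModel r k) where
  inv
    | ⟨i, j, l, false⟩ => ⟨-i, -j, l + red r i * red r j, false⟩
    | ⟨i, j, l, true⟩ => ⟨-j, -i, l + k, true⟩

theorem inv_false (i j : ZMod (2 ^ (r + 1))) (l : ZMod 2) :
    (⟨i, j, l, false⟩⁻¹ : SwapModel r k) = ⟨-i, -j, l + red r i * red r j, false⟩ := rfl

theorem inv_true (i j : ZMod (2 ^ (r + 1))) (l : ZMod 2) :
    (⟨i, j, l, true⟩⁻¹ : SwapModel r k) = ⟨-j, -i, l + k, true⟩ := rfl

instance : Group (SwapModel r k) :=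
  Group.ofLeftAxioms
    (by
      rintro ⟨i, j, l, _ | _⟩ ⟨i', j', l', _ | _⟩ ⟨i'', j'', l'', _ | _⟩ <;>
        simp only [mul_false, true_mul_false, true_mul_true, map_add, SwapModel.mk.injEq,
          and_true] <;> refine ⟨by ring, by ring, ?_⟩ <;> ring_nf <;> reduce_mod_char)
    (by
      rintro ⟨i, j, l, _ | _⟩ <;> simp [one_def, mul_false])
    (by
      rintro ⟨i, j, l, _ | _⟩ <;>
        simp only [inv_false, inv_true, one_def, mul_false, true_mul_true, map_neg,
          SwapModel.mk.injEq, and_true] <;> refine ⟨by ring, by ring, ?_⟩ <;> ring_nf <;> reduce_mod_char)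

theorem card : Nat.card (SwapModel r k) = 2 ^ (2 * (r + 1 + 1)) := by
  have e : SwapModel r k ≃ (ZMod (2 ^ (r + 1)) × ZMod (2 ^ (r + 1))) × ZMod 2 × Bool :=
    ⟨fun p => ((p.i, p.j), p.l, p.e), fun p => ⟨p.1.1, p.1.2, p.2.1, p.2.2⟩, fun _ => rfl,
      fun _ => rfl⟩
  rw [Nat.card_congr e]
  simp only [Nat.card_prod, Nat.card_zmod, Nat.card_eq_fintype_card (α := Bool), Fintype.card_bool]
  ring

theorem x_pow (n : ℕ) : (⟨1, 0, 0, false⟩ ^ n : SwapModel r k) = ⟨n, 0, 0, false⟩ := by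
  induction n with
  | zero => simp [one_def]
  | succ n ih => rw [pow_succ, ih, mul_false]; simp

theorem y_pow (n : ℕ) : (⟨0, 1, 0, false⟩ ^ n : SwapModel r k) = ⟨0, n, 0, false⟩ := by
  induction n with
  | zero => simp [one_def]
  | succ n ih => rw [pow_succ, ih, mul_false]; simp

theorem z_pow (n : ℕ) : (⟨0, 0, 1, false⟩ ^ n : SwapModel r k) = ⟨0, 0, n, false⟩ := by
  induction n with
  | zero => simp [one_def]
  | succ n ih => rw [pow_succ, ih, mul_false]; simp

theorem commutator_x_y : ⁅(⟨1, 0, 0, false⟩ : SwapModel r k), (⟨0, 1, 0, false⟩ : SwapModel r k)⁆ =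
    ⟨0, 0, 1, false⟩ := by
  simp [commutatorElement_def, mul_false, inv_false]

/-- The elements `x`, `y` and `a` of the model satisfy the defining relations of the presented
group. -/
theorem relations : ∀ w ∈ (
    let x : FreeGroup (Fin 3) := .of 0
    let y : FreeGroup (Fin 3) := .of 1
    let a : FreeGroup (Fin 3) := .of 2
    {x ^ 2 ^ (r + 1), ⁅x, y⁆ ^ 2, ⁅x, ⁅x, y⁆⁆, ⁅y, ⁅x, y⁆⁆, a ^ 2 * (⁅x, y⁆ ^ k)⁻¹,
      a * x * a⁻¹ * y⁻¹} : Set (FreeGroup (Fin 3))),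
    FreeGroup.lift (![⟨1, 0, 0, false⟩, ⟨0, 1, 0, false⟩, ⟨0, 0, 0, true⟩] :
      Fin 3 → SwapModel r k) w =
      1 := by
  have h2 : ((2 : ℕ) : ZMod 2) = 0 := rfl
  rintro w (rfl | rfl | rfl | rfl | rfl | rfl)
  · simp only [map_pow, FreeGroup.lift_apply_of, Matrix.cons_val_zero, x_pow, one_def]
    simp
  · simp only [map_pow, map_commutatorElement, FreeGroup.lift_apply_of, Matrix.cons_val_zero,
      Matrix.cons_val_one, commutator_x_y, z_pow, h2, one_def]
  · simp only [map_commutatorElement, FreeGroup.lift_apply_of, Matrix.cons_val_zero,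
      Matrix.cons_val_one, commutator_x_y]
    simp [commutatorElement_def, mul_false, inv_false, one_def]
    rfl
  · simp only [map_commutatorElement, FreeGroup.lift_apply_of, Matrix.cons_val_zero,
      Matrix.cons_val_one, commutator_x_y]
    simp [commutatorElement_def, mul_false, inv_false, one_def]
    rfl
  · simp only [map_mul, map_pow, map_inv, map_commutatorElement, FreeGroup.lift_apply_of,
      Matrix.cons_val_zero, Matrix.cons_val_one, Matrix.cons_val, commutator_x_y, z_pow]
    rw [mul_inv_eq_one, sq, true_mul_true]
    simp
  · simp only [map_mul, map_inv, FreeGroup.lift_apply_of,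
      Matrix.cons_val_zero, Matrix.cons_val_one, Matrix.cons_val]
    rw [mul_inv_eq_one, mul_inv_eq_iff_eq_mul, true_mul_false, mul_false]
    simp

/-- The homomorphism from the presented group to its model. -/
def ofPresented (r k : ℕ) : NormalizerQuotientGroup (r + 1) k →* SwapModel r k :=
  PresentedGroup.toGroup relations

theorem ofPresented_surjective : Function.Surjective (ofPresented r k) := by
  have h0 : (⟨1, 0, 0, false⟩ : SwapModel r k) ∈ (ofPresented r k).range :=
    ⟨.of 0, PresentedGroup.toGroup.of relations⟩
  have h1 : (⟨0, 1, 0, false⟩ : SwapModel r k) ∈ (ofPresented r k).range :=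
    ⟨.of 1, PresentedGroup.toGroup.of relations⟩
  have h2 : (⟨0, 0, 0, true⟩ : SwapModel r k) ∈ (ofPresented r k).range :=
    ⟨.of 2, PresentedGroup.toGroup.of relations⟩
  have h3 : (⟨0, 0, 1, false⟩ : SwapModel r k) ∈ (ofPresented r k).range := by
    have h := mul_mem (mul_mem (mul_mem h0 h1) (inv_mem h0)) (inv_mem h1)
    rw [← commutator_x_y]
    exact h
  have key : ∀ i j l, (⟨i, j, l, false⟩ : SwapModel r k) ∈ (ofPresented r k).range := by
    intro i j l
    have := mul_mem (mul_mem (pow_mem h0 i.val) (pow_mem h1 j.val)) (pow_mem h3 l.val)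
    rw [x_pow, y_pow, z_pow] at this
    simpa [mul_false] using this
  rintro ⟨i, j, l, _ | _⟩
  · exact key i j l
  · have := mul_mem (key i j l) h2
    rw [mul_false] at this
    simpa using this

/-- The presented group has at most as many elements as its image, the model. -/
theorem ofPresented_bijective : Function.Bijective (ofPresented r k) := by
  have h := normalizerQuotientGroup_card_le (r + 1) k
  have := h.1
  refine (Nat.bijective_iff_surjective_and_card _).mpr ⟨ofPresented_surjective, ?_⟩
  refine le_antisymm (h.2.trans_eq card.symm)
    (Nat.card_le_card_of_surjective _ ofPresented_surjective)

/-- The involutions of the cyclic group `ℤ/2^(r+1)` are even if `r ≠ 0`. -/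
theorem red_eq_zero_of_add_self {r : ℕ} (hr : r ≠ 0) {i : ZMod (2 ^ (r + 1))} (h : i + i = 0) :
    red r i = 0 := by
  obtain ⟨n, rfl⟩ := ZMod.natCast_zmod_surjective i
  rw [← Nat.cast_add, ZMod.natCast_eq_zero_iff, pow_succ, ← mul_two] at h
  rw [map_natCast, ZMod.natCast_eq_zero_iff]
  exact (dvd_pow_self 2 hr).trans (Nat.dvd_of_mul_dvd_mul_right two_pos h)

/-- If `a ^ 2 = z`, every element `ua` with `u ∈ ⟨x, y⟩` squares to a nontrivial element. -/
theorem e_eq_false_of_sq_eq_one {p : SwapModel r 1} (hp : p ^ 2 = 1) : p.e = false := by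
  obtain ⟨i, j, l, _ | _⟩ := p
  · rfl
  · exfalso
    rw [sq, true_mul_true, one_def, SwapModel.mk.injEq] at hp
    obtain ⟨h1, -, h3, -⟩ := hp
    have h4 : red r i = - red r j := by
      rw [← map_neg, eq_neg_of_add_eq_zero_left h1]
    rw [h4] at h3
    ring_nf at h3
    reduce_mod_char at h3
    simp at h3

/-- For `k = 1` the involutions commute with each other, while for `k = 0` the involution `a` does
not commute with the involution `x ^ 2 ^ r`. -/
theorem isEmpty_mulEquiv (hr : r ≠ 0) : IsEmpty (SwapModel r 0 ≃* SwapModel r 1) := by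
  refine ⟨fun f => ?_⟩
  have hcomm : ∀ p q : SwapModel r 1, p ^ 2 = 1 → q ^ 2 = 1 → p * q = q * p := by
    intro p q hp hq
    have hpe := e_eq_false_of_sq_eq_one hp
    have hqe := e_eq_false_of_sq_eq_one hq
    obtain ⟨i, j, l, _ | _⟩ := p <;> obtain ⟨i', j', l', _ | _⟩ := q <;> cases hpe <;> cases hqe
    rw [sq, mul_false, one_def, SwapModel.mk.injEq] at hp hq
    rw [mul_false, mul_false, red_eq_zero_of_add_self hr hp.1, red_eq_zero_of_add_self hr hq.1,
      mul_zero, mul_zero, add_comm i, add_comm j, add_comm l]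
  have h2 : ((2 : ℕ) ^ r : ZMod (2 ^ (r + 1))) + (2 : ℕ) ^ r = 0 := by
    rw [← two_mul]
    exact_mod_cast (by rw [← pow_succ', ZMod.natCast_self] :
      ((2 * 2 ^ r : ℕ) : ZMod (2 ^ (r + 1))) = 0)
  let t : SwapModel r 0 := ⟨0, 0, 0, true⟩
  let u : SwapModel r 0 := ⟨(2 : ℕ) ^ r, 0, 0, false⟩
  have ht : t ^ 2 = 1 := by
    rw [sq, true_mul_true, one_def]
    simp
  have hu : u ^ 2 = 1 := by
    rw [sq, mul_false, one_def, h2]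
    simp
  have htu : t * u = u * t := by
    apply f.injective
    rw [map_mul, map_mul]
    exact hcomm _ _ (by rw [← map_pow, ht, map_one]) (by rw [← map_pow, hu, map_one])
  rw [true_mul_false, mul_false, SwapModel.mk.injEq] at htu
  have h0 : (((2 ^ r : ℕ) : ℕ) : ZMod (2 ^ (r + 1))) = 0 := by
    have := htu.1
    simp only [add_zero] at this
    exact_mod_cast this.symm
  rw [ZMod.natCast_eq_zero_iff] at h0
  have h1 := Nat.le_of_dvd (by positivity) h0
  rw [pow_succ] at h1
  have := Nat.two_pow_pos r
  omega

end SwapModel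

theorem normalizerQuotientGroup_card {r : ℕ} (hr : r ≠ 0) (k : ℕ) :
    Nat.card (NormalizerQuotientGroup r k) = 2 ^ (2 * (r + 1)) := by
  obtain ⟨r, rfl⟩ := Nat.exists_eq_succ_of_ne_zero hr
  rw [Nat.card_congr (Equiv.ofBijective _ SwapModel.ofPresented_bijective), SwapModel.card]

theorem normalizerQuotientGroup_isEmpty_mulEquiv {r : ℕ} (hr : 2 ≤ r) :
    IsEmpty (NormalizerQuotientGroup r 0 ≃* NormalizerQuotientGroup r 1) := by
  obtain ⟨r, rfl⟩ := Nat.exists_eq_succ_of_ne_zero (by omega : r ≠ 0)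
  refine ⟨fun f => (SwapModel.isEmpty_mulEquiv (by omega : r ≠ 0)).false ?_⟩
  exact ((MulEquiv.ofBijective _ SwapModel.ofPresented_bijective).symm.trans f).trans
    (MulEquiv.ofBijective _ SwapModel.ofPresented_bijective)

/-! ### The abelianization of a rank-two group with a fixed-point-free automorphism -/

theorem IsPGroup.zpow_mul_zpow_mem_frattini_iff {G : Type*} [Group G] [Finite G]
    (hG : IsPGroup 2 G) {x y : G} (hx : x ∉ frattini G)
    (hy : y ∉ frattini G) (hxy : x⁻¹ * y ∉ frattini G) (i j : ℤ) :
    x ^ i * y ^ j ∈ frattini G ↔ Even i ∧ Even j := by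
  have hsq : ∀ (u : G) (k : ℤ), u ^ (2 * k) ∈ frattini G := fun u k => by
    rw [zpow_mul]
    exact zpow_mem (by exact_mod_cast hG.sq_mem_frattini u) _
  have hodd : ∀ (u : G) (k : ℤ), ∃ v ∈ frattini G, u ^ (2 * k + 1) = v * u := fun u k =>
    ⟨_, hsq u k, zpow_add_one _ _⟩
  have hxy' : x * y ∉ frattini G := fun h => hxy (by
    have := mul_mem (hsq x (-1)) h
    rwa [show x ^ (2 * (-1 : ℤ)) * (x * y) = x⁻¹ * y by group] at this)
  rcases Int.even_or_odd' i with ⟨k, rfl | rfl⟩ <;> rcases Int.even_or_odd' j with ⟨l, rfl | rfl⟩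
  · simpa using mul_mem (hsq x k) (hsq y l)
  · obtain ⟨v, hv, h⟩ := hodd y l
    rw [h, Subgroup.mul_mem_cancel_left _ (hsq x k), Subgroup.mul_mem_cancel_left _ hv]
    simp [hy]
  · obtain ⟨v, hv, h⟩ := hodd x k
    rw [h, Subgroup.mul_mem_cancel_right _ (hsq y l), Subgroup.mul_mem_cancel_left _ hv]
    simp [hx]
  · obtain ⟨v, hv, h⟩ := hodd x k
    rw [h, zpow_add_one, (inferInstance : (frattini G).Normal).mem_comm_iff, mul_assoc,
      Subgroup.mul_mem_cancel_left _ (hsq y l), (inferInstance : (frattini G).Normal).mem_comm_iff,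
      mul_assoc, Subgroup.mul_mem_cancel_left _ hv]
    simp [hxy']

/-- All elements outside the Frattini subgroup have the same order `2 ^ r` modulo the commutator
subgroup. -/
theorem FixesNoFrattiniCoset.exists_pow_mem_commutator_iff {G : Type*} [Group G] [Finite G]
    {α : MulAut G} (hα : FixesNoFrattiniCoset α) (hG : IsPGroup 2 G)
    (hΦ : (frattini G).index = 2 ^ 2) :
    ∃ r, 1 ≤ r ∧ ∀ w ∉ frattini G, ∀ n : ℕ, w ^ n ∈ commutator G ↔ 2 ^ r ∣ n := by
  obtain ⟨x, hx⟩ := exists_notMem_frattini hΦ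
  have hab : IsPGroup 2 (Abelianization G) :=
    hG.of_surjective (QuotientGroup.mk' _) (QuotientGroup.mk'_surjective _)
  obtain ⟨r, hr⟩ := IsPGroup.iff_orderOf.mp hab (Abelianization.of x)
  have hxn : ∀ n : ℕ, x ^ n ∈ commutator G ↔ 2 ^ r ∣ n := fun n => by
    rw [← hr, orderOf_dvd_iff_pow_eq_one, ← map_pow, ← MonoidHom.mem_ker, Abelianization.ker_of]
  refine ⟨r, ?_, fun w hw n => ?_⟩
  · by_contra! h0
    obtain rfl : r = 0 := by omega
    exact hx (hG.commutator_le_frattini (by simpa using (hxn 1).mpr (by simp)))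
  · rw [← hxn]
    exact ⟨fun h => hα.pow_mem_commutator hG hΦ hw h x,
      fun h => hα.pow_mem_commutator hG hΦ hx h w⟩

/-- If `2 ^ s` with `s < r` were the exact power of two dividing both exponents, `x ^ i * y ^ j`
would be the `2 ^ s`-th power of an element outside the Frattini subgroup, and hence nontrivial
modulo `G'`. -/
theorem IsPGroup.zpow_mul_zpow_mem_commutator_iff {G : Type*} [Group G] [Finite G]
    (hG : IsPGroup 2 G) {r : ℕ}
    (hr : ∀ w ∉ frattini G, ∀ n : ℕ, w ^ n ∈ commutator G ↔ 2 ^ r ∣ n)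
    {x y : G} (hx : x ∉ frattini G)
    (hy : y ∉ frattini G) (hxy : x⁻¹ * y ∉ frattini G) (i j : ℤ) :
    x ^ i * y ^ j ∈ commutator G ↔ (2 ^ r : ℤ) ∣ i ∧ (2 ^ r : ℤ) ∣ j := by
  have hof : ∀ u : G, u ∈ commutator G ↔ Abelianization.of u = 1 := fun u => by
    rw [← MonoidHom.mem_ker, Abelianization.ker_of]
  constructor
  · intro h
    have key : ∀ s ≤ r, (2 ^ s : ℤ) ∣ i ∧ (2 ^ s : ℤ) ∣ j := by
      intro s
      induction s with
      | zero => simp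
      | succ s ih =>
        intro hs
        obtain ⟨⟨i', rfl⟩, j', rfl⟩ := ih (by omega)
        have hw : (x ^ i' * y ^ j') ^ 2 ^ s ∈ commutator G := by
          rw [hof, map_mul, map_zpow, map_zpow] at h
          rw [hof, map_pow, map_mul, map_zpow, map_zpow, mul_pow, ← h, ← zpow_natCast,
            ← zpow_natCast, ← zpow_mul, ← zpow_mul]
          push_cast
          rw [mul_comm i', mul_comm j']
        have hΦ : x ^ i' * y ^ j' ∈ frattini G := by
          by_contra hnot
          have := (Nat.pow_dvd_pow_iff_le_right' (b := 0)).mp ((hr _ hnot _).mp hw)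
          omega
        obtain ⟨h1, h2⟩ := (hG.zpow_mul_zpow_mem_frattini_iff hx hy hxy _ _).mp hΦ
        rw [pow_succ]
        exact ⟨mul_dvd_mul_left _ h1.two_dvd, mul_dvd_mul_left _ h2.two_dvd⟩
    exact key r le_rfl
  · rintro ⟨⟨i', rfl⟩, j', rfl⟩
    have h : ∀ u ∉ frattini G, ∀ k : ℤ, u ^ (2 ^ r * k) ∈ commutator G := fun u hu k => by
      rw [zpow_mul]
      exact zpow_mem (by exact_mod_cast (hr u hu _).mpr dvd_rfl) _
    exact mul_mem (h x hx _) (h y hy _)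

theorem exists_zpow_mul_zpow_of_closure_eq_top {G : Type*} [Group G] {x y : G}
    (hS : Subgroup.closure {x, y} = ⊤) (g : G) :
    ∃ i j : ℤ, ∃ d ∈ commutator G, g = x ^ i * y ^ j * d := by
  have hg : Abelianization.of g ∈ Subgroup.closure {Abelianization.of x, Abelianization.of y} := by
    have := Subgroup.mem_map_of_mem Abelianization.of (hS ▸ Subgroup.mem_top g :
      g ∈ Subgroup.closure {x, y})
    rwa [MonoidHom.map_closure, Set.image_pair] at this
  obtain ⟨i, j, h⟩ := Subgroup.mem_closure_pair.mp hg
  refine ⟨i, j, (x ^ i * y ^ j)⁻¹ * g, ?_, by group⟩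
  rw [← Abelianization.ker_of, MonoidHom.mem_ker, map_mul, map_inv, map_mul, map_zpow, map_zpow, h,
    inv_mul_cancel]

theorem IsPGroup.nonempty_abelianization_equiv {G : Type*} [Group G] [Finite G]
    (hG : IsPGroup 2 G) (hΦ : (frattini G).index = 2 ^ 2) {r : ℕ}
    (hr : ∀ w ∉ frattini G, ∀ n : ℕ, w ^ n ∈ commutator G ↔ 2 ^ r ∣ n)
    {x y : G} (hx : x ∉ frattini G)
    (hy : y ∉ frattini G) (hxy : x⁻¹ * y ∉ frattini G) :
    Nonempty (Abelianization G ≃* Cyc (2 ^ r) × Cyc (2 ^ r)) := by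
  have hof : ∀ u : G, u ∈ commutator G ↔ Abelianization.of u = 1 := fun u => by
    rw [← MonoidHom.mem_ker, Abelianization.ker_of]
  have hx' : Abelianization.of x ^ 2 ^ r = 1 := by
    rw [← map_pow, ← hof]
    exact (hr x hx _).mpr dvd_rfl
  have hy' : Abelianization.of y ^ 2 ^ r = 1 := by
    rw [← map_pow, ← hof]
    exact (hr y hy _).mpr dvd_rfl
  let f : Cyc (2 ^ r) × Cyc (2 ^ r) →* Abelianization G :=
    (cycHom _ _ hx').coprod (cycHom _ _ hy')
  have hf : ∀ i j : ℤ, f (.ofAdd (i : ZMod (2 ^ r)), .ofAdd (j : ZMod (2 ^ r))) =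
      Abelianization.of (x ^ i * y ^ j) := fun i j => by
    simp [f, MonoidHom.coprod_apply, cycHom_intCast]
  refine ⟨(MulEquiv.ofBijective f ⟨?_, ?_⟩).symm⟩
  · rw [injective_iff_map_eq_one]
    rintro ⟨u, v⟩ h
    obtain ⟨i, hi⟩ := ZMod.intCast_surjective u.toAdd
    obtain ⟨j, hj⟩ := ZMod.intCast_surjective v.toAdd
    obtain rfl : .ofAdd (i : ZMod (2 ^ r)) = u := by rw [hi]; rfl
    obtain rfl : .ofAdd (j : ZMod (2 ^ r)) = v := by rw [hj]; rfl
    rw [hf, ← hof, hG.zpow_mul_zpow_mem_commutator_iff hr hx hy hxy] at h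
    have h1 := (ZMod.intCast_zmod_eq_zero_iff_dvd i (2 ^ r)).mpr (by exact_mod_cast h.1)
    have h2 := (ZMod.intCast_zmod_eq_zero_iff_dvd j (2 ^ r)).mpr (by exact_mod_cast h.2)
    rw [h1, h2]
    rfl
  · intro u
    obtain ⟨g, rfl⟩ : ∃ g, Abelianization.of g = u := QuotientGroup.mk'_surjective _ u
    obtain ⟨i, j, d, hd, rfl⟩ :=
      exists_zpow_mul_zpow_of_closure_eq_top (hG.closure_pair_eq_top hΦ hx hy hxy) g
    refine ⟨_, (hf i j).trans ?_⟩
    rw [map_mul _ _ d, (hof d).mp hd, mul_one]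

/-! ### Recognizing the wreath product -/

/-- The element `w` of the wreath product is sent to `x ^ i * (a * x * a⁻¹) ^ j * a ^ e`, where `i` and
`j` are the two components of `w.left` and `e` is `w.right`. -/
theorem nonempty_wreathProduct_equiv {G : Type*} [Group G] {x a : G} {m : ℕ} [NeZero m]
    (hS : Subgroup.closure {x, a} = ⊤) (hx : x ^ m = 1) (ha : a ^ 2 = 1)
    (hcomm : Commute x (a * x * a⁻¹)) (hcard : Nat.card G = m * m * 2) :
    Nonempty (G ≃* Cyc m ≀ᵣ Cyc 2) := by
  have hy : (a * x * a⁻¹) ^ m = 1 := by rw [conj_pow, hx]; group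
  set y := a * x * a⁻¹ with hydef
  have ha' : a⁻¹ = a := inv_eq_of_mul_eq_one_left (by rw [← sq, ha])
  let X := cycHom m x hx
  let Y := cycHom m y hy
  let A := cycHom 2 a ha
  have hX : ∀ u, ∃ i : ℤ, X u = x ^ i ∧ Y u = y ^ i := fun u => by
    obtain ⟨i, hi⟩ := ZMod.intCast_surjective u.toAdd
    obtain rfl : .ofAdd (i : ZMod m) = u := by rw [hi]; rfl
    exact ⟨i, cycHom_intCast _ _ _ _, cycHom_intCast _ _ _ _⟩
  have hXY : ∀ u v, X u * Y v = Y v * X u := fun u v => by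
    obtain ⟨i, hi, -⟩ := hX u
    obtain ⟨j, -, hj⟩ := hX v
    rw [hi, hj]
    exact hcomm.zpow_zpow i j
  have haX : ∀ u, a * X u = Y u * a := fun u => by
    obtain ⟨i, hi, hj⟩ := hX u
    rw [hi, hj, hydef, conj_zpow]
    group
  have haY : ∀ u, a * Y u = X u * a := fun u => by
    have := haX u
    calc a * Y u = a * (Y u * a) * a⁻¹ := by group
      _ = a ^ 2 * X u * a⁻¹ := by rw [← this, sq]; group
      _ = _ := by rw [ha, ha', one_mul]
  let s : Cyc 2 := .ofAdd 1
  have hA : A s = a := by simpa [A, s] using cycHom_intCast 2 a ha 1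
  have hs2 : ∀ t : Cyc 2, t = 1 ∨ t = s := by decide
  have hss : s * s = 1 := by decide
  have hsi : s⁻¹ = s := by decide
  let f : Cyc m ≀ᵣ Cyc 2 →* G :=
    { toFun := fun w => X (w.left 1) * Y (w.left s) * A w.right
      map_one' := by simp [RegularWreathProduct.one_left, RegularWreathProduct.one_right]
      map_mul' := by
        rintro ⟨u, t⟩ ⟨u', t'⟩
        simp only [RegularWreathProduct.mul_def, Pi.mul_apply, map_mul]
        rcases hs2 t with rfl | rfl
        · simp only [inv_one, one_mul, map_one, mul_one]
          simp only [mul_assoc]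
          rw [← mul_assoc (Y (u s)) (X (u' 1)), ← hXY]
          simp only [mul_assoc]
        · simp only [hsi, hss, mul_one, hA]
          calc _ = X (u 1) * (X (u' s) * Y (u s)) * Y (u' 1) * a * A t' := by simp only [mul_assoc]
            _ = X (u 1) * Y (u s) * (X (u' s) * Y (u' 1)) * a * A t' := by
              rw [hXY (u' s) (u s)]
              simp only [mul_assoc]
            _ = X (u 1) * Y (u s) * (Y (u' 1) * (X (u' s) * a)) * A t' := by
              rw [hXY (u' s) (u' 1)]
              simp only [mul_assoc]
            _ = X (u 1) * Y (u s) * (Y (u' 1) * a) * Y (u' s) * A t' := by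
              rw [← haY]
              simp only [mul_assoc]
            _ = _ := by
              rw [← haX]
              simp only [mul_assoc] }
  have hf1 : ∀ w, f w = X (w.left 1) * Y (w.left s) * A w.right := fun w => rfl
  refine nonempty_mulEquiv_of_surjective f (MonoidHom.surjective_of_closure f hS ?_)
    ⟨inferInstance, ?_⟩ hcard
  · rintro g (rfl | rfl)
    · refine ⟨⟨Function.update 1 1 (.ofAdd 1), 1⟩, ?_⟩
      rw [hf1]
      have h1 : s ≠ 1 := by decide
      have : X (.ofAdd 1) = g := by simpa [X] using cycHom_intCast m g hx 1
      simp [this, h1]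
    · exact ⟨⟨1, s⟩, by rw [hf1]; simp [hA]⟩
  · rw [RegularWreathProduct.card, Nat.card_congr Multiplicative.toAdd, Nat.card_zmod,
      Nat.card_congr Multiplicative.toAdd, Nat.card_zmod, sq]

/-! ### The normalizer of a subgroup of index two in its normalizer -/

theorem coe_mem_commutator_iff {P : Type*} [Group P] {Q : Subgroup P} {q : Q} :
    (q : P) ∈ (⁅Q, Q⁆ : Subgroup P) ↔ q ∈ commutator Q := by
  rw [← Subgroup.map_subtype_commutator]
  exact Subgroup.mem_map_iff_mem Q.subtype_injective

theorem commutator_self_subgroupOf {P : Type*} [Group P] (Q : Subgroup P) :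
    (⁅Q, Q⁆ : Subgroup P).subgroupOf Q = commutator Q := by
  ext q
  rw [Subgroup.mem_subgroupOf, coe_mem_commutator_iff]

/-- The element `a` of `N_P(Q) ∖ Q` conjugates `x` to `y`, where `x` and `y` are linearly independent
in `Q/Φ(Q)`, and its square lies in `[Q, Q]`. -/
structure SwapsGenerators {P : Type*} [Group P] (Q : Subgroup P) (x y : Q) (a : P) : Prop where
  left_notMem : x ∉ frattini Q
  right_notMem : y ∉ frattini Q
  inv_mul_notMem : x⁻¹ * y ∉ frattini Q
  mem_normalizer : a ∈ Subgroup.normalizer (Q : Set P)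
  notMem : a ∉ Q
  conj_eq : a * x * a⁻¹ = y
  sq_mem : a ^ 2 ∈ (⁅Q, Q⁆ : Subgroup P)

/-- `Subgroup.mul_mem_iff_of_index_two` for a subgroup of index two in a subgroup `N`. -/
theorem mem_of_relIndex_eq_two {P : Type*} [Group P] {Q N : Subgroup P} (h : Q.relIndex N = 2)
    {a b : P} (ha : a ∈ N) (hb : b ∈ N) : a * b ∈ Q ↔ (a ∈ Q ↔ b ∈ Q) :=
  Subgroup.mul_mem_iff_of_index_two (H := Q.subgroupOf N) h (a := ⟨a, ha⟩) (b := ⟨b, hb⟩)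

/-- Write `y` for the conjugate of `x` under `g`. Conjugation by `g` fixes `g² ≡ x^i y^j` and
interchanges `x` and `y` modulo `[Q, Q]`, so that `x^i ≡ x^j` and `y^i ≡ y^j`. Hence `x^{-i}g` has
its square in `[Q, Q]`. -/
theorem exists_swapsGenerators {P : Type*} [Group P] [Finite P] (hP : IsPGroup 2 P)
    {Q : Subgroup P} (hΦ : (frattini Q).index = 2 ^ 2)
    (hN : Q.relIndex (Subgroup.normalizer (Q : Set P)) = 2) {r : ℕ}
    (hr : ∀ w ∉ frattini Q, ∀ n : ℕ, w ^ n ∈ commutator Q ↔ 2 ^ r ∣ n)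
    {g : P} (hg : g ∈ Subgroup.normalizer (Q : Set P)) (hgQ : g ∉ Q) {x : Q}
    (hx : x⁻¹ * Q.normalizerMonoidHom ⟨g, hg⟩ x ∉ frattini Q) :
    ∃ (y : Q) (a : P), SwapsGenerators Q x y a := by
  have hQ := hP.to_subgroup Q
  set φ := Q.normalizerMonoidHom ⟨g, hg⟩ with hφ
  have hφc : ∀ u : Q, (φ u : P) = g * u * g⁻¹ := fun u => by simp [hφ]
  have hxΦ : x ∉ frattini Q := fun h => hx (mul_mem (inv_mem h)
    ((mulAut_mem_iff_of_characteristic _ φ x).mpr h))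
  have hyΦ : φ x ∉ frattini Q := mt (mulAut_mem_iff_of_characteristic _ φ x).mp hxΦ
  have hg2 : g ^ 2 ∈ Q := by
    rw [sq, mem_of_relIndex_eq_two hN hg hg]
  have hof : ∀ u : Q, u ∈ commutator Q ↔ Abelianization.of u = 1 := fun u => by
    rw [← MonoidHom.mem_ker, Abelianization.ker_of]
  obtain ⟨i, j, d, hd, hq⟩ :=
    exists_zpow_mul_zpow_of_closure_eq_top (hQ.closure_pair_eq_top hΦ hxΦ hyΦ hx) ⟨g ^ 2, hg2⟩
  have hφq : φ ⟨g ^ 2, hg2⟩ = ⟨g ^ 2, hg2⟩ := Subtype.ext (by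
    rw [hφc]
    change g * g ^ 2 * g⁻¹ = g ^ 2
    group)
  have hφφ : φ (φ x) = ⟨g ^ 2, hg2⟩ * x * ⟨g ^ 2, hg2⟩⁻¹ := Subtype.ext (by
    rw [hφc, hφc]
    simp only [Subgroup.coe_mul, Subgroup.coe_inv, sq]
    group)
  have hij : x ^ (i - j) * φ x ^ (j - i) ∈ commutator Q := by
    have h1 : Abelianization.of (φ (φ x)) = Abelianization.of x := by
      rw [hφφ]
      simp only [map_mul, map_inv, mul_inv_cancel_comm]
    have h2 := (hof _).mp ((mulAut_mem_iff_of_characteristic _ φ d).mpr hd)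
    have h := congrArg Abelianization.of hφq
    rw [hq] at h
    simp only [map_mul, map_zpow, h1, h2, (hof _).mp hd, mul_one] at h
    rw [hof, map_mul, map_zpow, map_zpow, zpow_sub, zpow_sub]
    calc _ = (Abelianization.of x ^ i * Abelianization.of (φ x) ^ j) *
          (Abelianization.of (φ x) ^ i * Abelianization.of x ^ j)⁻¹ := by
          rw [mul_inv, mul_mul_mul_comm, mul_comm (Abelianization.of (φ x) ^ i)⁻¹]
      _ = 1 := by rw [h, mul_inv_cancel]
  have hdvd := ((hQ.zpow_mul_zpow_mem_commutator_iff hr hxΦ hyΦ hx _ _).mp hij).2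
  obtain ⟨l, hl⟩ := hdvd
  have hyij : φ x ^ (j - i) ∈ commutator Q := by
    rw [hl, zpow_mul]
    exact zpow_mem (by exact_mod_cast (hr _ hyΦ _).mpr dvd_rfl) _
  have hxi : ((x ^ (-i) : Q) : P) ∈ Subgroup.normalizer (Q : Set P) :=
    Subgroup.le_normalizer (x ^ (-i)).2
  have hΦn : (frattini Q).Normal := inferInstance
  have hcoe : ∀ u : Q, ((x ^ (-i) : Q) : P) * g * u * (((x ^ (-i) : Q) : P) * g)⁻¹ =
      ((x ^ (-i) * φ u * x ^ i : Q) : P) := fun u => by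
    simp only [Subgroup.coe_mul, hφc, Subgroup.coe_zpow]
    group
  refine ⟨x ^ (-i) * φ x * x ^ i, ((x ^ (-i) : Q) : P) * g, hxΦ, ?_, ?_, mul_mem hxi hg, ?_,
    hcoe x, ?_⟩
  · rw [hΦn.mem_comm_iff, ← mul_assoc, ← zpow_add]
    simpa using hyΦ
  · rw [← mul_assoc, ← mul_assoc, hΦn.mem_comm_iff, ← mul_assoc, ← mul_assoc, ← zpow_neg_one,
      ← zpow_add, ← zpow_add]
    simpa using hx
  · rw [Subgroup.mul_mem_cancel_left _ (x ^ (-i)).2]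
    exact hgQ
  · have : (((x ^ (-i) : Q) : P) * g) ^ 2 = ((x ^ (-i) * φ (x ^ (-i)) * ⟨g ^ 2, hg2⟩ : Q) : P) := by
      simp only [Subgroup.coe_mul, hφc, sq]
      group
    rw [this, coe_mem_commutator_iff, hq, hof]
    rw [hof] at hd hyij
    simp only [map_mul, map_zpow, hd, mul_one] at hyij ⊢
    rw [← hyij, zpow_sub, zpow_neg, zpow_neg]
    rw [mul_comm (_⁻¹) (_⁻¹), mul_assoc, inv_mul_cancel_left, mul_comm]

namespace SwapsGenerators

variable {P : Type*} [Group P] {Q : Subgroup P} {x y : Q} {a : P}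

theorem closure_normalizer_eq_top [Finite P] (h : SwapsGenerators Q x y a) (hP : IsPGroup 2 P)
    (hΦ : (frattini Q).index = 2 ^ 2)
    (hN : Q.relIndex (Subgroup.normalizer (Q : Set P)) = 2) :
    Subgroup.closure {(⟨x, Subgroup.le_normalizer x.2⟩ : Subgroup.normalizer (Q : Set P)),
      ⟨a, h.mem_normalizer⟩} = ⊤ := by
  set K := Subgroup.closure {(⟨x, Subgroup.le_normalizer x.2⟩ : Subgroup.normalizer (Q : Set P)),
    ⟨a, h.mem_normalizer⟩} with hK
  have hxK : (⟨x, Subgroup.le_normalizer x.2⟩ : Subgroup.normalizer (Q : Set P)) ∈ K :=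
    Subgroup.subset_closure (by simp)
  have haK : (⟨a, h.mem_normalizer⟩ : Subgroup.normalizer (Q : Set P)) ∈ K :=
    Subgroup.subset_closure (by simp)
  have hyK : (⟨y, Subgroup.le_normalizer y.2⟩ : Subgroup.normalizer (Q : Set P)) ∈ K := by
    have := mul_mem (mul_mem haK hxK) (inv_mem haK)
    have e : (⟨y, Subgroup.le_normalizer y.2⟩ : Subgroup.normalizer (Q : Set P)) =
        ⟨a, h.mem_normalizer⟩ * ⟨x, Subgroup.le_normalizer x.2⟩ * ⟨a, h.mem_normalizer⟩⁻¹ :=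
      Subtype.ext h.conj_eq.symm
    rwa [e]
  have hQK : (⊤ : Subgroup Q) ≤ K.comap (Subgroup.inclusion Subgroup.le_normalizer) := by
    rw [← (hP.to_subgroup Q).closure_pair_eq_top hΦ h.left_notMem h.right_notMem h.inv_mul_notMem,
      Subgroup.closure_le]
    rintro _ (rfl | rfl)
    · exact hxK
    · exact hyK
  rw [eq_top_iff]
  rintro ⟨u, hu⟩ -
  by_cases huQ : u ∈ Q
  · exact hQK (Subgroup.mem_top ⟨u, huQ⟩)
  · have hau : a⁻¹ * u ∈ Q := by
      rw [mem_of_relIndex_eq_two hN (inv_mem h.mem_normalizer) hu, inv_mem_iff]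
      exact iff_of_false h.notMem huQ
    have := mul_mem haK (hQK (Subgroup.mem_top ⟨a⁻¹ * u, hau⟩))
    convert this using 1
    exact Subtype.ext (mul_inv_cancel_left a u).symm

theorem closure_quotient_eq_top [Finite P] (h : SwapsGenerators Q x y a) (hP : IsPGroup 2 P)
    (hΦ : (frattini Q).index = 2 ^ 2)
    (hN : Q.relIndex (Subgroup.normalizer (Q : Set P)) = 2)
    (K : Subgroup (Subgroup.normalizer (Q : Set P))) [K.Normal] :
    Subgroup.closure {QuotientGroup.mk' K ⟨x, Subgroup.le_normalizer x.2⟩,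
      QuotientGroup.mk' K ⟨a, h.mem_normalizer⟩} = ⊤ := by
  rw [← Set.image_pair, ← MonoidHom.map_closure, h.closure_normalizer_eq_top hP hΦ hN,
    Subgroup.map_top_of_surjective _ (QuotientGroup.mk'_surjective K)]

end SwapsGenerators

theorem card_normalizer_quotient {P : Type*} [Group P] {Q : Subgroup P} {K : Subgroup P}
    (hK : K ≤ Q) (hN : Q.relIndex (Subgroup.normalizer (Q : Set P)) = 2) :
    Nat.card (Subgroup.normalizer (Q : Set P) ⧸ K.subgroupOf (Subgroup.normalizer (Q : Set P))) =
      (K.subgroupOf Q).index * 2 := by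
  rw [← hN]
  exact (Subgroup.relIndex_mul_relIndex K Q _ hK Subgroup.le_normalizer).symm

/-- Modulo `[Q, Q]` the elements `x` and `y` commute and `a` is an involution interchanging them. -/
theorem SwapsGenerators.nonempty_normalizer_quotient_equiv {P : Type*} [Group P] [Finite P]
    {Q : Subgroup P} {x y : Q} {a : P} (h : SwapsGenerators Q x y a) (hP : IsPGroup 2 P)
    (hΦ : (frattini Q).index = 2 ^ 2)
    (hN : Q.relIndex (Subgroup.normalizer (Q : Set P)) = 2) {r : ℕ}
    (hr : ∀ w ∉ frattini Q, ∀ n : ℕ, w ^ n ∈ commutator Q ↔ 2 ^ r ∣ n)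
    (hindex : (commutator Q).index = 2 ^ r * 2 ^ r) :
    Nonempty ((Subgroup.normalizer (Q : Set P) ⧸
      (⁅Q, Q⁆ : Subgroup P).subgroupOf (Subgroup.normalizer (Q : Set P))) ≃*
        Cyc (2 ^ r) ≀ᵣ Cyc 2) := by
  refine nonempty_wreathProduct_equiv (h.closure_quotient_eq_top hP hΦ hN _) ?_ ?_ ?_ ?_
  · rw [← map_pow, QuotientGroup.mk'_apply, QuotientGroup.eq_one_iff, Subgroup.mem_subgroupOf]
    exact coe_mem_commutator_iff.mpr ((hr x h.left_notMem _).mpr dvd_rfl)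
  · rw [← map_pow, QuotientGroup.mk'_apply, QuotientGroup.eq_one_iff, Subgroup.mem_subgroupOf]
    exact h.sq_mem
  · rw [← commutatorElement_eq_one_iff_commute, ← map_mul, ← map_inv, ← map_mul,
      ← map_commutatorElement, QuotientGroup.mk'_apply, QuotientGroup.eq_one_iff,
      Subgroup.mem_subgroupOf]
    refine Subgroup.commutator_mem_commutator x.2 ?_
    simp only [Subgroup.coe_mul, Subgroup.coe_inv]
    rw [h.conj_eq]
    exact y.2
  · rw [card_normalizer_quotient (Subgroup.commutator_le_self Q) hN, commutator_self_subgroupOf,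
      hindex]

/-- If `Q` is abelian of exponent at least four, then `x²` is centralized by every conjugate of `Q`
under an element normalizing `N_P(Q)`, but by no element of `N_P(Q) ∖ Q`. -/
theorem SwapsGenerators.normalizer_eq_top {P : Type*} [Group P] [Finite P]
    {Q : Subgroup P} {x y : Q} {a : P} (h : SwapsGenerators Q x y a) (hP : IsPGroup 2 P)
    (hN : Q.relIndex (Subgroup.normalizer (Q : Set P)) = 2) {r : ℕ}
    (hr : ∀ w ∉ frattini Q, ∀ n : ℕ, w ^ n ∈ commutator Q ↔ 2 ^ r ∣ n) (hr2 : 2 ≤ r)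
    (hcomm : commutator Q = ⊥) : Subgroup.normalizer (Q : Set P) = ⊤ := by
  have hab : ∀ u ∈ Q, ∀ v ∈ Q, u * v = v * u := fun u hu v hv => by
    rw [← commutatorElement_eq_one_iff_mul_comm, ← Subgroup.mem_bot]
    have := Subgroup.commutator_mem_commutator hu hv
    rw [← Subgroup.map_subtype_commutator, hcomm, Subgroup.map_bot] at this
    exact this
  have hle : ∀ t ∈ Subgroup.normalizer (Subgroup.normalizer (Q : Set P) : Set P), ∀ q ∈ Q,
      t * q * t⁻¹ ∈ Q := by
    intro t ht q hq
    by_contra hb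
    set N := Subgroup.normalizer (Q : Set P) with hNdef
    have hbN : t * q * t⁻¹ ∈ N := (Subgroup.mem_normalizer_iff.mp ht q).mp (Subgroup.le_normalizer hq)
    have hx2 : t⁻¹ * (x : P) ^ 2 * t ∈ Q := by
      have h1 : t⁻¹ * x * t ∈ N := by
        rw [Subgroup.mem_normalizer_iff.mp ht]
        convert Subgroup.le_normalizer x.2 using 1
        group
      have h2 := (mem_of_relIndex_eq_two hN h1 h1).mpr Iff.rfl
      convert h2 using 1
      rw [sq]
      group
    have hcb : (t * q * t⁻¹) * (x : P) ^ 2 = (x : P) ^ 2 * (t * q * t⁻¹) := by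
      have := hab _ hq _ hx2
      calc _ = t * (q * (t⁻¹ * (x : P) ^ 2 * t)) * t⁻¹ := by group
        _ = _ := by rw [this]; group
    obtain ⟨u, hu⟩ : ∃ u, u = a⁻¹ * (t * q * t⁻¹) := ⟨_, rfl⟩
    have hab' : u ∈ Q := by
      rw [hu, mem_of_relIndex_eq_two hN (inv_mem h.mem_normalizer) hbN, inv_mem_iff]
      exact iff_of_false h.notMem hb
    have hca : a * (x : P) ^ 2 * a⁻¹ = (x : P) ^ 2 := by
      have hau : t * q * t⁻¹ = a * u := by rw [hu]; group
      rw [hau, mul_assoc, hab _ hab' _ (pow_mem x.2 2), ← mul_assoc, ← mul_assoc,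
        mul_left_inj] at hcb
      rw [hcb]
      group
    have hxy : x ^ (2 : ℤ) * y ^ (-2 : ℤ) ∈ commutator Q := by
      have : x ^ (2 : ℤ) * y ^ (-2 : ℤ) = 1 := by
        rw [zpow_neg, mul_inv_eq_one]
        apply Subtype.ext
        rw [Subgroup.coe_zpow, Subgroup.coe_zpow, ← h.conj_eq, conj_zpow]
        exact_mod_cast hca.symm
      rw [this]
      exact one_mem _
    have := ((hP.to_subgroup Q).zpow_mul_zpow_mem_commutator_iff hr h.left_notMem h.right_notMem
      h.inv_mul_notMem _ _).mp hxy
    have h4 := Int.le_of_dvd two_pos ((pow_dvd_pow 2 hr2).trans this.1)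
    norm_num at h4
  by_contra hne
  have : Group.IsNilpotent P := hP.isNilpotent
  have hlt := Group.normalizerCondition_of_isNilpotent _ (lt_top_iff_ne_top.mpr hne)
  obtain ⟨t, ht, htN⟩ := SetLike.exists_of_lt hlt
  refine htN (Subgroup.mem_normalizer_iff.mpr fun q => ⟨hle t ht q, fun hq => ?_⟩)
  have := hle t⁻¹ (inv_mem ht) _ hq
  convert this using 1
  group

/-- If `Q` is abelian of exponent at least four, then `Q` is normal in `P`. -/
theorem SwapsGenerators.nonempty_wreathProduct_equiv {P : Type*} [Group P] [Finite P]
    {Q : Subgroup P} {x y : Q} {a : P} (h : SwapsGenerators Q x y a) (hP : IsPGroup 2 P)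
    (hΦ : (frattini Q).index = 2 ^ 2)
    (hN : Q.relIndex (Subgroup.normalizer (Q : Set P)) = 2) {r : ℕ}
    (hr : ∀ w ∉ frattini Q, ∀ n : ℕ, w ^ n ∈ commutator Q ↔ 2 ^ r ∣ n)
    (hindex : (commutator Q).index = 2 ^ r * 2 ^ r) (hr2 : 2 ≤ r) (hcomm : commutator Q = ⊥) :
    Nonempty (P ≃* Cyc (2 ^ r) ≀ᵣ Cyc 2) := by
  obtain ⟨e⟩ := h.nonempty_normalizer_quotient_equiv hP hΦ hN hr hindex
  have hbot : (⁅Q, Q⁆ : Subgroup P).subgroupOf (Subgroup.normalizer (Q : Set P)) = ⊥ := by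
    rw [← Subgroup.map_subtype_commutator, hcomm, Subgroup.map_bot, Subgroup.bot_subgroupOf]
  exact ⟨Subgroup.topEquiv.symm.trans ((MulEquiv.subgroupCongr
    (h.normalizer_eq_top hP hN hr hr2 hcomm).symm).trans (QuotientGroup.quotientBot.symm.trans
      ((QuotientGroup.quotientMulEquivOfEq hbot.symm).trans e)))⟩

/-! ### The subgroup `Φ(G')K₃(G)` -/

/-- The subgroup `Φ(G')[G', G]` of a group `G`. In a 2-group it is the smallest normal subgroup modulo
which `G'` is central of exponent at most two. -/
def frattiniSupK3 (G : Type*) [Group G] : Subgroup G :=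
  (frattini (commutator G)).map (commutator G).subtype ⊔ ⁅commutator G, ⊤⁆

instance frattiniSupK3_characteristic (G : Type*) [Group G] :
    (frattiniSupK3 G).Characteristic := by
  unfold frattiniSupK3
  infer_instance

theorem frattiniSupK3_le_commutator (G : Type*) [Group G] : frattiniSupK3 G ≤ commutator G :=
  sup_le (Subgroup.map_subtype_le _) (Subgroup.commutator_mono le_top le_top)

theorem commutatorElement_mem_frattiniSupK3 {G : Type*} [Group G] {d : G} (hd : d ∈ commutator G)
    (g : G) : ⁅d, g⁆ ∈ frattiniSupK3 G :=
  (le_sup_right : _ ≤ frattiniSupK3 G) (Subgroup.commutator_mem_commutator hd (Subgroup.mem_top g))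

theorem IsPGroup.sq_mem_frattiniSupK3 {G : Type*} [Group G] [Finite G] (hG : IsPGroup 2 G) {d : G}
    (hd : d ∈ commutator G) : d ^ 2 ∈ frattiniSupK3 G :=
  (le_sup_left : _ ≤ frattiniSupK3 G)
    ⟨⟨d, hd⟩ ^ 2, (hG.to_subgroup _).sq_mem_frattini _, rfl⟩

/-- If `Φ(G')[G', G] = G'`, then `[G', G] = G'` since `Φ(G')` consists of nongenerators, and `G'` is
trivial since `G` is nilpotent. -/
theorem IsPGroup.frattiniSupK3_ne_commutator {G : Type*} [Group G] [Finite G] (hG : IsPGroup 2 G)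
    (hne : commutator G ≠ ⊥) : ¬ commutator G ≤ frattiniSupK3 G := by
  intro h
  have hle : ⁅commutator G, (⊤ : Subgroup G)⁆ ≤ commutator G :=
    Subgroup.commutator_mono le_top le_top
  have htop : ⁅commutator G, (⊤ : Subgroup G)⁆.subgroupOf (commutator G) = ⊤ := by
    apply frattini_nongenerating
    apply Subgroup.map_injective (commutator G).subtype_injective
    rw [Subgroup.map_sup, Subgroup.map_subgroupOf_eq_of_le hle, sup_comm, ← MonoidHom.range_eq_map,
      Subgroup.range_subtype]
    exact le_antisymm (frattiniSupK3_le_commutator G) h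
  have heq : ⁅commutator G, (⊤ : Subgroup G)⁆ = commutator G :=
    le_antisymm hle (Subgroup.subgroupOf_eq_top.mp htop)
  have hnil : Group.IsNilpotent G := hG.isNilpotent
  obtain ⟨n, hn⟩ := Subgroup.nilpotent_iff_lowerCentralSeries.mp hnil
  have hconst : ∀ n, commutator G ≤ (⊤ : Subgroup G).lowerCentralSeries n := by
    intro n
    induction n with
    | zero => exact le_top
    | succ n ih =>
      rw [← heq]
      exact Subgroup.commutator_mono ih le_rfl
  exact hne (le_bot_iff.mp (hn ▸ hconst n))

/-- Modulo `Φ(G')K₃(G)` the commutator subgroup is generated by the central element `[x, y]`, whose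
square is trivial. -/
theorem IsPGroup.mem_frattiniSupK3_or {G : Type*} [Group G] [Finite G] (hG : IsPGroup 2 G) {x y : G}
    (hS : Subgroup.closure {x, y} = ⊤) {d : G} (hd : d ∈ commutator G) :
    d ∈ frattiniSupK3 G ∨ ⁅x, y⁆⁻¹ * d ∈ frattiniSupK3 G := by
  set c := ⁅x, y⁆ with hc
  have hcG : c ∈ commutator G :=
    Subgroup.commutator_mem_commutator (Subgroup.mem_top _) (Subgroup.mem_top _)
  have hmk : ∀ u : G, u ∈ frattiniSupK3 G ↔ QuotientGroup.mk' (frattiniSupK3 G) u = 1 := fun u =>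
    (QuotientGroup.eq_one_iff u).symm
  have hnormal : (Subgroup.zpowers (QuotientGroup.mk' (frattiniSupK3 G) c)).Normal := by
    refine ⟨?_⟩
    rintro _ ⟨k, rfl⟩ g
    obtain ⟨g, rfl⟩ := QuotientGroup.mk'_surjective _ g
    have := (hmk _).mp (commutatorElement_mem_frattiniSupK3 hcG g)
    rw [map_commutatorElement, commutatorElement_eq_one_iff_commute] at this
    simp only
    rw [← (this.zpow_left k).eq, mul_inv_cancel_right]
    exact ⟨k, rfl⟩
  have hle := commutator_le_of_closure_pair_eq_top hS
    ((Subgroup.zpowers (QuotientGroup.mk' (frattiniSupK3 G) c)).comap (QuotientGroup.mk' _))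
    (Subgroup.mem_zpowers _)
  obtain ⟨k, hk⟩ := hle hd
  have hc2 := (hmk _).mp (hG.sq_mem_frattiniSupK3 hcG)
  rw [map_pow] at hc2
  simp only at hk
  rw [hmk, hmk, map_mul, map_inv, ← hk]
  generalize QuotientGroup.mk' (frattiniSupK3 G) c = C at *
  rcases Int.even_or_odd' k with ⟨l, rfl | rfl⟩
  · left
    rw [zpow_mul]
    simp [show C ^ (2 : ℤ) = 1 by exact_mod_cast hc2]
  · right
    rw [zpow_add_one, zpow_mul]
    simp [show C ^ (2 : ℤ) = 1 by exact_mod_cast hc2]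

theorem IsPGroup.commutatorElement_notMem_frattiniSupK3 {G : Type*} [Group G] [Finite G]
    (hG : IsPGroup 2 G) {x y : G} (hS : Subgroup.closure {x, y} = ⊤) (hne : commutator G ≠ ⊥) :
    ⁅x, y⁆ ∉ frattiniSupK3 G :=
  fun h => hG.frattiniSupK3_ne_commutator hne (commutator_le_of_closure_pair_eq_top hS _ h)

theorem IsPGroup.relIndex_frattiniSupK3 {G : Type*} [Group G] [Finite G] (hG : IsPGroup 2 G)
    {x y : G} (hS : Subgroup.closure {x, y} = ⊤) (hne : commutator G ≠ ⊥) :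
    (frattiniSupK3 G).relIndex (commutator G) = 2 := by
  have hcG : ⁅x, y⁆ ∈ commutator G :=
    Subgroup.commutator_mem_commutator (Subgroup.mem_top _) (Subgroup.mem_top _)
  have hc := hG.commutatorElement_notMem_frattiniSupK3 hS hne
  have hn : (frattiniSupK3 G).Normal := inferInstance
  rw [Subgroup.relIndex, Subgroup.index_eq_two_iff]
  refine ⟨⟨⁅x, y⁆, hcG⟩⁻¹, ?_⟩
  rintro ⟨d, hd⟩
  simp only [Subgroup.mem_subgroupOf, Subgroup.coe_mul, Subgroup.coe_inv]
  rw [hn.mem_comm_iff]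
  by_cases h : d ∈ frattiniSupK3 G
  · refine Or.inr ⟨h, fun h' => hc ?_⟩
    exact inv_mem_iff.mp ((Subgroup.mul_mem_cancel_right _ h).mp h')
  · exact Or.inl ⟨(hG.mem_frattiniSupK3_or hS hd).resolve_left h, h⟩

/-! ### Power maps modulo a central commutator subgroup -/

theorem mul_pow_of_commute_commutatorElement {G : Type*} [Group G] {u v : G}
    (hu : Commute ⁅v, u⁆ u) (hv : Commute ⁅v, u⁆ v) (n : ℕ) :
    (u * v) ^ n = u ^ n * v ^ n * ⁅v, u⁆ ^ n.choose 2 := by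
  set z := ⁅v, u⁆ with hz
  have hvu : v * u = z * (u * v) := by rw [hz, commutatorElement_def]; group
  have hvn : ∀ n : ℕ, v ^ n * u = z ^ n * (u * v ^ n) := by
    intro n
    induction n with
    | zero => simp
    | succ n ih =>
      calc v ^ (n + 1) * u = v * (v ^ n * u) := by rw [pow_succ', mul_assoc]
        _ = v * z ^ n * u * v ^ n := by rw [ih]; simp only [mul_assoc]
        _ = z ^ n * (v * u) * v ^ n := by rw [← (hv.pow_left n).eq]; simp only [mul_assoc]
        _ = _ := by rw [hvu, pow_succ, pow_succ']; simp only [mul_assoc]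
  induction n with
  | zero => simp
  | succ n ih =>
    have hC := (hu.mul_right hv).pow_left (n.choose 2)
    calc (u * v) ^ (n + 1) = u ^ n * v ^ n * (z ^ n.choose 2 * (u * v)) := by
          rw [pow_succ, ih]; simp only [mul_assoc]
      _ = u ^ n * (v ^ n * u) * v * z ^ n.choose 2 := by rw [hC.eq]; simp only [mul_assoc]
      _ = u ^ n * (z ^ n * (u * (v ^ n * v))) * z ^ n.choose 2 := by
        rw [hvn]; simp only [mul_assoc]
      _ = u ^ n * (u * (v ^ n * v) * z ^ n) * z ^ n.choose 2 := by
        rw [((hu.mul_right ((hv.pow_right n).mul_right hv)).pow_left n).eq]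
      _ = _ := by
        rw [Nat.choose_succ_succ' n 1, Nat.choose_one_right, pow_add z, pow_succ u n, pow_succ v n]
        simp only [mul_assoc]

/-- Modulo `N` the map `u ↦ u ^ n` is a homomorphism that is constant on the orbits of `α`. -/
theorem FixesNoFrattiniCoset.pow_mem {G : Type*} [Group G] [Finite G] {α : MulAut G}
    (hα : FixesNoFrattiniCoset α) (hG : IsPGroup 2 G) (hΦ : (frattini G).index = 2 ^ 2)
    (N : Subgroup G) [N.Normal] {n : ℕ} (hcentral : ∀ d ∈ commutator G, ∀ w, ⁅d, w⁆ ∈ N)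
    (hchoose : ∀ d ∈ commutator G, d ^ n.choose 2 ∈ N) (hfix : ∀ u, (u ^ n)⁻¹ * α (u ^ n) ∈ N)
    (u : G) : u ^ n ∈ N := by
  have hmk : ∀ u : G, u ∈ N ↔ QuotientGroup.mk' N u = 1 := fun u =>
    (QuotientGroup.eq_one_iff u).symm
  let f : G →* G ⧸ N :=
    { toFun := fun u => QuotientGroup.mk' N u ^ n
      map_one' := by simp
      map_mul' := fun u v => by
        have hd : ⁅v, u⁆ ∈ commutator G :=
          Subgroup.commutator_mem_commutator (Subgroup.mem_top _) (Subgroup.mem_top _)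
        have hcomm : ∀ w, Commute ⁅QuotientGroup.mk' N v, QuotientGroup.mk' N u⁆
            (QuotientGroup.mk' N w) := fun w => by
          rw [← commutatorElement_eq_one_iff_commute, ← map_commutatorElement,
            ← map_commutatorElement, ← hmk]
          exact hcentral _ hd w
        have h := (hmk _).mp (hchoose _ hd)
        rw [map_pow, map_commutatorElement] at h
        rw [map_mul, mul_pow_of_commute_commutatorElement (hcomm u) (hcomm v), h, mul_one] }
  have h := hα.eq_one_of_comp_eq hG hΦ f (fun u => by
    have := (hmk _).mp (hfix u)
    rw [map_mul, map_inv, inv_mul_eq_one, map_pow, map_pow, map_pow] at this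
    exact this.symm) u
  rw [hmk, map_pow]
  exact h

theorem two_pow_dvd_choose_two (s : ℕ) : 2 ^ s ∣ (2 ^ (s + 1)).choose 2 := by
  rw [Nat.choose_two_right, pow_succ, mul_assoc, mul_left_comm, Nat.mul_div_cancel_left _ two_pos]
  exact dvd_mul_right _ _

/-- The commutator subgroup has order two modulo `Φ(G')K₃(G)`, so `α` fixes `u ^ 2 ^ r` in this
quotient; and `(2 ^ r).choose 2` is even for `r ≥ 2`. -/
theorem FixesNoFrattiniCoset.pow_mem_frattiniSupK3 {G : Type*} [Group G] [Finite G] {α : MulAut G}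
    (hα : FixesNoFrattiniCoset α) (hG : IsPGroup 2 G) (hΦ : (frattini G).index = 2 ^ 2)
    (hne : commutator G ≠ ⊥) {r : ℕ}
    (hr : ∀ w ∉ frattini G, ∀ n : ℕ, w ^ n ∈ commutator G ↔ 2 ^ r ∣ n) (hr2 : 2 ≤ r) (u : G) :
    u ^ 2 ^ r ∈ frattiniSupK3 G := by
  obtain ⟨x, hx⟩ := exists_notMem_frattini hΦ
  have hindex := hG.relIndex_frattiniSupK3 (hα.closure_eq_top hG hΦ hx) hne
  refine hα.pow_mem hG hΦ _ (fun d hd w => commutatorElement_mem_frattiniSupK3 hd w) ?_ ?_ u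
  · intro d hd
    obtain ⟨s, rfl⟩ : ∃ s, r = s + 1 := ⟨r - 1, by omega⟩
    obtain ⟨k, hk⟩ := (dvd_pow_self 2 (by omega : s ≠ 0)).trans (two_pow_dvd_choose_two s)
    rw [hk, pow_mul]
    exact _root_.pow_mem (hG.sq_mem_frattiniSupK3 hd) k
  · intro v
    have hv := hα.pow_mem_commutator hG hΦ hx ((hr x hx _).mpr dvd_rfl) v
    rw [mem_of_relIndex_eq_two hindex (inv_mem hv)
      ((mulAut_mem_iff_of_characteristic _ α _).mpr hv), inv_mem_iff,
      mulAut_mem_iff_of_characteristic]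

theorem frattini_map_mulEquiv {G H : Type*} [Group G] [Group H] (e : G ≃* H) :
    (frattini G).map e.toMonoidHom = frattini H := by
  refine le_antisymm (Subgroup.map_le_iff_le_comap.mpr
    (frattini_le_comap_frattini_of_surjective e.surjective)) fun h hh => ?_
  exact ⟨e.symm h, frattini_le_comap_frattini_of_surjective (φ := e.symm.toMonoidHom)
    e.symm.surjective hh, e.apply_symm_apply h⟩

theorem frattiniCommK3_le {P : Type*} [Group P] (Q : Subgroup P) :
    frattiniCommK3 Q ≤ Q :=
  sup_le ((Subgroup.map_subtype_le _).trans (Subgroup.commutator_le_self Q))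
    ((Subgroup.commutator_mono (Subgroup.commutator_le_self Q) le_rfl).trans
      (Subgroup.commutator_le_self Q))

theorem frattiniCommK3_subgroupOf {P : Type*} [Group P] (Q : Subgroup P) :
    (frattiniCommK3 Q).subgroupOf Q = frattiniSupK3 Q := by
  let e : commutator Q ≃* (⁅Q, Q⁆ : Subgroup P) :=
    ((commutator Q).equivMapOfInjective Q.subtype Q.subtype_injective).trans
      (MulEquiv.subgroupCongr (Subgroup.map_subtype_commutator Q))
  apply Subgroup.map_injective Q.subtype_injective
  rw [Subgroup.map_subgroupOf_eq_of_le (frattiniCommK3_le Q), frattiniSupK3, Subgroup.map_sup,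
    Subgroup.map_commutator, Subgroup.map_subtype_commutator, ← MonoidHom.range_eq_map,
    Subgroup.range_subtype, frattiniCommK3, ← frattini_map_mulEquiv e, Subgroup.map_map,
    Subgroup.map_map]
  rfl

theorem coe_mem_frattiniCommK3_iff {P : Type*} [Group P] {Q : Subgroup P} {q : Q} :
    (q : P) ∈ frattiniCommK3 Q ↔ q ∈ frattiniSupK3 Q := by
  rw [← frattiniCommK3_subgroupOf, Subgroup.mem_subgroupOf]

theorem IsPGroup.index_frattiniSupK3 {G : Type*} [Group G] [Finite G] (hG : IsPGroup 2 G)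
    {x y : G} (hS : Subgroup.closure {x, y} = ⊤) (hne : commutator G ≠ ⊥) {m : ℕ}
    (hindex : (commutator G).index = m) : (frattiniSupK3 G).index = m * 2 := by
  rw [← Subgroup.relIndex_mul_index (frattiniSupK3_le_commutator G),
    hG.relIndex_frattiniSupK3 hS hne, hindex, mul_comm]

/-! ### The quotients by `Φ(Q')K₃(Q)` -/

theorem nonempty_presentedGroup_equiv {ι H : Type*} [Group H] {rels : Set (FreeGroup ι)} {v : ι → H}
    (hrel : ∀ s ∈ rels, FreeGroup.lift v s = 1) {S : Set H} (hS : Subgroup.closure S = ⊤)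
    (hSv : S ⊆ Set.range v) {m : ℕ}
    (hcard : Finite (PresentedGroup rels) ∧ Nat.card (PresentedGroup rels) ≤ m)
    (hH : Nat.card H = m) : Nonempty (H ≃* PresentedGroup rels) := by
  refine nonempty_mulEquiv_of_surjective (PresentedGroup.toGroup hrel)
    (MonoidHom.surjective_of_closure _ hS fun s hs => ?_) hcard hH
  obtain ⟨i, rfl⟩ := hSv hs
  exact ⟨.of i, PresentedGroup.toGroup.of hrel⟩

theorem FixesNoFrattiniCoset.nonempty_minimalNonabelianGroup_equiv {G : Type*} [Group G] [Finite G]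
    {α : MulAut G} (hα : FixesNoFrattiniCoset α) (hG : IsPGroup 2 G)
    (hΦ : (frattini G).index = 2 ^ 2) (hne : commutator G ≠ ⊥) {r : ℕ}
    (hr : ∀ w ∉ frattini G, ∀ n : ℕ, w ^ n ∈ commutator G ↔ 2 ^ r ∣ n) (hr2 : 2 ≤ r)
    (hindex : (commutator G).index = 2 ^ r * 2 ^ r) :
    Nonempty (G ⧸ frattiniSupK3 G ≃* MinimalNonabelianGroup 2 r r) := by
  obtain ⟨x, hx⟩ := exists_notMem_frattini hΦ
  have hS := hα.closure_eq_top hG hΦ hx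
  set y := α x
  have hmk : ∀ u : G, u ∈ frattiniSupK3 G → QuotientGroup.mk' (frattiniSupK3 G) u = 1 := fun u =>
    (QuotientGroup.eq_one_iff u).mpr
  have hc : ⁅x, y⁆ ∈ commutator G :=
    Subgroup.commutator_mem_commutator (Subgroup.mem_top _) (Subgroup.mem_top _)
  have hc' : ∀ u, ⁅u, ⁅x, y⁆⁆ ∈ frattiniSupK3 G := fun u => by
    rw [← commutatorElement_inv]
    exact inv_mem (commutatorElement_mem_frattiniSupK3 hc u)
  have hS' : Subgroup.closure {QuotientGroup.mk' (frattiniSupK3 G) x, QuotientGroup.mk' _ y} =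
      ⊤ := by
    rw [← Set.image_pair, ← MonoidHom.map_closure, hS,
      Subgroup.map_top_of_surjective _ (QuotientGroup.mk'_surjective _)]
  refine nonempty_presentedGroup_equiv
    (v := ![QuotientGroup.mk' (frattiniSupK3 G) x, QuotientGroup.mk' _ y]) ?_ hS'
    (by rintro s (rfl | rfl); exacts [⟨0, rfl⟩, ⟨1, rfl⟩])
    (minimalNonabelianGroup_card_le r) (hG.index_frattiniSupK3 hS hne hindex)
  have key := hα.pow_mem_frattiniSupK3 hG hΦ hne hr hr2
  rintro s (rfl | rfl | rfl | rfl | rfl) <;>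
    simp only [map_pow, map_commutatorElement, FreeGroup.lift_apply_of, Matrix.cons_val_zero,
      Matrix.cons_val_one] <;> simp only [← map_pow, ← map_commutatorElement]
  · exact hmk _ (key x)
  · exact hmk _ (key y)
  · exact hmk _ (hG.sq_mem_frattiniSupK3 hc)
  · exact hmk _ (hc' x)
  · exact hmk _ (hc' y)

theorem SwapsGenerators.exists_nonempty_normalizerQuotientGroup_equiv {P : Type*} [Group P]
    [Finite P] {Q : Subgroup P} {x y : Q} {a : P} (h : SwapsGenerators Q x y a)
    (hP : IsPGroup 2 P) (hΦ : (frattini Q).index = 2 ^ 2) {α : MulAut Q}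
    (hα : FixesNoFrattiniCoset α)
    (hN : Q.relIndex (Subgroup.normalizer (Q : Set P)) = 2) (hne : commutator Q ≠ ⊥) {r : ℕ}
    (hr : ∀ w ∉ frattini Q, ∀ n : ℕ, w ^ n ∈ commutator Q ↔ 2 ^ r ∣ n) (hr2 : 2 ≤ r)
    (hindex : (commutator Q).index = 2 ^ r * 2 ^ r) :
    ∃ k < 2, Nonempty ((Subgroup.normalizer (Q : Set P) ⧸
      (frattiniCommK3 Q).subgroupOf (Subgroup.normalizer (Q : Set P))) ≃*
        NormalizerQuotientGroup r k) := by
  have hQ := hP.to_subgroup Q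
  have hS := hQ.closure_pair_eq_top hΦ h.left_notMem h.right_notMem h.inv_mul_notMem
  have hc : ⁅x, y⁆ ∈ commutator Q :=
    Subgroup.commutator_mem_commutator (Subgroup.mem_top _) (Subgroup.mem_top _)
  have hc' : ∀ u, ⁅u, ⁅x, y⁆⁆ ∈ frattiniSupK3 Q := fun u => by
    rw [← commutatorElement_inv]
    exact inv_mem (commutatorElement_mem_frattiniSupK3 hc u)
  have haQ : a ^ 2 ∈ Q := Subgroup.commutator_le_self Q h.sq_mem
  obtain ⟨k, hk2, hk⟩ : ∃ k < 2, (⟨a ^ 2, haQ⟩ : Q) * (⁅x, y⁆ ^ k)⁻¹ ∈ frattiniSupK3 Q := by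
    have hn : (frattiniSupK3 Q).Normal := inferInstance
    rcases hQ.mem_frattiniSupK3_or hS (d := ⟨a ^ 2, haQ⟩) (coe_mem_commutator_iff.mp h.sq_mem)
      with h0 | h1
    · exact ⟨0, by norm_num, by simpa using h0⟩
    · exact ⟨1, by norm_num, by rwa [pow_one, hn.mem_comm_iff]⟩
  refine ⟨k, hk2, ?_⟩
  set K := (frattiniCommK3 Q).subgroupOf (Subgroup.normalizer (Q : Set P)) with hK
  let X : Subgroup.normalizer (Q : Set P) := ⟨x, Subgroup.le_normalizer x.2⟩
  let Y : Subgroup.normalizer (Q : Set P) := ⟨y, Subgroup.le_normalizer y.2⟩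
  let A : Subgroup.normalizer (Q : Set P) := ⟨a, h.mem_normalizer⟩
  have hmk : ∀ (q : Q), q ∈ frattiniSupK3 Q →
      QuotientGroup.mk' K (Subgroup.inclusion Subgroup.le_normalizer q) = 1 := fun q hq =>
    (QuotientGroup.eq_one_iff _).mpr (coe_mem_frattiniCommK3_iff.mpr hq)
  refine nonempty_presentedGroup_equiv
    (v := ![QuotientGroup.mk' K X, QuotientGroup.mk' K Y, QuotientGroup.mk' K A]) ?_
    (h.closure_quotient_eq_top hP hΦ hN K) ?_ (normalizerQuotientGroup_card_le r k) ?_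
  · rintro s (rfl | rfl | rfl | rfl | rfl | rfl) <;>
      simp only [map_pow, map_mul, map_inv, map_commutatorElement, FreeGroup.lift_apply_of,
        Matrix.cons_val_zero, Matrix.cons_val_one, Matrix.cons_val] <;>
      simp only [← map_pow, ← map_commutatorElement, ← map_mul, ← map_inv]
    · exact hmk _ (hα.pow_mem_frattiniSupK3 hQ hΦ hne hr hr2 x)
    · exact hmk _ (hQ.sq_mem_frattiniSupK3 hc)
    · exact hmk _ (hc' x)
    · exact hmk _ (hc' y)
    · exact hmk _ hk
    · have : A * X * A⁻¹ * Y⁻¹ = 1 := by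
        rw [mul_inv_eq_one]
        exact Subtype.ext h.conj_eq
      rw [this, map_one]
  · rintro s (rfl | rfl)
    · exact ⟨0, rfl⟩
    · exact ⟨2, rfl⟩
  · rw [card_normalizer_quotient (frattiniCommK3_le Q) hN, frattiniCommK3_subgroupOf,
      hQ.index_frattiniSupK3 hS hne hindex]
    ring

/-! ### The case `|Φ(Q')K₃(Q)| = 2` -/

theorem eq_of_mem_of_card_eq_two {G : Type*} [Group G] {N : Subgroup G} (h : Nat.card N = 2)
    {u v : G} (hu : u ∈ N) (hv : v ∈ N) (hu1 : u ≠ 1) (hv1 : v ≠ 1) : u = v := by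
  obtain ⟨e, -, he⟩ := (Nat.card_eq_two_iff' (1 : N)).mp h
  have h1 := he ⟨u, hu⟩ (fun h => hu1 (congrArg Subtype.val h))
  have h2 := he ⟨v, hv⟩ (fun h => hv1 (congrArg Subtype.val h))
  exact congrArg Subtype.val (h1.trans h2.symm)

/-- An automorphism fixes the only nontrivial element of a characteristic subgroup of order two. -/
theorem mulAut_apply_eq_of_card_eq_two {G : Type*} [Group G] {N : Subgroup G} [N.Characteristic]
    (h : Nat.card N = 2) (α : MulAut G) {u : G} (hu : u ∈ N) : α u = u := by
  by_cases hu1 : u = 1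
  · rw [hu1, map_one]
  · exact eq_of_mem_of_card_eq_two h ((mulAut_mem_iff_of_characteristic _ α u).mpr hu) hu
      (by rwa [Ne, map_eq_one_iff α α.injective]) hu1

theorem le_center_of_card_eq_two {G : Type*} [Group G] {N : Subgroup G} [N.Characteristic]
    (h : Nat.card N = 2) : N ≤ Subgroup.center G := by
  intro u hu
  rw [Subgroup.mem_center_iff]
  intro g
  rw [← mul_inv_eq_iff_eq_mul]
  exact mulAut_apply_eq_of_card_eq_two h (MulAut.conj g) hu

/-- If `Φ(G')K₃(G)` has order two, it is central and fixed by `α`. Then `u ↦ [u, c]`, where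
`c ∈ G' ∖ Φ(G')K₃(G)`, is a homomorphism that is invariant under `α`, hence trivial. -/
theorem FixesNoFrattiniCoset.commutator_le_center {G : Type*} [Group G] [Finite G] {α : MulAut G}
    (hα : FixesNoFrattiniCoset α) (hG : IsPGroup 2 G) (hΦ : (frattini G).index = 2 ^ 2)
    (hne : commutator G ≠ ⊥) (hcard : Nat.card (frattiniSupK3 G) = 2) :
    commutator G ≤ Subgroup.center G := by
  obtain ⟨x, hx⟩ := exists_notMem_frattini hΦ
  have hS := hα.closure_eq_top hG hΦ hx
  have hZ := le_center_of_card_eq_two hcard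
  set c := ⁅x, α x⁆ with hcdef
  have hc : c ∈ commutator G :=
    Subgroup.commutator_mem_commutator (Subgroup.mem_top _) (Subgroup.mem_top _)
  have huc : ∀ u, ⁅u, c⁆ ∈ frattiniSupK3 G := fun u => by
    rw [← commutatorElement_inv]
    exact inv_mem (commutatorElement_mem_frattiniSupK3 hc u)
  have hm : c⁻¹ * α c ∈ frattiniSupK3 G := by
    rw [mem_of_relIndex_eq_two (hG.relIndex_frattiniSupK3 hS hne) (inv_mem hc)
      ((mulAut_mem_iff_of_characteristic _ α _).mpr hc), inv_mem_iff,
      mulAut_mem_iff_of_characteristic]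
  let f : G →* G :=
    { toFun := fun u => ⁅u, c⁆
      map_one' := commutatorElement_one_left c
      map_mul' := fun u v => by
        have h1 := Subgroup.mem_center_iff.mp (hZ (huc v))
        calc ⁅u * v, c⁆ = u * ⁅v, c⁆ * (c * u⁻¹ * c⁻¹) := by
              simp only [commutatorElement_def]; group
          _ = ⁅u, c⁆ * ⁅v, c⁆ := by
              rw [h1 u, mul_assoc, ← h1, commutatorElement_def u]
              simp only [mul_assoc] }
  refine commutator_le_of_closure_pair_eq_top hS _ (Subgroup.mem_center_iff.mpr fun u => ?_)
  rw [← commutatorElement_eq_one_iff_mul_comm]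
  refine hα.eq_one_of_comp_eq hG hΦ f (fun u => ?_) u
  change ⁅α u, c⁆ = ⁅u, c⁆
  have hmc := Subgroup.mem_center_iff.mp (hZ hm)
  have hαc : α c = c * (c⁻¹ * α c) := by group
  calc ⁅α u, c⁆ = ⁅α u, α c⁆ := by
        rw [hαc]
        generalize c⁻¹ * α c = m at hmc
        rw [commutatorElement_def, commutatorElement_def, ← mul_assoc, mul_assoc _ m, ← hmc]
        group
    _ = ⁅u, c⁆ := by
        rw [← map_commutatorElement]
        exact mulAut_apply_eq_of_card_eq_two hcard α (huc u)

theorem IsPGroup.card_commutator_eq_four {G : Type*} [Group G] [Finite G] (hG : IsPGroup 2 G)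
    {x y : G} (hS : Subgroup.closure {x, y} = ⊤) (hne : commutator G ≠ ⊥)
    (hcard : Nat.card (frattiniSupK3 G) = 2) : Nat.card (commutator G) = 4 := by
  have := Subgroup.relIndex_mul_relIndex ⊥ _ _ bot_le (frattiniSupK3_le_commutator G)
  rw [Subgroup.relIndex_bot_left, Subgroup.relIndex_bot_left, hcard,
    hG.relIndex_frattiniSupK3 hS hne] at this
  exact this.symm

theorem IsPGroup.orderOf_commutatorElement_eq_four {G : Type*} [Group G] [Finite G]
    (hG : IsPGroup 2 G) {x y : G} (hS : Subgroup.closure {x, y} = ⊤) (hne : commutator G ≠ ⊥)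
    (hcard : Nat.card (frattiniSupK3 G) = 2) (hZ : commutator G ≤ Subgroup.center G) :
    orderOf ⁅x, y⁆ = 4 := by
  have hc : ⁅x, y⁆ ∈ commutator G :=
    Subgroup.commutator_mem_commutator (Subgroup.mem_top _) (Subgroup.mem_top _)
  have hn : (Subgroup.zpowers ⁅x, y⁆).Normal := by
    refine ⟨fun u hu g => ?_⟩
    have := Subgroup.mem_center_iff.mp (hZ ((Subgroup.zpowers_le.mpr hc) hu)) g
    rwa [this, mul_inv_cancel_right]
  have heq : commutator G = Subgroup.zpowers ⁅x, y⁆ := le_antisymm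
    (commutator_le_of_closure_pair_eq_top hS _ (Subgroup.mem_zpowers _)) (Subgroup.zpowers_le.mpr hc)
  rw [← Nat.card_zpowers, ← heq, hG.card_commutator_eq_four hS hne hcard]

/-- For `r ≥ 3` the number `(2 ^ r).choose 2` is divisible by four, the order of `G'`, and `α`
fixes the elements `u ^ 2 ^ r` of `Φ(G')K₃(G)`. Hence `u ↦ u ^ 2 ^ r` is a homomorphism invariant
under `α`, so it is trivial. -/
theorem FixesNoFrattiniCoset.nonempty_essentialGroup_equiv {G : Type*} [Group G] [Finite G]
    {α : MulAut G} (hα : FixesNoFrattiniCoset α) (hG : IsPGroup 2 G)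
    (hΦ : (frattini G).index = 2 ^ 2) (hne : commutator G ≠ ⊥) {r : ℕ}
    (hr : ∀ w ∉ frattini G, ∀ n : ℕ, w ^ n ∈ commutator G ↔ 2 ^ r ∣ n) (hr3 : 3 ≤ r)
    (hindex : (commutator G).index = 2 ^ r * 2 ^ r) (hcard : Nat.card (frattiniSupK3 G) = 2) :
    Nonempty (G ≃* EssentialGroup r) := by
  obtain ⟨x, hx⟩ := exists_notMem_frattini hΦ
  have hS := hα.closure_eq_top hG hΦ hx
  set y := α x
  have hZ := hα.commutator_le_center hG hΦ hne hcard
  have hcard' := hG.card_commutator_eq_four hS hne hcard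
  have hd4 : ∀ d ∈ commutator G, d ^ 4 = 1 := fun d hd => by
    have := pow_card_eq_one' (x := (⟨d, hd⟩ : commutator G))
    rw [hcard'] at this
    exact congrArg Subtype.val this
  have hdc : ∀ d ∈ commutator G, ∀ w : G, ⁅d, w⁆ = 1 := fun d hd w =>
    commutatorElement_eq_one_iff_mul_comm.mpr (Subgroup.mem_center_iff.mp (hZ hd) w).symm
  have hpow : ∀ u : G, u ^ 2 ^ r = 1 := fun u => by
    refine Subgroup.mem_bot.mp (hα.pow_mem hG hΦ ⊥ (fun d hd w => ?_) (fun d hd => ?_)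
      (fun v => ?_) u)
    · rw [hdc d hd w]
      exact one_mem _
    · obtain ⟨s, rfl⟩ : ∃ s, r = s + 1 := ⟨r - 1, by omega⟩
      obtain ⟨k, hk⟩ := (pow_dvd_pow 2 (by omega : 2 ≤ s)).trans (two_pow_dvd_choose_two s)
      rw [hk, pow_mul, show 2 ^ 2 = 4 from rfl, hd4 d hd, one_pow]
      exact one_mem _
    · rw [mulAut_apply_eq_of_card_eq_two hcard α
        (hα.pow_mem_frattiniSupK3 hG hΦ hne hr (by omega) v), inv_mul_cancel]
      exact one_mem _
  have hc : ⁅x, y⁆ ∈ commutator G :=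
    Subgroup.commutator_mem_commutator (Subgroup.mem_top _) (Subgroup.mem_top _)
  have hc' : ∀ u, ⁅u, ⁅x, y⁆⁆ = 1 := fun u => by
    rw [← commutatorElement_inv, hdc _ hc, inv_one]
  have hcardG : Nat.card G = 2 ^ r * 2 ^ r * 4 := by
    rw [← (commutator G).card_mul_index, hcard', hindex, mul_comm]
  refine nonempty_presentedGroup_equiv (v := ![x, y]) ?_ hS
    (by rintro s (rfl | rfl); exacts [⟨0, rfl⟩, ⟨1, rfl⟩]) (essentialGroup_card_le r) hcardG
  rintro s (rfl | rfl | rfl | rfl | rfl) <;>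
    simp only [map_pow, map_commutatorElement, FreeGroup.lift_apply_of, Matrix.cons_val_zero,
      Matrix.cons_val_one]
  · exact hpow x
  · exact hpow y
  · exact hd4 _ hc
  · exact hc' x
  · exact hc' y

/-- For generators of the form `x = vα(v)` and `y = α(x)` the fourth powers are determined: since
`v⁴` is fixed by `α`, the class-two power formula gives `x⁴ = v⁸[α(v), v]⁶ = [α(v), v]²`. -/
theorem FixesNoFrattiniCoset.nonempty_essentialGroupTwo_equiv {G : Type*} [Group G] [Finite G]
    {α : MulAut G} (hα : FixesNoFrattiniCoset α) (hG : IsPGroup 2 G)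
    (hΦ : (frattini G).index = 2 ^ 2) (hne : commutator G ≠ ⊥)
    (hr : ∀ w ∉ frattini G, ∀ n : ℕ, w ^ n ∈ commutator G ↔ 2 ^ 2 ∣ n)
    (hindex : (commutator G).index = 2 ^ 2 * 2 ^ 2) (hcard : Nat.card (frattiniSupK3 G) = 2) :
    Nonempty (G ≃* EssentialGroupTwo) := by
  obtain ⟨v, hv⟩ := exists_notMem_frattini hΦ
  have hx : v * α v ∉ frattini G := fun h => hα v hv (by
    have := mul_mem (inv_mem (hG.sq_mem_frattini v)) h
    rwa [show (v ^ 2)⁻¹ * (v * α v) = v⁻¹ * α v by rw [sq]; group] at this)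
  have hZ := hα.commutator_le_center hG hΦ hne hcard
  have hc : ∀ u w : G, ⁅u, w⁆ ∈ commutator G := fun u w =>
    Subgroup.commutator_mem_commutator (Subgroup.mem_top _) (Subgroup.mem_top _)
  have hdc : ∀ d ∈ commutator G, ∀ w, Commute d w := fun d hd w =>
    (Subgroup.mem_center_iff.mp (hZ hd) w).symm
  have hsq1 : ∀ d ∈ frattiniSupK3 G, d ^ 2 = 1 := fun d hd => by
    have := pow_card_eq_one' (x := (⟨d, hd⟩ : frattiniSupK3 G))
    rw [hcard] at this
    exact congrArg Subtype.val this
  have hfour : ∀ u : G, u ^ 4 ∈ frattiniSupK3 G :=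
    hα.pow_mem_frattiniSupK3 hG hΦ hne hr le_rfl
  have hfix : ∀ u : G, α u ^ 4 = u ^ 4 := fun u => by
    rw [← map_pow, mulAut_apply_eq_of_card_eq_two hcard α (hfour u)]
  have horder : ∀ u w : G, Subgroup.closure {u, w} = ⊤ → orderOf ⁅u, w⁆ = 4 := fun u w h =>
    hG.orderOf_commutatorElement_eq_four h hne hcard hZ
  have hv4 : (v * α v) ^ 4 = ⁅α v, v⁆ ^ 2 := by
    have ho := horder (α v) v (by rw [Set.pair_comm]; exact hα.closure_eq_top hG hΦ hv)
    rw [mul_pow_of_commute_commutatorElement (hdc _ (hc _ _) _) (hdc _ (hc _ _) _), hfix, ← pow_add,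
      show 4 + 4 = 4 * 2 from rfl, pow_mul, hsq1 _ (hfour v), one_mul,
      show Nat.choose 4 2 = 4 + 2 from rfl, pow_add, ← ho, pow_orderOf_eq_one, one_mul]
  have hS := hα.closure_eq_top hG hΦ hx
  have hne1 : ∀ u w : G, Subgroup.closure {u, w} = ⊤ → ⁅u, w⁆ ^ 2 ≠ 1 := fun u w h h1 => by
    have := Nat.le_of_dvd two_pos (orderOf_dvd_of_pow_eq_one h1)
    rw [horder u w h] at this
    omega
  have hx4 : (v * α v) ^ 4 = ⁅v * α v, α (v * α v)⁆ ^ 2 := by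
    rw [hv4]
    exact eq_of_mem_of_card_eq_two hcard (hG.sq_mem_frattiniSupK3 (hc _ _))
      (hG.sq_mem_frattiniSupK3 (hc _ _))
      (hne1 _ _ (by rw [Set.pair_comm]; exact hα.closure_eq_top hG hΦ hv)) (hne1 _ _ hS)
  set x := v * α v
  have hcardG : Nat.card G = 4 * 4 * 4 := by
    rw [← (commutator G).card_mul_index, hG.card_commutator_eq_four hS hne hcard, hindex]
    norm_num
  refine nonempty_presentedGroup_equiv (v := ![x, α x]) ?_ hS
    (by rintro s (rfl | rfl); exacts [⟨0, rfl⟩, ⟨1, rfl⟩]) essentialGroupTwo_card_le hcardG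
  rintro s (rfl | rfl | rfl | rfl | rfl) <;>
    simp only [map_pow, map_mul, map_inv, map_commutatorElement, FreeGroup.lift_apply_of,
      Matrix.cons_val_zero, Matrix.cons_val_one]
  · rw [show 8 = 4 * 2 from rfl, pow_mul, hsq1 _ (hfour x)]
  · rw [commutatorElement_eq_one_iff_commute]
    exact (hdc _ (hc _ _) _).symm
  · rw [commutatorElement_eq_one_iff_commute]
    exact (hdc _ (hc _ _) _).symm
  · rw [hfix, mul_inv_cancel]
  · rw [hfix, hx4, mul_inv_cancel]

theorem mainTheorem11 {P : Type*} [Group P] [Finite P] (hP : IsPGroup 2 P)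
    (F : FusionSystem P) (hF : F.IsSaturated 2)
    (Q : Subgroup P) (hQ : F.IsEssential 2 Q) (hrank : (frattini Q).index = 2 ^ 2) :
    -- (i)
    (Nonempty (Q ≃* Cyc 2 × Cyc 2) ∧
      ((∃ n, 3 ≤ n ∧ Nonempty (P ≃* DihedralGroup (2 ^ (n - 1)))) ∨
        ∃ n, 4 ≤ n ∧ Nonempty (P ≃* SemidihedralGroup n))) ∨
    -- (ii)
    (Nonempty (Q ≃* QuaternionGroup 2) ∧
      ((∃ n, 3 ≤ n ∧ Nonempty (P ≃* QuaternionGroup (2 ^ (n - 2)))) ∨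
        ∃ n, 4 ≤ n ∧ Nonempty (P ≃* SemidihedralGroup n))) ∨
    -- (iii)
    (∃ r, 2 ≤ r ∧ Nonempty (Q ≃* Cyc (2 ^ r) × Cyc (2 ^ r)) ∧
      Nonempty (P ≃* Cyc (2 ^ r) ≀ᵣ Cyc 2)) ∨
    -- (iv)
    (∃ r, 2 ≤ r ∧
      (∃ k, k < 2 ∧ Nonempty
        ((Subgroup.normalizer (Q : Set P) ⧸
          (frattiniCommK3 Q).subgroupOf (Subgroup.normalizer (Q : Set P))) ≃*
            NormalizerQuotientGroup r k)) ∧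
      -- the two possibilities are not isomorphic, and both have order `2^(2(r+1)) ≥ 2^6`
      IsEmpty (NormalizerQuotientGroup r 0 ≃* NormalizerQuotientGroup r 1) ∧
      (∀ k, k < 2 → Nat.card (NormalizerQuotientGroup r k) = 2 ^ (2 * (r + 1))) ∧
      2 ^ 6 ≤ 2 ^ (2 * (r + 1)) ∧
      Nonempty
        ((Subgroup.normalizer (Q : Set P) ⧸
          (⁅Q, Q⁆ : Subgroup P).subgroupOf (Subgroup.normalizer (Q : Set P))) ≃*
            Cyc (2 ^ r) ≀ᵣ Cyc 2) ∧
      Nonempty ((Q ⧸ (frattiniCommK3 Q).subgroupOf Q) ≃* MinimalNonabelianGroup 2 r r) ∧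
      (Nat.card (frattiniCommK3 Q) = 2 →
        (r = 2 → Nonempty (Q ≃* EssentialGroupTwo)) ∧
        (r ≠ 2 → Nonempty (Q ≃* EssentialGroup r)))) := by
  have hQ2 := hP.to_subgroup Q
  have hN := hQ.relIndex_normalizer hP hF hrank
  obtain ⟨α, hα⟩ := hQ.exists_fixesNoFrattiniCoset hP hrank
  obtain ⟨g, hg, hgQ⟩ : ∃ g ∈ Subgroup.normalizer (Q : Set P), g ∉ Q := by
    by_contra! h
    rw [Subgroup.relIndex_eq_one.mpr h] at hN
    omega
  have hQtop : Q ≠ ⊤ := fun h => hgQ (h ▸ Subgroup.mem_top g)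
  have hcent := hQ.centric.centralizer_le
  obtain ⟨r, hr1, hr⟩ := hα.exists_pow_mem_commutator_iff hQ2 hrank
  obtain ⟨x, hx⟩ := hQ.exists_notMem_frattini hP hg hgQ
  obtain ⟨y, a, h⟩ := exists_swapsGenerators hP hrank hN hr hg hgQ hx
  obtain ⟨e⟩ := hQ2.nonempty_abelianization_equiv hrank hr h.left_notMem h.right_notMem
    h.inv_mul_notMem
  have hindex : (commutator Q).index = 2 ^ r * 2 ^ r := by
    rw [Subgroup.index, ← Nat.card_zmod (2 ^ r), ← Nat.card_congr Multiplicative.toAdd,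
      ← Nat.card_prod]
    exact Nat.card_congr e.toEquiv
  have hequiv : commutator Q = ⊥ → Nonempty (Q ≃* Cyc (2 ^ r) × Cyc (2 ^ r)) := fun hab =>
    ⟨QuotientGroup.quotientBot.symm.trans
      ((QuotientGroup.quotientMulEquivOfEq hab.symm).trans e)⟩
  by_cases hab : commutator Q = ⊥
  · obtain ⟨e'⟩ := hequiv hab
    obtain rfl | hr2 : r = 1 ∨ 2 ≤ r := by omega
    · exact Or.inl ⟨⟨e'⟩, hP.dihedral_or_semidihedral_of_four_subgroup e' hcent hQtop⟩
    · exact Or.inr (Or.inr (Or.inl ⟨r, hr2, ⟨e'⟩,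
        h.nonempty_wreathProduct_equiv hP hrank hN hr hindex hr2 hab⟩))
  · obtain rfl | hr2 : r = 1 ∨ 2 ≤ r := by omega
    · obtain ⟨e'⟩ := hα.quaternionGroup_equiv hQ2 hrank hindex hab
      exact Or.inr (Or.inl ⟨⟨e'⟩, hP.quaternion_or_semidihedral_of_quaternion_subgroup e' hcent⟩)
    · obtain ⟨emin⟩ := hα.nonempty_minimalNonabelianGroup_equiv hQ2 hrank hab hr hr2 hindex
      refine Or.inr (Or.inr (Or.inr ⟨r, hr2,
        h.exists_nonempty_normalizerQuotientGroup_equiv hP hrank hα hN hab hr hr2 hindex,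
        normalizerQuotientGroup_isEmpty_mulEquiv hr2,
        fun k _ => normalizerQuotientGroup_card (by omega) k,
        Nat.pow_le_pow_right two_pos (by omega),
        h.nonempty_normalizer_quotient_equiv hP hrank hN hr hindex,
        ⟨(QuotientGroup.quotientMulEquivOfEq (frattiniCommK3_subgroupOf Q)).trans emin⟩,
        fun hcard => ?_⟩))
      rw [← Nat.card_congr (Subgroup.subgroupOfEquivOfLe (frattiniCommK3_le Q)).toEquiv,
        frattiniCommK3_subgroupOf] at hcard
      refine ⟨?_, fun hr3 => hα.nonempty_essentialGroup_equiv hQ2 hrank hab hr (by omega) hindex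
        hcard⟩
      rintro rfl
      exact hα.nonempty_essentialGroupTwo_equiv hQ2 hrank hab hr hindex hcard
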